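/- Let $p$ be a prime and $k$ an algebraic closure of $\mathbf F_p$. Let $n_1,\dots,n_r\ge 1$ be integers, $n=n_1+\dots+n_r$, and let $\sigma$ be the permutation of $\{1,\dots,n\}$ which maps each block $R_m=\{N_{m-1}+1,\dots,N_m\}$, $N_m=n_1+\dots+n_m$, to itself by the cycle $a\mapsto a-1$ (and $N_{m-1}+1\mapsto N_m$). Let $G=\prod_{m=1}^r \mathrm{Res}_{\mathbf F_{p^{n_m}}/\mathbf F_p}\mathrm{SL}_2$, so that $G_k=\mathrm{SL}_{2,k}^n$ with Frobenius $\varphi(x_1,\dots,x_n)=(x_{\sigma(1)}^{(p)},\dots,x_{\sigma(n)}^{(p)})$. Let $B,B_-,T\subset G_k$ be the subgroups of tuples of lower triangular, upper triangular and diagonal matrices; identify $X^*(T)=\mathbf Z^n$ by letting $\lambda=(\lambda_i)$ correspond to $(\mathrm{diag}(t_i,t_i^{-1}))_i\mapsto\prod_i t_i^{\lambda_i}$. Let $$E=\{(x,y)\in B\times B_- : \varphi(\bar x)=\bar y\}$$ ($\bar x,\bar y\in T$ the diagonal parts) act on $G_k$ by $(x,y)\cdot g=xgy^{-1}$, and let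 $\mathcal X=[E\backslash G_k]$ be the stack of $G$-zips for the Borel-type zip datum $(G,B,T,B_-,T,\varphi)$. For $S\subset\{1,\dots,n\}$ let $G_S\subset G_k$ be the set of tuples $(g_i)$ whose upper left entry $(g_i)_{11}$ is non-zero exactly for $i\in S$, let $\mathcal X_S=[E\backslash G_S]$, and let $\mathcal X_S^*$ be its Zariski closure with the reduced structure. A character $\lambda\in X^*(T)$ gives, through the first projection $E\to B\to T$, a line bundle $\mathscr L(\lambda)$ on $\mathcal X$. Let $X$ be a non-empty $k$-scheme with a morphism $\zeta:X\to\mathcal X$. Let $X_S=\zeta^{-1}(\mathcal X_S)$, and let $X_S^*$ be its Zariski closure with the reduced structure. Define the cones $$C_X=\{\lambda : H^0(X,\zeta^*\mathscr L(m\lambda))\ne0\text{ for some }m\ge1\},\quad C_{X,S}=\{\lambda : H^0(X_S^*,\zeta^*\mathscr L(m\lambda))\neq 0\text{ for some }m\ge1\},$$ and similarly $C_{\mathcal X}$ and $C_{\mathcal X,S}$, with $\mathcal X$ and $\mathcal X_S^*$ in place of $X$ and $X_S^*$. Assume that * $\zeta$ is smooth, and its restriction to each connected component of $X$ is surjective onto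 $\mathcal X$; * for every $S\subset\{1,\dots,n\}$ the reduced scheme $X_S^*$ is pseudo-complete, that is, every $h\in H^0(X_S^*,\mathcal O)$ is locally constant. Call a pair $(S',j)$ with $j\in S'\subset R_m$ *admissible* if, after a cyclic translation of $R_m\cong\mathbf Z/n_m\mathbf Z$, it has the form $S'=\{x_1<\dots<x_s\}$ with all differences $x_{i+1}-x_i$ odd and $j=x_s$. Call $S\subset\{1,\dots,n\}$ *$G$-admissible* if for every $m$ and every $j\in S\cap R_m$ the pair $(S\cap R_m,j)$ is admissible. Then: 1. For every $G$-admissible $S$ such that $\zeta$ maps each connected component of $X_S^*$ onto $\mathcal X_S^*$, one has $C_{X,S}=C_{\mathcal X,S}$. (For $S=\{1,\dots,n\}$, where $X_S^*=X$, the condition on components is part of the hypotheses.) 2. In particular, $C_X=C_{\mathcal X}$. 3. If $G$ is $\mathbf F_p$-split, i.e. $n_1=\dots=n_r=1$, then every $S\subset\{1,\dots,n\}$ is $G$-admissible. -/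

import Mathlib

universe u

open AlgebraicGeometry CategoryTheory

noncomputable section

namespace ZipCone

/-! ### The group, the zip group and characters, on points -/

/-- The index set `{1, …, n}`, cut into `r` blocks; block `m` has `d m` consecutive elements. -/
abbrev Idx {r : ℕ} (d : Fin r → ℕ) : Type := Σ m : Fin r, Fin (d m)

/-- The permutation `σ`: on each block it is the cycle `a ↦ a - 1`. -/
def frobPerm {r : ℕ} (d : Fin r → ℕ) : Equiv.Perm (Idx d) :=
  Equiv.sigmaCongrRight fun m => (finRotate (d m)).symm

/-- The `A`-points of `G_k = SL_2 × ⋯ × SL_2` (one factor for each `i : ι`). -/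
abbrev GPts (ι : Type) (A : Type u) [CommRing A] : Type u :=
  ι → Matrix.SpecialLinearGroup (Fin 2) A

/-- The `A`-points of the zip group `E`: pairs `(x, y)` with every `x i` lower triangular, every
`y i` upper triangular, and the torus part of `y` equal to the Frobenius of the torus part of `x`.
The Frobenius of `G` is `(x_i)_i ↦ (x_{σ i}^{(p)})_i`. -/
def zipGroup {ι : Type} (p : ℕ) (σ : Equiv.Perm ι) (A : Type u) [CommRing A] :
    Subgroup (GPts ι A × GPts ι A) where
  carrier := {e | ∀ i, e.1 i 0 1 = 0 ∧ e.2 i 1 0 = 0 ∧ e.2 i 0 0 = e.1 (σ i) 0 0 ^ p}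
  mul_mem' := by
    intro a b ha hb i
    obtain ⟨h1, h2, h3⟩ := ha i
    obtain ⟨h1', h2', h3'⟩ := hb i
    obtain ⟨k1, -, -⟩ := ha (σ i)
    simp [Matrix.mul_apply, Fin.sum_univ_two, h1, h2, h3, h1', h2', h3', k1, mul_pow]
  one_mem' := by
    intro i
    simp
  inv_mem' := by
    intro a ha i
    obtain ⟨h1, h2, h3⟩ := ha i
    obtain ⟨k1, -, -⟩ := ha (σ i)
    have hd : a.2 i 0 0 * a.2 i 1 1 = 1 := by
      have := (a.2 i).det_coe
      rw [Matrix.det_fin_two, h2] at this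
      simpa using this
    have hd' : a.1 (σ i) 0 0 * a.1 (σ i) 1 1 = 1 := by
      have := (a.1 (σ i)).det_coe
      rw [Matrix.det_fin_two, k1] at this
      simpa using this
    refine ⟨?_, ?_, ?_⟩
    · simp [Matrix.SpecialLinearGroup.coe_inv, Matrix.adjugate_fin_two, h1]
    · simp [Matrix.SpecialLinearGroup.coe_inv, Matrix.adjugate_fin_two, h2]
    · simp only [Prod.fst_inv, Prod.snd_inv, Pi.inv_apply, Matrix.SpecialLinearGroup.coe_inv,
        Matrix.adjugate_fin_two]
      have e : (a.1 (σ i) 0 0 * a.1 (σ i) 1 1) ^ p = 1 := by rw [hd', one_pow]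
      rw [mul_pow, ← h3] at e
      simp
      calc a.2 i 1 1 = a.2 i 1 1 * (a.2 i 0 0 * a.1 (σ i) 1 1 ^ p) := by rw [e, mul_one]
        _ = (a.2 i 0 0 * a.2 i 1 1) * a.1 (σ i) 1 1 ^ p := by ring
        _ = a.1 (σ i) 1 1 ^ p := by rw [hd, one_mul]

/-- Functoriality of the points of `E` in the ring. -/
def zipGroupMap {ι : Type} {p : ℕ} {σ : Equiv.Perm ι} {A B : Type u} [CommRing A] [CommRing B]
    (f : A →+* B) (e : zipGroup p σ A) : zipGroup p σ B :=
  ⟨(fun i => Matrix.SpecialLinearGroup.map f (e.1.1 i),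
    fun i => Matrix.SpecialLinearGroup.map f (e.1.2 i)), by
    intro i
    obtain ⟨h1, h2, h3⟩ := e.2 i
    simp [Matrix.SpecialLinearGroup.map_apply_coe, h1, h2, h3]⟩

/-- The `i`-th coordinate of the torus part of the first component of a point of `E`. -/
def torusCoord {ι : Type} {p : ℕ} {σ : Equiv.Perm ι} {A : Type u} [CommRing A]
    (e : zipGroup p σ A) (i : ι) : Aˣ where
  val := e.1.1 i 0 0
  inv := e.1.1 i 1 1
  val_inv := by
    have := (e.1.1 i).det_coe
    rw [Matrix.det_fin_two, (e.2 i).1] at this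
    simpa using this
  inv_val := by
    have := (e.1.1 i).det_coe
    rw [Matrix.det_fin_two, (e.2 i).1] at this
    rw [mul_comm]
    simpa using this

/-- The character `lam ∈ X^*(T) = ℤ^n`, as a character of `E` through the first projection. -/
def character {ι : Type} [Fintype ι] {p : ℕ} {σ : Equiv.Perm ι} {A : Type u} [CommRing A]
    (lam : ι → ℤ) (e : zipGroup p σ A) : Aˣ :=
  ∏ i, torusCoord e i ^ lam i

/-! ### The scheme `G_k` -/

/-- The coordinate ring of `SL_2 × ⋯ × SL_2` over `k`. -/
abbrev CoordRing (k : Type u) [Field k] (ι : Type) : Type u :=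
  MvPolynomial (ι × Fin 2 × Fin 2) k ⧸
    Ideal.span (Set.range fun i : ι =>
      (MvPolynomial.X (i, 0, 0) * MvPolynomial.X (i, 1, 1) -
        MvPolynomial.X (i, 0, 1) * MvPolynomial.X (i, 1, 0) - 1 :
          MvPolynomial (ι × Fin 2 × Fin 2) k))

/-- The universal point of `SL_2 × ⋯ × SL_2`. -/
def genericPt (k : Type u) [Field k] (ι : Type) : GPts ι (CoordRing k ι) := fun i =>
  ⟨Matrix.of fun a b => Ideal.Quotient.mk _ (MvPolynomial.X (i, a, b)), by
    rw [Matrix.det_fin_two]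
    simp only [Matrix.of_apply]
    rw [← map_mul, ← map_mul, ← map_sub, ← map_one (Ideal.Quotient.mk _), Ideal.Quotient.eq]
    exact Ideal.subset_span ⟨i, rfl⟩⟩

/-- `k`-schemes. -/
abbrev KSch (k : Type u) [Field k] : Type (u + 1) := Over (Spec (CommRingCat.of k))

/-- Global functions on a `k`-scheme. -/
abbrev Fn {k : Type u} [Field k] (Y : KSch k) : Type u := Γ(Y.left, ⊤)

/-- Pullback of global functions. -/
abbrev pull {k : Type u} [Field k] {Y Z : KSch k} (f : Y ⟶ Z) : Fn Z →+* Fn Y :=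
  f.left.appTop.hom

/-- The constant functions on a `k`-scheme. -/
def const {k : Type u} [Field k] (Y : KSch k) (c : k) : Fn Y :=
  Y.hom.appTop.hom ((Scheme.ΓSpecIso (CommRingCat.of k)).inv.hom c)

/-- The `k`-scheme `G_k = SL_2 × ⋯ × SL_2`. -/
def GSch (k : Type u) [Field k] (ι : Type) : KSch k :=
  Over.mk (Spec.map (CommRingCat.ofHom (algebraMap k (CoordRing k ι))))

/-- The tuple of matrices of a `T`-point of `G_k`. -/
def mat {k : Type u} [Field k] {ι : Type} {T : KSch k} (g : T ⟶ GSch k ι) : GPts ι (Fn T) :=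
  fun i => Matrix.SpecialLinearGroup.map
    ((pull g).comp (Scheme.ΓSpecIso (CommRingCat.of (CoordRing k ι))).inv.hom) (genericPt k ι i)

/-! ### Morphisms to the stack of `G`-zips -/

/-- A morphism `ζ : X ⟶ [E \ G]`: an `E`-torsor `π : I ⟶ X` (for the fppf topology) with an
`E`-equivariant morphism `q : I ⟶ G`, where `(x, y) ∈ E` acts on `G` by `g ↦ x g y⁻¹`.
The action of the group scheme `E` on `I` is given on `T`-points, naturally in `T`. -/
structure ZipMorphism {k : Type u} [Field k] {ι : Type} (p : ℕ) (σ : Equiv.Perm ι)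
    (X : KSch k) where
  I : KSch k
  π : I ⟶ X
  q : I ⟶ GSch k ι
  act : ∀ {T : KSch k}, zipGroup p σ (Fn T) → (T ⟶ I) → (T ⟶ I)
  act_one : ∀ {T : KSch k} (z : T ⟶ I), act 1 z = z
  act_mul : ∀ {T : KSch k} (e e' : zipGroup p σ (Fn T)) (z : T ⟶ I),
    act (e * e') z = act e (act e' z)
  act_natural : ∀ {T T' : KSch k} (f : T' ⟶ T) (e : zipGroup p σ (Fn T)) (z : T ⟶ I),
    f ≫ act e z = act (zipGroupMap (pull f) e) (f ≫ z)
  act_π : ∀ {T : KSch k} (e : zipGroup p σ (Fn T)) (z : T ⟶ I), act e z ≫ π = z ≫ π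
  act_q : ∀ {T : KSch k} (e : zipGroup p σ (Fn T)) (z : T ⟶ I),
    mat (act e z ≫ q) = e.1.1 * mat (z ≫ q) * e.1.2⁻¹
  simply_transitive : ∀ {T : KSch k} (z z' : T ⟶ I), z ≫ π = z' ≫ π →
    ∃! e : zipGroup p σ (Fn T), act e z = z'
  flat : Flat π.left
  surjective : Surjective π.left
  locallyOfFinitePresentation : LocallyOfFinitePresentation π.left

/-! ### Strata -/

/-- For `g : Y ⟶ G`, the preimage in `Y` of `G_S = ∏ G_{S,i}`, where `G_{S,i}` is the
non-vanishing locus of the upper left entry if `i ∈ S`, and its zero locus if `i ∉ S`. -/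
def preStratum {k : Type u} [Field k] {ι : Type} {Y : KSch k} (g : Y ⟶ GSch k ι)
    (S : Finset ι) : Set Y.left :=
  {y | ∀ i, y ∈ Y.left.basicOpen (mat g i 0 0 : Γ(Y.left, ⊤)) ↔ i ∈ S}

/-- The subset `G_S` of `G`. -/
def groupStratum (k : Type u) [Field k] {ι : Type} (S : Finset ι) : Set (GSch k ι).left :=
  preStratum (𝟙 (GSch k ι)) S

/-- The Zariski closure of a subset, with the reduced structure. -/
def redClosure {k : Type u} [Field k] (Y : KSch k) (s : Set Y.left) : KSch k :=
  Over.mk ((Scheme.IdealSheafData.vanishingIdeal ⟨closure s, isClosed_closure⟩).subschemeι ≫ Y.hom)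

/-- The inclusion of the Zariski closure. -/
def redClosureι {k : Type u} [Field k] (Y : KSch k) (s : Set Y.left) : redClosure Y s ⟶ Y :=
  Over.homMk (Scheme.IdealSheafData.vanishingIdeal ⟨closure s, isClosed_closure⟩).subschemeι rfl

/-- A reduced `k`-scheme is pseudo-complete if all its global functions are locally constant. -/
def PseudoComplete {k : Type u} [Field k] (Y : KSch k) : Prop :=
  IsReduced Y.left ∧ ∀ (h : Γ(Y.left, ⊤)) (y : Y.left), ∃ (U : Y.left.Opens) (c : k), y ∈ U ∧
    Y.left.presheaf.map (homOfLE (le_top : U ≤ ⊤)).op h =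
      Y.left.presheaf.map (homOfLE (le_top : U ≤ ⊤)).op (const Y c)

namespace ZipMorphism

variable {k : Type u} [Field k] {ι : Type} {p : ℕ} {σ : Equiv.Perm ι} {X : KSch k}

/-- The stratum `X_S = ζ⁻¹([E \ G_S])`. -/
def stratum (ζ : ZipMorphism p σ X) (S : Finset ι) : Set X.left :=
  ζ.π.left '' preStratum ζ.q S

/-- The stratum closure `X_S^*`, with the reduced structure. -/
def stratumClosure (ζ : ZipMorphism p σ X) (S : Finset ι) : KSch k :=
  redClosure X (ζ.stratum S)

/-- `ζ` is smooth: its base change along the atlas `G ⟶ [E \ G]`, which is `q`, is smooth. -/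
def IsSmooth (ζ : ZipMorphism p σ X) : Prop := Smooth ζ.q.left

/-- `ζ` maps the subset `Z` of `X` onto the substack `[E \ V]`, for `V` an `E`-stable subset of `G`
that contains the image of `Z` (tested after base change to the atlas `G`). -/
def MapsOnto (ζ : ZipMorphism p σ X) (Z : Set X.left) (V : Set (GSch k ι).left) : Prop :=
  ∀ g ∈ V, ∃ z : ζ.I.left, ζ.π.left z ∈ Z ∧ ζ.q.left z = g

/-- The restriction of the torsor `I` to the stratum closure `X_S^*`. -/
def torsorOver (ζ : ZipMorphism p σ X) (S : Finset ι) : KSch k :=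
  Over.mk (Limits.pullback.fst ζ.π.left (redClosureι X (ζ.stratum S)).left ≫ ζ.I.hom)

/-- The projection of the restricted torsor to `I`. -/
def torsorOverι (ζ : ZipMorphism p σ X) (S : Finset ι) : ζ.torsorOver S ⟶ ζ.I :=
  Over.homMk (Limits.pullback.fst ζ.π.left (redClosureι X (ζ.stratum S)).left) rfl

end ZipMorphism

/-! ### Sections of automorphic line bundles and their cones -/

section Cones

variable {k : Type u} [Field k] {ι : Type} [Fintype ι]

/-- Let `E` act on `J`, with graph `rel` on `T`-points: `rel e z z'` says `e · z = z'`.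
The global sections of the line bundle attached to `lam` on the quotient `[E \ J]` are the functions
`f` on `J` with `f (e · z) = lam(e) f(z)`. -/
def IsSection (p : ℕ) (σ : Equiv.Perm ι) (J : KSch k)
    (rel : ∀ T : KSch k, zipGroup p σ (Fn T) → (T ⟶ J) → (T ⟶ J) → Prop)
    (lam : ι → ℤ) (f : Fn J) : Prop :=
  ∀ (T : KSch k) (e : zipGroup p σ (Fn T)) (z z' : T ⟶ J), rel T e z z' →
    pull z' f = (character lam e : Fn T) * pull z f

/-- The characters `lam` such that some multiple `m • lam`, `m ≥ 1`, has a nonzero global section. -/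
def sectionCone (p : ℕ) (σ : Equiv.Perm ι) (J : KSch k)
    (rel : ∀ T : KSch k, zipGroup p σ (Fn T) → (T ⟶ J) → (T ⟶ J) → Prop) : Set (ι → ℤ) :=
  {lam | ∃ m : ℕ, 1 ≤ m ∧ ∃ f : Fn J, f ≠ 0 ∧ IsSection p σ J rel (m • lam) f}

/-- The cone of `X`. -/
def ZipMorphism.cone {p : ℕ} {σ : Equiv.Perm ι} {X : KSch k} (ζ : ZipMorphism p σ X) :
    Set (ι → ℤ) :=
  sectionCone p σ ζ.I fun _ e z z' => ζ.act e z = z'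

/-- The cone of the stratum closure `X_S^*`. -/
def ZipMorphism.stratumCone {p : ℕ} {σ : Equiv.Perm ι} {X : KSch k} (ζ : ZipMorphism p σ X)
    (S : Finset ι) : Set (ι → ℤ) :=
  sectionCone p σ (ζ.torsorOver S) fun _ e z z' =>
    ζ.act e (z ≫ ζ.torsorOverι S) = z' ≫ ζ.torsorOverι S

variable (k)

/-- The cone of the stack `[E \ G]`. -/
def stackCone (p : ℕ) (σ : Equiv.Perm ι) : Set (ι → ℤ) :=
  sectionCone p σ (GSch k ι) fun _ e z z' => mat z' = e.1.1 * mat z * e.1.2⁻¹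

/-- The cone of the closed substack `[E \ G_S^*]`, where `G_S^*` is the closure of `G_S` with the
reduced structure. -/
def stackStratumCone (p : ℕ) (σ : Equiv.Perm ι) (S : Finset ι) : Set (ι → ℤ) :=
  sectionCone p σ (redClosure (GSch k ι) (groupStratum k S)) fun _ e z z' =>
    mat (z' ≫ redClosureι _ _) = e.1.1 * mat (z ≫ redClosureι _ _) * e.1.2⁻¹

end Cones

/-! ### Admissible subsets -/

/-- `S = {x_1 < ⋯ < x_s}` with all `x_{i+1} - x_i` odd, and `j = x_s`. -/
def IsNormalizedAdmissiblePair {d : ℕ} (S : Finset (Fin d)) (j : Fin d) : Prop :=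
  j ∈ S ∧ (∀ x ∈ S, x ≤ j) ∧
    ∀ x ∈ S, ∀ y ∈ S, x < y → (∀ z ∈ S, ¬ (x < z ∧ z < y)) → Odd ((y : ℤ) - (x : ℤ))

/-- Some cyclic translate of `(S, j)` is a normalized admissible pair. -/
def IsAdmissiblePair {d : ℕ} (S : Finset (Fin d)) (j : Fin d) : Prop :=
  ∃ c : ℕ, IsNormalizedAdmissiblePair (S.map (finRotate d ^ c).toEmbedding) ((finRotate d ^ c) j)

/-- The part of `S` in the block `m`. -/
def block {r : ℕ} {d : Fin r → ℕ} (S : Finset (Idx d)) (m : Fin r) : Finset (Fin (d m)) :=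
  Finset.univ.filter fun a => (⟨m, a⟩ : Idx d) ∈ S

/-- `S` is `G`-admissible if for every `j ∈ S`, say in the block `m`, the pair `(S_m, j)` is
admissible. -/
def IsGAdmissible {r : ℕ} {d : Fin r → ℕ} (S : Finset (Idx d)) : Prop :=
  ∀ j ∈ S, IsAdmissiblePair (block S j.1) j.2

end ZipCone

end

/-
The weight of the upper left entry `(g_i)₁₁` is the partial Hasse weight `e_i - p e_{σ i}`, and
where this entry vanishes, the upper right entry is a unit of weight `e_i + p e_{σ i}`. For a given
`S`, the former for `i ∈ S` and the latter for `i ∉ S` form a basis of the rational characters. The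
cone of the stack contains every `λ` whose coordinates in this basis are non-negative on `S`, and it
is contained in the cone of `X` by pullback along `ζ`. Hence everything comes down to the
non-negativity of the coordinates of the weight of a non-zero section on the stratum closure.

Dividing the section by the upper left entries with `i ∈ S` as often as possible, one may restrict
it to the smaller closures without annihilating it. For `S = {i}` a negative coordinate would make
it possible to produce, on multiplication by powers of the entries, a non-zero function vanishing
on the smallest stratum, contrary to pseudo-completeness. For a larger admissible `S` a negative
`j`-th coordinate is refuted by comparison with the sets `S ∖ {x}`: the parity condition aligns the
signs in the bounds that they provide. To keep the restrictions non-zero, the argument takes place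
on the open subset of the torsor that remains after removal of those components of closed strata
which do not meet the smallest stratum.
-/

noncomputable section

namespace ZipCone

/-! ### Weights of sections and their coordinates -/

section Coordinates

variable {ι : Type}

/-- The element `σ⁻⁽ⁿ⁺¹⁾ j` of the cycle of `j`. The shift by one lists the cycle, for
`n < cycleLen σ j`, with `j` itself in the last place. -/
def cycleElem (σ : Equiv.Perm ι) (j : ι) (n : ℕ) : ι := σ.symm^[n + 1] j

/-- The length of the cycle of `j` under `σ`. -/
def cycleLen (σ : Equiv.Perm ι) (j : ι) : ℕ := Function.minimalPeriod σ.symm j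

section Cycle

variable (σ : Equiv.Perm ι) (j : ι)

lemma cycleElem_injOn : Set.InjOn (cycleElem σ j) (Set.Iio (cycleLen σ j)) := by
  intro a ha b hb h
  rw [cycleElem, cycleElem, Function.iterate_succ_apply', Function.iterate_succ_apply'] at h
  exact Function.iterate_injOn_Iio_minimalPeriod ha hb (σ.symm.injective h)

lemma cycleElem_cycleElem (t n : ℕ) :
    cycleElem σ (cycleElem σ j t) n = cycleElem σ j (t + 1 + n) := by
  simp only [cycleElem, ← Function.iterate_add_apply]
  rw [show n + 1 + (t + 1) = t + 1 + n + 1 by omega]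

variable [Finite ι]

lemma cycleLen_pos : 0 < cycleLen σ j :=
  Function.minimalPeriod_pos_of_mem_periodicPts
    (Function.Injective.mem_periodicPts σ.symm.injective j)

lemma cycleElem_cycleLen_sub_one : cycleElem σ j (cycleLen σ j - 1) = j := by
  rw [cycleElem, Nat.sub_add_cancel (cycleLen_pos σ j)]
  exact Function.iterate_minimalPeriod

lemma cycleLen_cycleElem (t : ℕ) : cycleLen σ (cycleElem σ j t) = cycleLen σ j :=
  Function.minimalPeriod_apply_iterate (Function.Injective.mem_periodicPts σ.symm.injective j) _

lemma cycleElem_cycleElem_last {t : ℕ} (ht : t + 1 < cycleLen σ j) :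
    cycleElem σ (cycleElem σ j t) (cycleLen σ j - 2 - t) = j := by
  rw [cycleElem_cycleElem, show t + 1 + (cycleLen σ j - 2 - t) = cycleLen σ j - 1 by omega,
    cycleElem_cycleLen_sub_one]

lemma cycleElem_ne_self {x : ℕ} (hx : x + 1 < cycleLen σ j) : cycleElem σ j x ≠ j := by
  intro e
  have := cycleElem_injOn σ j (Set.mem_Iio.mpr (by omega)) (Set.mem_Iio.mpr (by omega))
    (e.trans (cycleElem_cycleLen_sub_one σ j).symm)
  omega

lemma exists_cycleElem_eq (n : ℕ) : ∃ m < cycleLen σ j, cycleElem σ j m = cycleElem σ j n := by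
  refine ⟨n % cycleLen σ j, Nat.mod_lt _ (cycleLen_pos σ j), ?_⟩
  rw [cycleElem, cycleElem, Function.iterate_succ_apply', Function.iterate_succ_apply', cycleLen,
    Function.iterate_mod_minimalPeriod_eq]

lemma two_le_pow_cycleLen {p : ℕ} (hp : 2 ≤ p) : (2 : ℚ) ≤ p ^ cycleLen σ j := by
  exact_mod_cast hp.trans (Nat.le_self_pow (cycleLen_pos σ j).ne' p)

end Cycle

variable [DecidableEq ι]

/-- The sign `+1` on `S` and `-1` off `S`. -/
def sgn (S : Finset ι) (i : ι) : ℚ := if i ∈ S then 1 else -1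

lemma sgn_of_mem {S : Finset ι} {i : ι} (h : i ∈ S) : sgn S i = 1 := if_pos h

lemma sgn_of_notMem {S : Finset ι} {i : ι} (h : i ∉ S) : sgn S i = -1 := if_neg h

lemma sgn_mul_self (S : Finset ι) (i : ι) : sgn S i * sgn S i = 1 := by
  unfold sgn; split_ifs <;> norm_num

/-- The weight `e_i - p e_{σ i}` of the upper left entry of the `i`-th matrix, the `i`-th partial
Hasse invariant. -/
def hasseWeight (p : ℕ) (σ : Equiv.Perm ι) (i : ι) : ι → ℤ :=
  Pi.single i 1 - (p : ℤ) • Pi.single (σ i) 1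

lemma hasseWeight_apply (p : ℕ) (σ : Equiv.Perm ι) (l i : ι) :
    hasseWeight p σ l i = (if i = l then 1 else 0) - p * (if σ.symm i = l then 1 else 0) := by
  have : (i = σ l) ↔ (σ.symm i = l) := by rw [Equiv.symm_apply_eq]
  simp [hasseWeight, Pi.single_apply, this]

/-- `c` are the coordinates of `lam` in the basis `e_i - p e_{σ i}` (`i ∈ S`),
`e_i + p e_{σ i}` (`i ∉ S`). These are the weights of the sections without zeros on the stratum
of `S`: the upper left entries for `i ∈ S` and the upper right entries for `i ∉ S`. -/
def IsCoord (p : ℕ) (σ : Equiv.Perm ι) (S : Finset ι) (lam : ι → ℤ) (c : ι → ℚ) : Prop :=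
  ∀ i, (lam i : ℚ) = c i - p * sgn S (σ.symm i) * c (σ.symm i)

section Coord

variable {p : ℕ} {σ : Equiv.Perm ι} {S S' : Finset ι} {lam : ι → ℤ} {c c' : ι → ℚ}

lemma exists_isCoord [Finite ι] (hp : 2 ≤ p) (σ : Equiv.Perm ι) (S : Finset ι) (lam : ι → ℤ) :
    ∃ c, IsCoord p σ S lam c := by
  let M : (ι → ℚ) →ₗ[ℚ] (ι → ℚ) :=
    { toFun := fun c i => c i - p * sgn S (σ.symm i) * c (σ.symm i)
      map_add' := fun c c' => by ext i; simp only [Pi.add_apply]; ring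
      map_smul' := fun a c => by
        ext i; simp only [Pi.smul_apply, smul_eq_mul, RingHom.id_apply]; ring }
  suffices hinj : Function.Injective M by
    obtain ⟨c, hc⟩ := (LinearMap.injective_iff_surjective.mp hinj) fun i => (lam i : ℚ)
    exact ⟨c, fun i => (congrFun hc i).symm⟩
  rw [← LinearMap.ker_eq_bot, LinearMap.ker_eq_bot']
  intro c hc
  have habs : ∀ i, |c (σ i)| = p * |c i| := fun i => by
    have hi := congrFun hc (σ i)
    simp only [M, LinearMap.coe_mk, AddHom.coe_mk, Equiv.symm_apply_apply, Pi.zero_apply] at hi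
    have hs : |sgn S i| = 1 := by unfold sgn; split_ifs <;> simp
    rw [sub_eq_zero.mp hi, abs_mul, abs_mul, hs, mul_one, Nat.abs_cast]
  rcases isEmpty_or_nonempty ι with h | h
  · exact Subsingleton.elim _ _
  obtain ⟨i, hi⟩ := Finite.exists_max fun i => |c i|
  have hmax : |c i| = 0 := by
    have hp' : (2 : ℚ) ≤ p := by exact_mod_cast hp
    nlinarith [hi (σ i), habs i, abs_nonneg (c i)]
  exact funext fun l => abs_nonpos_iff.mp (hmax ▸ hi l)

lemma IsCoord.nsmul (h : IsCoord p σ S lam c) (m : ℕ) :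
    IsCoord p σ S (m • lam) fun i => m * c i := fun i => by
  simp only [Pi.smul_apply, nsmul_eq_mul, Int.cast_mul, Int.cast_natCast, h i]
  ring

lemma IsCoord.sub_hasseWeight (h : IsCoord p σ S lam c) (hS : S' ⊆ S) (a : ι → ℕ) :
    IsCoord p σ S (lam - ∑ l ∈ S', a l • hasseWeight p σ l)
      (fun i => c i - if i ∈ S' then (a i : ℚ) else 0) := by
  intro i
  have hsum : (∑ l ∈ S', a l • hasseWeight p σ l) i = (if i ∈ S' then (a i : ℤ) else 0) -
      p * (if σ.symm i ∈ S' then (a (σ.symm i) : ℤ) else 0) := by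
    simp [Finset.sum_apply, hasseWeight_apply, mul_sub, Finset.sum_sub_distrib,
      mul_comm, Finset.sum_ite_eq]
  rw [Pi.sub_apply, hsum]
  push_cast
  rw [h i]
  by_cases hi : σ.symm i ∈ S'
  · simp only [sgn_of_mem (hS hi), hi, if_true]; ring
  · simp only [hi, if_false]; ring

/-- The product of the signs of the first `n` elements of the cycle of `j`. -/
def gapSign (σ : Equiv.Perm ι) (S : Finset ι) (j : ι) (n : ℕ) : ℚ :=
  ∏ y ∈ Finset.range n, sgn S (cycleElem σ j y)

lemma gapSign_zero (σ : Equiv.Perm ι) (S : Finset ι) (j : ι) : gapSign σ S j 0 = 1 :=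
  Finset.prod_range_zero _

lemma gapSign_succ (σ : Equiv.Perm ι) (S : Finset ι) (j : ι) (n : ℕ) :
    gapSign σ S j (n + 1) = gapSign σ S j n * sgn S (cycleElem σ j n) :=
  Finset.prod_range_succ _ n

lemma gapSign_mul_self (σ : Equiv.Perm ι) (S : Finset ι) (j : ι) (n : ℕ) :
    gapSign σ S j n * gapSign σ S j n = 1 := by
  rw [gapSign, ← Finset.prod_mul_distrib, Finset.prod_congr rfl fun _ _ => sgn_mul_self S _,
    Finset.prod_const_one]

lemma gapSign_add (σ : Equiv.Perm ι) (S : Finset ι) (j : ι) (t n : ℕ) :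
    gapSign σ S j (t + 1 + n) =
      gapSign σ S j (t + 1) * gapSign σ S (cycleElem σ j t) n := by
  simp only [gapSign, Finset.prod_range_add, cycleElem_cycleElem]

lemma gapSign_erase (σ : Equiv.Perm ι) (S : Finset ι) (j : ι) {x n : ℕ}
    (hx : x < cycleLen σ j) (hn : n ≤ cycleLen σ j) (hxS : cycleElem σ j x ∈ S) :
    gapSign σ (S.erase (cycleElem σ j x)) j n = (if x < n then -1 else 1) * gapSign σ S j n := by
  induction n with
  | zero => simp [gapSign_zero]
  | succ n ih =>
    rw [gapSign_succ, gapSign_succ, ih (by omega)]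
    rcases eq_or_ne n x with rfl | hnx
    · simp [sgn, hxS]
    · have hne : cycleElem σ j n ≠ cycleElem σ j x := fun e => hnx (cycleElem_injOn σ j hn hx e)
      have hlt : x < n + 1 ↔ x < n := by omega
      simp only [sgn, Finset.mem_erase, hne, ne_eq, not_false_eq_true, true_and, hlt, mul_assoc]

lemma gapSign_erase_of_forall_ne (σ : Equiv.Perm ι) (S : Finset ι) {j i : ι}
    (hi : ∀ n, cycleElem σ j n ≠ i) (n : ℕ) : gapSign σ (S.erase i) j n = gapSign σ S j n :=
  Finset.prod_congr rfl fun y _ => by simp [sgn, hi y]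

/-- The product of the signs of all elements of the cycle of `j`. -/
def cycleSign (σ : Equiv.Perm ι) (S : Finset ι) (j : ι) : ℚ := gapSign σ S j (cycleLen σ j)

lemma cycleSign_eq_one_or (σ : Equiv.Perm ι) (S : Finset ι) (j : ι) :
    cycleSign σ S j = 1 ∨ cycleSign σ S j = -1 :=
  mul_self_eq_one_iff.mp (gapSign_mul_self σ S j _)

lemma cycleSign_erase (σ : Equiv.Perm ι) (S : Finset ι) (j : ι) {x : ℕ}
    (hx : x < cycleLen σ j) (hxS : cycleElem σ j x ∈ S) :
    cycleSign σ (S.erase (cycleElem σ j x)) j = -cycleSign σ S j := by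
  rw [cycleSign, gapSign_erase σ S j hx le_rfl hxS, if_pos hx, neg_one_mul, cycleSign]

lemma IsCoord.sub_eq (hS : S' ⊆ S) (h : IsCoord p σ S lam c) (h' : IsCoord p σ S' lam c')
    (j : ι) (N : ℕ) :
    c' j - c j = p ^ N * gapSign σ S' j N * (c' (σ.symm^[N] j) - c (σ.symm^[N] j)) -
      2 * ∑ n ∈ Finset.range N, if cycleElem σ j n ∈ S \ S' then
        p ^ (n + 1) * gapSign σ S' j n * c (cycleElem σ j n) else 0 := by
  induction N with
  | zero => simp [gapSign_zero]
  | succ N ih =>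
    have hN := h (σ.symm^[N] j)
    have hN' := h' (σ.symm^[N] j)
    rw [← Function.iterate_succ_apply' σ.symm N j, ← cycleElem] at hN hN'
    rw [ih, Finset.sum_range_succ, gapSign_succ, ← cycleElem]
    set i := cycleElem σ j N
    have hstep : c' (σ.symm^[N] j) - c (σ.symm^[N] j) =
        p * sgn S' i * (c' i - c i) - p * (sgn S i - sgn S' i) * c i := by
      rw [hN] at hN'
      linear_combination -hN'
    rw [hstep]
    by_cases hi' : i ∈ S'
    · simp only [sgn_of_mem hi', sgn_of_mem (hS hi'), Finset.mem_sdiff, hi', not_true, and_false,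
        if_false]
      ring
    by_cases hi : i ∈ S
    · simp only [sgn_of_mem hi, sgn_of_notMem hi', Finset.mem_sdiff, hi, hi', not_false_eq_true,
        and_self, if_true]
      ring
    · simp only [sgn_of_notMem hi, sgn_of_notMem hi', Finset.mem_sdiff, hi, false_and, if_false]
      ring

lemma IsCoord.one_sub_mul_sub_eq (hS : S' ⊆ S) (h : IsCoord p σ S lam c)
    (h' : IsCoord p σ S' lam c') (j : ι) :
    (1 - p ^ cycleLen σ j * cycleSign σ S' j) * (c' j - c j) =
      -2 * ∑ n ∈ Finset.range (cycleLen σ j), if cycleElem σ j n ∈ S \ S' then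
        p ^ (n + 1) * gapSign σ S' j n * c (cycleElem σ j n) else 0 := by
  have hN := h.sub_eq hS h' j (cycleLen σ j)
  rw [show σ.symm^[cycleLen σ j] j = j from Function.iterate_minimalPeriod] at hN
  unfold cycleSign
  linear_combination hN

lemma IsCoord.erase (h : IsCoord p σ S lam c) {j : ι} {x : ℕ} (hx : x < cycleLen σ j)
    (hxS : cycleElem σ j x ∈ S) (h' : IsCoord p σ (S.erase (cycleElem σ j x)) lam c') :
    (1 + p ^ cycleLen σ j * cycleSign σ S j) * (c' j - c j) =
      -2 * (p ^ (x + 1) * gapSign σ S j x * c (cycleElem σ j x)) := by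
  have hc := h.one_sub_mul_sub_eq (Finset.erase_subset _ S) h' j
  rw [cycleSign_erase σ S j hx hxS, Finset.sum_eq_single_of_mem x (Finset.mem_range.mpr hx),
    if_pos (by simp [hxS]), gapSign_erase σ S j hx hx.le hxS, if_neg (lt_irrefl x), one_mul] at hc
  · linear_combination hc
  · intro n hn hne
    refine if_neg fun hmem => hne (cycleElem_injOn σ j (Finset.mem_range.mp hn) hx ?_)
    by_contra hne'
    simp [hne'] at hmem

lemma IsCoord.erase_of_forall_ne [Finite ι] (hp : 2 ≤ p) (h : IsCoord p σ S lam c) {j i : ι}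
    (hi : ∀ n, cycleElem σ j n ≠ i) (h' : IsCoord p σ (S.erase i) lam c') : c' j = c j := by
  have hc := h.one_sub_mul_sub_eq (Finset.erase_subset i S) h' j
  rw [Finset.sum_eq_zero fun n _ => if_neg (by simp [hi n]), mul_zero, mul_eq_zero] at hc
  have hq := two_le_pow_cycleLen σ j hp
  rcases hc with hc | hc
  · rcases cycleSign_eq_one_or σ (S.erase i) j with hs | hs <;> rw [hs] at hc <;> linarith
  · linarith

lemma IsCoord.erase_erase (h : IsCoord p σ S lam c) {j : ι} {x y : ℕ} (hyx : y < x)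
    (hx : x < cycleLen σ j) (hxS : cycleElem σ j x ∈ S) (hyS : cycleElem σ j y ∈ S)
    (h' : IsCoord p σ ((S.erase (cycleElem σ j x)).erase (cycleElem σ j y)) lam c') :
    (1 - p ^ cycleLen σ j * cycleSign σ S j) * (c' j - c j) =
      2 * (p ^ (x + 1) * gapSign σ S j x * c (cycleElem σ j x) -
        p ^ (y + 1) * gapSign σ S j y * c (cycleElem σ j y)) := by
  have hy := hyx.trans hx
  have hyS' : cycleElem σ j y ∈ S.erase (cycleElem σ j x) :=
    Finset.mem_erase.mpr ⟨fun e => hyx.ne (cycleElem_injOn σ j hy hx e), hyS⟩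
  have hc := h.one_sub_mul_sub_eq ((Finset.erase_subset _ _).trans (Finset.erase_subset _ S)) h' j
  rw [cycleSign_erase σ _ j hy hyS', cycleSign_erase σ S j hx hxS, Finset.sum_eq_add_of_mem x y
    (Finset.mem_range.mpr hx) (Finset.mem_range.mpr hy) hyx.ne', if_pos (by simp [hxS]),
    if_pos (by simp [hyS]), gapSign_erase σ _ j hy hx.le hyS', gapSign_erase σ S j hx hx.le hxS,
    gapSign_erase σ _ j hy hy.le hyS', gapSign_erase σ S j hx hy.le hxS, if_pos hyx,
    if_neg (lt_irrefl x), if_neg (lt_irrefl y), if_neg hyx.not_gt] at hc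
  · linear_combination hc
  · rintro n hn ⟨hnx, hny⟩
    refine if_neg fun hmem => ?_
    have hnx' : cycleElem σ j n ≠ cycleElem σ j x := fun e =>
      hnx (cycleElem_injOn σ j (Finset.mem_range.mp hn) hx e)
    have hny' : cycleElem σ j n ≠ cycleElem σ j y := fun e =>
      hny (cycleElem_injOn σ j (Finset.mem_range.mp hn) hy e)
    simp [hnx', hny'] at hmem

end Coord

end Coordinates

/-! ### Admissible pairs and non-negative coordinates -/

section SignAdmissible

variable {ι : Type} [DecidableEq ι]

/-- The form of admissibility used by the descent on `S`, for any permutation `σ`: the product of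
the signs preceding an element of `S`, in the cycle of `j` listed from the successor of `j` on, is
the same for all elements of `S` in that cycle. -/
structure IsSignAdmissible (σ : Equiv.Perm ι) (S : Finset ι) (j : ι) : Prop where
  mem : j ∈ S
  gapSign_eq : ∀ n < cycleLen σ j, cycleElem σ j n ∈ S → gapSign σ S j n = cycleSign σ S j

lemma isSignAdmissible_univ [Fintype ι] (σ : Equiv.Perm ι) (j : ι) :
    IsSignAdmissible σ Finset.univ j where
  mem := Finset.mem_univ j
  gapSign_eq n _ _ := by simp [cycleSign, gapSign, sgn]

section Erase

variable {σ : Equiv.Perm ι} {S : Finset ι} {j : ι}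

lemma cycleElem_mem_erase {n x : ℕ} (hn : n < cycleLen σ j) (hx : x < cycleLen σ j) :
    cycleElem σ j n ∈ S.erase (cycleElem σ j x) ↔ n ≠ x ∧ cycleElem σ j n ∈ S := by
  rw [Finset.mem_erase, ne_eq, (cycleElem_injOn σ j).eq_iff hn hx]

variable [Finite ι]

lemma gapSign_cycleLen_add (σ : Equiv.Perm ι) (S : Finset ι) (j : ι) (m : ℕ) :
    gapSign σ S j (cycleLen σ j + m) = cycleSign σ S j * gapSign σ S j m := by
  have h := gapSign_add σ S j (cycleLen σ j - 1) m
  rwa [Nat.sub_add_cancel (cycleLen_pos σ j), cycleElem_cycleLen_sub_one] at h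

lemma cycleSign_cycleElem (σ : Equiv.Perm ι) (S : Finset ι) (j : ι) (t : ℕ) :
    cycleSign σ S (cycleElem σ j t) = cycleSign σ S j := by
  have hne : gapSign σ S j (t + 1) ≠ 0 := left_ne_zero_of_mul_eq_one (gapSign_mul_self σ S j _)
  refine mul_left_cancel₀ hne ?_
  rw [cycleSign, cycleLen_cycleElem, ← gapSign_add, add_comm, gapSign_cycleLen_add, mul_comm]

namespace IsSignAdmissible

lemma erase_of_forall_ne (h : IsSignAdmissible σ S j) {i : ι}
    (hi : ∀ n, cycleElem σ j n ≠ i) : IsSignAdmissible σ (S.erase i) j where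
  mem := Finset.mem_erase.mpr ⟨cycleElem_cycleLen_sub_one σ j ▸ hi _, h.mem⟩
  gapSign_eq n hn hnS := by
    rw [cycleSign, gapSign_erase_of_forall_ne σ S hi, gapSign_erase_of_forall_ne σ S hi]
    exact h.gapSign_eq n hn (Finset.mem_of_mem_erase hnS)

lemma erase_first (h : IsSignAdmissible σ S j) {x : ℕ} (hx : x + 1 < cycleLen σ j)
    (hxS : cycleElem σ j x ∈ S) (hfirst : ∀ n < x, cycleElem σ j n ∉ S) :
    IsSignAdmissible σ (S.erase (cycleElem σ j x)) j where
  mem := Finset.mem_erase.mpr ⟨(cycleElem_ne_self σ j hx).symm, h.mem⟩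
  gapSign_eq n hn hnS := by
    obtain ⟨hne, hnS⟩ := (cycleElem_mem_erase hn (by omega)).mp hnS
    have hxn : x < n := (Nat.lt_or_gt_of_ne hne).resolve_left fun hlt => hfirst n hlt hnS
    rw [gapSign_erase σ S j (by omega) hn.le hxS, if_pos hxn, neg_one_mul,
      cycleSign_erase σ S j (by omega) hxS, h.gapSign_eq n hn hnS]

lemma erase_consecutive (h : IsSignAdmissible σ S j) {x y : ℕ} (hyx : y < x)
    (hx : x + 1 < cycleLen σ j) (hxS : cycleElem σ j x ∈ S) (hyS : cycleElem σ j y ∈ S)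
    (hgap : ∀ n, y < n → n < x → cycleElem σ j n ∉ S) :
    IsSignAdmissible σ ((S.erase (cycleElem σ j x)).erase (cycleElem σ j y)) j := by
  have hx' : x < cycleLen σ j := by omega
  have hy' : y < cycleLen σ j := by omega
  have hyS' := (cycleElem_mem_erase hy' hx').mpr ⟨hyx.ne, hyS⟩
  refine ⟨Finset.mem_erase.mpr ⟨(cycleElem_ne_self σ j (by omega)).symm,
    Finset.mem_erase.mpr ⟨(cycleElem_ne_self σ j hx).symm, h.mem⟩⟩, fun n hn hnS => ?_⟩
  rw [cycleElem_mem_erase hn hy', cycleElem_mem_erase hn hx'] at hnS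
  obtain ⟨-, hnx, hnS⟩ := hnS
  have hiff : y < n ↔ x < n :=
    ⟨fun hlt => (Nat.lt_or_gt_of_ne hnx).resolve_left fun hgt => hgap n hlt hgt hnS, hyx.trans⟩
  rw [cycleSign_erase σ _ j hy' hyS', cycleSign_erase σ S j hx' hxS, neg_neg,
    ← h.gapSign_eq n hn hnS, gapSign_erase σ _ j hy' hn.le hyS',
    gapSign_erase σ S j hx' hn.le hxS]
  simp only [hiff]
  split_ifs <;> ring

variable {t : ℕ}

lemma gapSign_cycleElem (h : IsSignAdmissible σ S j) (ht : t + 1 < cycleLen σ j)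
    (htS : cycleElem σ j t ∈ S) (m : ℕ) :
    gapSign σ S (cycleElem σ j t) (cycleLen σ j - 1 - t + m) = gapSign σ S j m := by
  have hne : cycleSign σ S j ≠ 0 := left_ne_zero_of_mul_eq_one (gapSign_mul_self σ S j _)
  have hadd := gapSign_add σ S j t (cycleLen σ j - 1 - t + m)
  rw [show t + 1 + (cycleLen σ j - 1 - t + m) = cycleLen σ j + m by omega, gapSign_cycleLen_add,
    gapSign_succ, sgn_of_mem htS, mul_one, h.gapSign_eq t (by omega) htS] at hadd
  exact (mul_left_cancel₀ hne hadd).symm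

lemma erase_self (h : IsSignAdmissible σ S j) (ht : t + 1 < cycleLen σ j)
    (htS : cycleElem σ j t ∈ S)
    (hlast : ∀ n, t < n → n + 1 < cycleLen σ j → cycleElem σ j n ∉ S) :
    IsSignAdmissible σ (S.erase j) (cycleElem σ j t) := by
  have hj := cycleElem_cycleElem_last σ j ht
  have hlen := cycleLen_cycleElem σ j t
  refine ⟨Finset.mem_erase.mpr ⟨cycleElem_ne_self σ j ht, htS⟩, fun n hn hnS => ?_⟩
  rw [hlen] at hn
  have hle : cycleLen σ j - 1 - t ≤ n := by
    by_contra hlt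
    rcases Nat.lt_or_ge (t + 1 + n + 1) (cycleLen σ j) with hn' | hn'
    · rw [cycleElem_cycleElem] at hnS
      exact hlast _ (by omega) hn' (Finset.mem_of_mem_erase hnS)
    · rw [show n = cycleLen σ j - 2 - t by omega, hj] at hnS
      exact Finset.notMem_erase j S hnS
  obtain ⟨m, rfl⟩ := Nat.exists_eq_add_of_le hle
  have hmS : cycleElem σ j m ∈ S := by
    rw [cycleElem_cycleElem, show t + 1 + (cycleLen σ j - 1 - t + m) = cycleLen σ j - 1 + 1 + m by
      omega, ← cycleElem_cycleElem, cycleElem_cycleLen_sub_one] at hnS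
    exact Finset.mem_of_mem_erase hnS
  have hx : cycleLen σ j - 2 - t < cycleLen σ (cycleElem σ j t) := by omega
  have hjS : cycleElem σ (cycleElem σ j t) (cycleLen σ j - 2 - t) ∈ S := hj.symm ▸ h.mem
  have hsign := cycleSign_erase σ S _ hx hjS
  have hgap := gapSign_erase σ S _ hx (hn.le.trans hlen.ge) hjS
  rw [hj] at hsign hgap
  rw [hsign, hgap, if_pos (by omega), neg_one_mul, cycleSign_cycleElem,
    h.gapSign_cycleElem ht htS, h.gapSign_eq m (by omega) hmS]

lemma isCoord_erase_self {p : ℕ} {lam : ι → ℤ} {c c' : ι → ℚ} (h : IsSignAdmissible σ S j)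
    (ht : t + 1 < cycleLen σ j) (htS : cycleElem σ j t ∈ S) (hc : IsCoord p σ S lam c)
    (hc' : IsCoord p σ (S.erase j) lam c') :
    (1 + p ^ cycleLen σ j * cycleSign σ S j) * (c' (cycleElem σ j t) - c (cycleElem σ j t)) =
      -2 * (p ^ (cycleLen σ j - 1 - t) * c j) := by
  have hj := cycleElem_cycleElem_last σ j ht
  have hgap := h.gapSign_cycleElem ht htS 0
  rw [show cycleLen σ j - 1 - t + 0 = cycleLen σ j - 2 - t + 1 by omega, gapSign_zero,
    gapSign_succ, hj, sgn_of_mem h.mem, mul_one] at hgap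
  have hd := hc.erase (j := cycleElem σ j t) (x := cycleLen σ j - 2 - t) (c' := c')
    (by rw [cycleLen_cycleElem]; omega) (hj.symm ▸ h.mem) (hj.symm ▸ hc')
  rwa [cycleLen_cycleElem, cycleSign_cycleElem, hj, hgap, mul_one,
    show cycleLen σ j - 2 - t + 1 = cycleLen σ j - 1 - t by omega] at hd

end IsSignAdmissible

end Erase

section Nonneg

variable {p : ℕ} {σ : Equiv.Perm ι} {C : Finset ι → Set (ι → ℤ)} {S : Finset ι} {j : ι}

variable (p σ C) in
/-- The sets of weights `C S` allow division by partial Hasse invariants: a weight in `C S` can be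
diminished by a combination of the Hasse weights in `S` so as to lie in all `C (S.erase i)`. On
sections this is division by the equations of the boundary strata, followed by restriction. -/
def HasseDivisible : Prop :=
  ∀ S, ∀ lam ∈ C S, ∃ a : ι → ℕ, ∀ i ∈ S,
    lam - ∑ l ∈ S, a l • hasseWeight p σ l ∈ C (S.erase i)

variable (p σ C S j) in
/-- All weights in `C S` have a non-negative `j`-th coordinate. -/
def CoordNonneg : Prop :=
  ∀ lam ∈ C S, ∀ c, IsCoord p σ S lam c → 0 ≤ c j

lemma HasseDivisible.exists_isCoord_le (hC : HasseDivisible p σ C) {S' : Finset ι} (hS : S' ⊆ S)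
    {lam : ι → ℤ} (hlam : lam ∈ C S') {c : ι → ℚ} (hc : IsCoord p σ S lam c) :
    ∃ mu b, (∀ i ∈ S', mu ∈ C (S'.erase i)) ∧ IsCoord p σ S mu b ∧ (∀ i, b i ≤ c i) ∧
      ∀ i ∉ S', b i = c i := by
  obtain ⟨a, ha⟩ := hC S' lam hlam
  refine ⟨_, _, ha, hc.sub_hasseWeight hS a, fun i => ?_, fun i hi => by simp [hi]⟩
  rw [sub_le_self_iff]
  positivity

variable [Finite ι]

lemma CoordNonneg.of_erase (hp : 2 ≤ p) (hC : HasseDivisible p σ C) {i : ι} (hi : i ∈ S)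
    (hij : ∀ n, cycleElem σ j n ≠ i) (h : CoordNonneg p σ C (S.erase i) j) :
    CoordNonneg p σ C S j := by
  intro lam hlam c hc
  obtain ⟨mu, b, hmu, hb, hbc, -⟩ := hC.exists_isCoord_le subset_rfl hlam hc
  obtain ⟨c', hc'⟩ := exists_isCoord hp σ (S.erase i) mu
  exact (h mu (hmu i hi) c' hc').trans
    ((hb.erase_of_forall_ne hp hij hc').trans_le (hbc j))

lemma exists_lt_forall_not {P : ℕ → Prop} {n x : ℕ} (hnx : n < x) (hn : P n) :
    ∃ y < x, P y ∧ ∀ z, y < z → z < x → ¬ P z := by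
  classical
  refine ⟨Nat.findGreatest P (x - 1), ?_, Nat.findGreatest_spec (by omega) hn, fun z hz hzx =>
    Nat.findGreatest_is_greatest hz (by omega)⟩
  have := Nat.findGreatest_le (P := P) (x - 1)
  omega

lemma IsSignAdmissible.le_coord (hp : 2 ≤ p) (hC : HasseDivisible p σ C)
    (h : IsSignAdmissible σ S j)
    (ih : ∀ S' ⊂ S, IsSignAdmissible σ S' j → CoordNonneg p σ C S' j)
    {mu : ι → ℤ} (hmu : ∀ i ∈ S, mu ∈ C (S.erase i)) {b : ι → ℚ} (hb : IsCoord p σ S mu b)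
    (hneg : b j ≤ 0) {x : ℕ} (hx : x + 1 < cycleLen σ j) (hxS : cycleElem σ j x ∈ S) :
    (p ^ cycleLen σ j + cycleSign σ S j) * -b j ≤ 2 * p ^ (x + 1) * -b (cycleElem σ j x) := by
  have hq := two_le_pow_cycleLen σ j hp
  induction x using Nat.strong_induction_on with
  | _ x ihx =>
  have hgapx := h.gapSign_eq x (by omega) hxS
  by_cases hfirst : ∀ n < x, cycleElem σ j n ∉ S
  · obtain ⟨c', hc'⟩ := exists_isCoord hp σ (S.erase (cycleElem σ j x)) mu
    have hnonneg := ih _ (Finset.erase_ssubset hxS) (h.erase_first hx hxS hfirst) mu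
      (hmu _ hxS) c' hc'
    have heq := hb.erase (by omega) hxS hc'
    rw [hgapx] at heq
    rcases cycleSign_eq_one_or σ S j with hs | hs <;> rw [hs] at heq ⊢ <;> nlinarith
  push Not at hfirst
  obtain ⟨n, hnx, hnS⟩ := hfirst
  obtain ⟨y, hyx, hyS, hgap⟩ := exists_lt_forall_not (P := (cycleElem σ j · ∈ S)) hnx hnS
  have hyS' := (cycleElem_mem_erase (S := S) (by omega : y < cycleLen σ j)
    (by omega : x < cycleLen σ j)).mpr ⟨hyx.ne, hyS⟩
  obtain ⟨mu', b', hmu', hb', hle, heqx⟩ :=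
    hC.exists_isCoord_le (Finset.erase_subset (cycleElem σ j x) S) (hmu _ hxS) hb
  obtain ⟨c', hc'⟩ := exists_isCoord hp σ ((S.erase (cycleElem σ j x)).erase (cycleElem σ j y)) mu'
  have hnonneg := ih _ ((Finset.erase_ssubset hyS').trans (Finset.erase_ssubset hxS))
    (h.erase_consecutive hyx hx hxS hyS hgap) mu' (hmu' _ hyS') c' hc'
  have heq := hb'.erase_erase hyx (by omega) hxS hyS hc'
  rw [heqx _ (Finset.notMem_erase _ _), hgapx, h.gapSign_eq y (by omega) hyS] at heq
  have hprev := ihx y hyx (by omega) hyS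
  have hley : (p : ℚ) ^ (y + 1) * b' (cycleElem σ j y) ≤ p ^ (y + 1) * b (cycleElem σ j y) := by
    gcongr
    exact hle _
  rcases cycleSign_eq_one_or σ S j with hs | hs <;> rw [hs] at heq hprev ⊢ <;>
    nlinarith [hle j]

omit [DecidableEq ι] in
lemma exists_cycleElem_mem (hj : j ∈ S) (hS : S ≠ {j})
    (hcycle : ∀ i ∈ S, ∃ n, cycleElem σ j n = i) :
    ∃ n < cycleLen σ j - 1, cycleElem σ j n ∈ S := by
  obtain ⟨i, hi, hij⟩ : ∃ i ∈ S, i ≠ j := by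
    by_contra! hall
    exact hS (Finset.eq_singleton_iff_unique_mem.mpr ⟨hj, hall⟩)
  obtain ⟨n, rfl⟩ := hcycle i hi
  obtain ⟨m, hm, hmn⟩ := exists_cycleElem_eq σ j n
  have hne : m ≠ cycleLen σ j - 1 := by
    rintro rfl
    exact hij (hmn.symm.trans (cycleElem_cycleLen_sub_one σ j))
  exact ⟨m, by omega, hmn ▸ hi⟩

/-- Removing the elements `x` of `S ∖ {j}` in the cycle of `j` bounds a negative `j`-th
coordinate by the `x`-th one, and removing `j` bounds the `t`-th coordinate by the `j`-th one, `t`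
being the element before `j`. With `q = p ^ cycleLen σ j` and the cycle sign `κ` this amounts to
`(q + κ) ^ 2 ≤ 4 κ q`, which is absurd. -/
theorem IsSignAdmissible.coordNonneg (hp : 2 ≤ p) (hC : HasseDivisible p σ C)
    (hbase : ∀ j, CoordNonneg p σ C {j} j) (h : IsSignAdmissible σ S j) :
    CoordNonneg p σ C S j := by
  induction S using Finset.strongInduction generalizing j with
  | H S ih =>
  rcases eq_or_ne S {j} with rfl | hS
  · exact hbase j
  by_cases hcycle : ∀ i ∈ S, ∃ n, cycleElem σ j n = i
  swap
  · push Not at hcycle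
    obtain ⟨i, hi, hij⟩ := hcycle
    exact .of_erase hp hC hi hij (ih _ (Finset.erase_ssubset hi) (h.erase_of_forall_ne hij))
  intro lam hlam c hc
  obtain ⟨mu, b, hmu, hb, hbc, -⟩ := hC.exists_isCoord_le subset_rfl hlam hc
  refine le_trans ?_ (hbc j)
  by_contra! hneg
  obtain ⟨n, hn, hnS⟩ := exists_cycleElem_mem h.mem hS hcycle
  obtain ⟨t, ht, htS, hlast⟩ := exists_lt_forall_not (P := (cycleElem σ j · ∈ S)) hn hnS
  have ht' : t + 1 < cycleLen σ j := by omega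
  obtain ⟨c', hc'⟩ := exists_isCoord hp σ (S.erase j) mu
  have hnonneg := ih _ (Finset.erase_ssubset h.mem)
    (h.erase_self ht' htS fun n hn hn' => hlast n hn (by omega)) mu (hmu _ h.mem) c' hc'
  have hj := h.le_coord hp hC (fun S' hS' hadm => ih S' hS' hadm) hmu hb hneg.le ht' htS
  have hjt := h.isCoord_erase_self ht' htS hb hc'
  have hpow : (p : ℚ) ^ cycleLen σ j = p ^ (t + 1) * p ^ (cycleLen σ j - 1 - t) := by
    rw [← pow_add]; congr 1; omega
  have hq := two_le_pow_cycleLen σ j hp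
  have hκ := cycleSign_eq_one_or σ S j
  generalize cycleSign σ S j = κ at hj hjt hκ
  have hqκ : 0 ≤ (p : ℚ) ^ cycleLen σ j + κ := by rcases hκ with rfl | rfl <;> linarith
  have ht_le : (p ^ cycleLen σ j + κ) * -b (cycleElem σ j t) ≤
      2 * κ * p ^ (cycleLen σ j - 1 - t) * -b j := by
    rcases hκ with rfl | rfl <;> nlinarith
  have hsq : (p ^ cycleLen σ j + κ) ^ 2 * -b j ≤ 4 * κ * p ^ cycleLen σ j * -b j := calc
    _ ≤ 2 * p ^ (t + 1) * ((p ^ cycleLen σ j + κ) * -b (cycleElem σ j t)) := by nlinarith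
    _ ≤ 2 * p ^ (t + 1) * (2 * κ * p ^ (cycleLen σ j - 1 - t) * -b j) := by gcongr
    _ = 4 * κ * p ^ cycleLen σ j * -b j := by rw [hpow]; ring
  have hpos : 0 < ((p : ℚ) ^ cycleLen σ j - 1) ^ 2 * -b j :=
    mul_pos (pow_pos (by linarith) 2) (neg_pos.mpr hneg)
  rcases hκ with rfl | rfl <;> nlinarith

end Nonneg

end SignAdmissible

/-! ### Admissible subsets of the blocks -/

section Admissible

lemma isSignAdmissible_of_odd_gaps {ι : Type} [DecidableEq ι] [Finite ι] {σ : Equiv.Perm ι}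
    {S : Finset ι} {j : ι} (hj : j ∈ S)
    (hodd : ∀ x y, x < y → y < cycleLen σ j → cycleElem σ j x ∈ S → cycleElem σ j y ∈ S →
      (∀ z, x < z → z < y → cycleElem σ j z ∉ S) → Odd (y - x)) :
    IsSignAdmissible σ S j := by
  have hstep : ∀ n, cycleElem σ j n ∈ S → ∀ y, n ≤ y → y < cycleLen σ j → cycleElem σ j y ∈ S →
      gapSign σ S j y = gapSign σ S j n := by
    intro n hn y
    induction y using Nat.strong_induction_on with
    | _ y ih =>
    intro hny hy hyS
    rcases hny.eq_or_lt with rfl | hlt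
    · rfl
    obtain ⟨x, hxy, hxS, hgap⟩ := exists_lt_forall_not (P := (cycleElem σ j · ∈ S)) hlt hn
    have hnx : n ≤ x := not_lt.mp fun hxn => hgap n hxn hlt hn
    obtain ⟨m, hm⟩ := hodd x y hxy hy hxS hyS hgap
    have hsign : gapSign σ S (cycleElem σ j x) (2 * m) = 1 := by
      rw [gapSign, Finset.prod_congr rfl fun z hz => ?_, Finset.prod_const, Finset.card_range,
        pow_mul, neg_one_sq, one_pow]
      rw [Finset.mem_range] at hz
      rw [cycleElem_cycleElem, sgn_of_notMem (hgap _ (by omega) (by omega))]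
    rw [← ih x hxy hnx (by omega) hxS, show y = x + 1 + 2 * m by omega, gapSign_add, hsign,
      gapSign_succ, sgn_of_mem hxS, mul_one, mul_one]
  refine ⟨hj, fun n hn hnS => ?_⟩
  have hlen := cycleLen_pos σ j
  have hlast := cycleElem_cycleLen_sub_one σ j
  rw [← hstep n hnS (cycleLen σ j - 1) (by omega) (by omega) (hlast.symm ▸ hj), cycleSign]
  conv_rhs => rw [← Nat.sub_add_cancel hlen, gapSign_succ, hlast, sgn_of_mem hj, mul_one]

lemma val_finRotate_iterate {d : ℕ} (x : Fin d) (n : ℕ) :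
    ((finRotate d)^[n] x : ℕ) = (x + n) % d := by
  obtain ⟨d, rfl⟩ : ∃ k, d = k + 1 := ⟨d - 1, by have := x.2; omega⟩
  induction n with
  | zero => simp [Nat.mod_eq_of_lt x.2]
  | succ n ih =>
    rw [Function.iterate_succ_apply', finRotate_apply, Fin.val_add, ih]
    rcases d with _ | d
    · simp [Nat.mod_one]
    · rw [Fin.val_one, Nat.mod_add_mod, add_assoc]

variable {r : ℕ} {d : Fin r → ℕ}

lemma frobPerm_symm_iterate (m : Fin r) (x : Fin (d m)) (n : ℕ) :
    (frobPerm d).symm^[n] ⟨m, x⟩ = ⟨m, (finRotate (d m))^[n] x⟩ := by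
  induction n with
  | zero => rfl
  | succ n ih =>
    rw [Function.iterate_succ_apply', ih, Function.iterate_succ_apply']
    rfl

lemma cycleLen_frobPerm_le (j : Idx d) : cycleLen (frobPerm d) j ≤ d j.1 := by
  obtain ⟨m, x⟩ := j
  refine Function.IsPeriodicPt.minimalPeriod_le x.pos ?_
  rw [Function.IsPeriodicPt, Function.IsFixedPt, frobPerm_symm_iterate]
  congr 1
  ext
  rw [val_finRotate_iterate, Nat.add_mod_right, Nat.mod_eq_of_lt x.2]

/-- After the translation that puts `j` last, in place `j'` say, the element `cycleElem _ j n` sits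
in place `j' + n + 1 - d`, so that gaps in the cycle are gaps between places. -/
lemma IsAdmissiblePair.isSignAdmissible {S : Finset (Idx d)} {j : Idx d}
    (h : IsAdmissiblePair (block S j.1) j.2) : IsSignAdmissible (frobPerm d) S j := by
  obtain ⟨m, x⟩ := j
  obtain ⟨c, hj, hmax, hgap⟩ := h
  dsimp only at hj hmax hgap
  set S' := (block S m).map (finRotate (d m) ^ c).toEmbedding
  set j' := (finRotate (d m) ^ c) x with hj'
  have hmem : ∀ a, (finRotate (d m) ^ c) a ∈ S' ↔ (⟨m, a⟩ : Idx d) ∈ S := fun a => by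
    simp [S', block]
  have hcycle : ∀ n, cycleElem (frobPerm d) ⟨m, x⟩ n ∈ S ↔ (finRotate (d m))^[n + 1] j' ∈ S' := by
    intro n
    rw [cycleElem, frobPerm_symm_iterate, ← hmem, hj', ← Equiv.Perm.iterate_eq_pow,
      ← Function.iterate_add_apply, ← Function.iterate_add_apply, add_comm]
  have hplace : ∀ n < d m, cycleElem (frobPerm d) ⟨m, x⟩ n ∈ S →
      ((finRotate (d m))^[n + 1] j' : ℕ) + d m = j' + n + 1 := by
    intro n hn hnS
    have hle := hmax _ ((hcycle n).mp hnS)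
    rw [Fin.le_def, val_finRotate_iterate] at hle
    rw [val_finRotate_iterate]
    have hge : d m ≤ j' + (n + 1) := by
      by_contra hlt
      rw [Nat.mod_eq_of_lt (by omega)] at hle
      omega
    rw [Nat.mod_eq_sub_mod hge, Nat.mod_eq_of_lt (by omega)]
    omega
  refine isSignAdmissible_of_odd_gaps ((hmem x).mp hj) fun a b hab hb haS hbS hno => ?_
  have hbd := hb.trans_le (cycleLen_frobPerm_le _)
  have ha' := hplace a (hab.trans hbd) haS
  have hb' := hplace b hbd hbS
  have hodd := hgap _ ((hcycle a).mp haS) _ ((hcycle b).mp hbS) (Fin.lt_def.mpr (by omega)) ?_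
  · rw [show (b - a : ℕ) = ((finRotate (d m))^[b + 1] j' : ℕ) - (finRotate (d m))^[a + 1] j' by
      omega, ← Int.odd_coe_nat, Nat.cast_sub (by omega)]
    exact hodd
  · rintro z hz ⟨haz, hzb⟩
    rw [Fin.lt_def] at haz hzb
    obtain ⟨n, hn⟩ : ∃ n, n + (j' + 1) = z + d m := ⟨z + d m - (j' + 1), by omega⟩
    refine hno n (by omega) (by omega) ((hcycle n).mpr ?_)
    convert hz
    rw [Fin.ext_iff, val_finRotate_iterate, show (j' : ℕ) + (n + 1) = z + d m by omega,
      Nat.add_mod_right, Nat.mod_eq_of_lt z.2]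

lemma isGAdmissible_of_forall_eq_one (hd : ∀ m, d m = 1) (S : Finset (Idx d)) :
    IsGAdmissible S := by
  intro j hj
  have : Subsingleton (Fin (d j.1)) := by rw [hd]; infer_instance
  refine ⟨0, ?_, fun x _ => (Subsingleton.elim x _).le, fun x _ y _ hxy =>
    absurd (Subsingleton.elim x y) hxy.ne⟩
  simp only [pow_zero, Finset.mem_map_equiv, block, Finset.mem_filter, Finset.mem_univ, true_and]
  exact hj

end Admissible

/-! ### Étale and smooth algebras over a domain -/

section Algebra

open TensorProduct

lemma eq_zero_of_sum_smul_of_smul_eq_zero {A M : Type*} [CommRing A] [_root_.IsReduced A]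
    [AddCommGroup M] [Module A M] [Module.Flat A M] {n : ℕ} (a : Fin n → A) (y : Fin n → M)
    (h : ∀ i, a i • ∑ j, a j • y j = 0) : ∑ j, a j • y j = 0 := by
  let x : (Fin n → A) →ₗ[A] M := Fintype.linearCombination A y
  let f : (Fin n → A) →ₗ[A] (Fin n → A) := (LinearMap.toSpanSingleton A _ a).comp
    (Fintype.linearCombination A a)
  have hxf : x ∘ₗ f = 0 := by
    ext i
    simpa [x, f, Fintype.linearCombination_apply, mul_smul, Finset.smul_sum] using h i
  obtain ⟨m, α, z, hx, hαf⟩ := Module.Flat.exists_factorization_of_comp_eq_zero_of_free hxf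
  have hα (i : Fin n) : a i • α a = 0 := by
    simpa [f, Fintype.linearCombination_apply, Pi.single_apply] using congr($hαf (Pi.single i 1))
  have hα0 : α a = 0 := by
    ext l
    have hmem : α a l = ∑ i, a i • α (fun j => if i = j then 1 else 0) l :=
      LinearMap.pi_apply_eq_sum_univ (Finsupp.lapply l ∘ₗ α) a
    have hsq : α a l * α a l = 0 := by
      nth_rewrite 1 [hmem]
      rw [Finset.sum_mul]
      refine Finset.sum_eq_zero fun i _ => ?_
      have := congr($(hα i) l)
      rw [Finsupp.smul_apply, smul_eq_mul, Finsupp.zero_apply] at this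
      rw [smul_eq_mul, mul_right_comm, this, zero_mul]
    exact _root_.IsReduced.eq_zero _ ⟨2, by rw [sq, hsq]⟩
  calc ∑ j, a j • y j = x a := (Fintype.linearCombination_apply ..).symm
    _ = 0 := by rw [hx, LinearMap.comp_apply, hα0, map_zero]

lemma eq_zero_of_tmul_self_eq_zero {A M : Type*} [CommRing A] [_root_.IsReduced A] [AddCommGroup M]
    [Module A M] [Module.Flat A M] {b : M} (h : b ⊗ₜ[A] b = 0) : b = 0 := by
  obtain ⟨n, a, y, hb, hab⟩ :=
    vanishesTrivially_of_sum_tmul_eq_zero_of_rTensor_injective A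
      (m := fun _ : Unit => b) (n := fun _ : Unit => b)
      (Module.Flat.rTensor_preserves_injective_linearMap _ (Submodule.injective_subtype _))
      (by simpa using h)
  simp only [Fintype.univ_ofSubsingleton, Finset.sum_singleton] at hab
  replace hb : b = ∑ j, a () j • y j := hb ()
  rw [hb] at hab ⊢
  exact eq_zero_of_sum_smul_of_smul_eq_zero _ y hab

lemma exists_eq_tmul_one_of_isIntegral {P B K : Type*} [CommRing P] [IsDomain P]
    [IsIntegrallyClosed P] [CommRing B] [Algebra P B] [Algebra.Smooth P B] [Field K] [Algebra P K]
    [IsFractionRing P K] {x : B ⊗[P] K} (hx : IsIntegral B x) : ∃ b : B, x = b ⊗ₜ 1 := by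
  obtain ⟨y, hy⟩ := TensorProduct.toIntegralClosure_bijective_of_smooth.surjective
    (⟨x, hx⟩ : integralClosure B (B ⊗[P] K))
  replace hy : (TensorProduct.toIntegralClosure P B K y : B ⊗[P] K) = x := congrArg Subtype.val hy
  rw [← hy]
  clear hy
  induction y with
  | zero => exact ⟨0, by simp⟩
  | add y z hy hz =>
    obtain ⟨b, hb⟩ := hy
    obtain ⟨b', hb'⟩ := hz
    exact ⟨b + b', by rw [map_add, add_tmul, ← hb, ← hb']; rfl⟩
  | tmul b y =>
    obtain ⟨q, hq⟩ := IsIntegrallyClosed.isIntegral_iff.1 y.2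
    refine ⟨q • b, ?_⟩
    rw [smul_tmul, Algebra.smul_def, mul_one, hq]
    simp [TensorProduct.toIntegralClosure]

lemma exists_eq_one_tmul_of_isIdempotentElem {P B K : Type*} [CommRing P] [IsDomain P]
    [IsIntegrallyClosed P] [CommRing B] [Algebra P B] [Algebra.Smooth P B] [Field K] [Algebra P K]
    [IsFractionRing P K] {x : K ⊗[P] B} (hx : IsIdempotentElem x) : ∃ b : B, x = 1 ⊗ₜ b := by
  let c := Algebra.TensorProduct.comm P K B
  have hcx : c x ^ 2 = c x := by rw [← map_pow, sq, hx.eq]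
  obtain ⟨b, hb⟩ := exists_eq_tmul_one_of_isIntegral (x := c x)
    ⟨.X ^ 2 - .X, Polynomial.monic_X_pow_sub (Polynomial.degree_X_le.trans_lt (by norm_num)),
      by simp [hcx]⟩
  exact ⟨b, c.injective (hb.trans (Algebra.TensorProduct.comm_tmul ..).symm)⟩

lemma exists_isDomain_localizationAway_of_etale {P B : Type u} [CommRing P] [IsDomain P]
    [IsIntegrallyClosed P] [CommRing B] [Algebra P B] [Algebra.Etale P B] (p : Ideal B)
    [p.IsPrime] : ∃ s ∉ p, IsDomain (Localization.Away s) := by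
  classical
  let K := FractionRing P
  obtain ⟨I, _, L, _, _, e, -⟩ :=
    (Algebra.Etale.iff_exists_algEquiv_prod K (K ⊗[P] B)).1 inferInstance
  let φ : B →+* Π i, L i := (e : K ⊗[P] B →+* Π i, L i).comp
    (Algebra.TensorProduct.includeRight : B →ₐ[P] K ⊗[P] B).toRingHom
  have hφ : Function.Injective φ := e.injective.comp
    (Algebra.TensorProduct.includeRight_injective (IsFractionRing.injective P K))
  have exists_eq_single (i : I) : ∃ b, φ b = Pi.single i 1 := by
    have hi : IsIdempotentElem (Pi.single i 1 : Π i, L i) := by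
      rw [IsIdempotentElem, ← Pi.single_mul, mul_one]
    obtain ⟨b, hb⟩ := exists_eq_one_tmul_of_isIdempotentElem (hi.map e.symm)
    exact ⟨b, (e.symm_apply_eq.1 hb).symm⟩
  choose b hb using exists_eq_single
  have := Fintype.ofFinite I
  have hsum : ∑ i, b i = 1 := hφ <| by
    simp only [map_sum, map_one, hb]
    exact Finset.univ_sum_single 1
  obtain ⟨i, hi⟩ : ∃ i, b i ∉ p := by
    by_contra! h
    exact p.one_notMem (hsum ▸ sum_mem fun i _ => h i)
  let ψ : B →+* L i := (Pi.evalRingHom L i).comp φ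
  have hψ : ψ (b i) = 1 := by simp [ψ, hb]
  have hker (x : B) (hx : ψ x = 0) : b i * x = 0 := by
    refine hφ (funext fun l => ?_)
    rw [map_mul, hb, map_zero]
    rcases eq_or_ne l i with rfl | h
    · rw [Pi.mul_apply, Pi.single_eq_same, one_mul, Pi.zero_apply]; exact hx
    · simp [h]
  refine ⟨b i, hi, Function.Injective.isDomain
    (IsLocalization.Away.lift (b i) (g := ψ) (hψ ▸ isUnit_one))
    ((IsLocalization.lift_injective_iff _).2 fun x y => ?_)⟩
  refine ⟨fun h => ?_, fun h => (IsLocalization.eq_iff_exists (.powers (b i)) _).2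
    ⟨⟨b i, 1, pow_one _⟩, ?_⟩⟩
  · simpa using congr(IsLocalization.Away.lift (b i) (g := ψ) (hψ ▸ isUnit_one) $h)
  · rw [← sub_eq_zero, ← mul_sub]
    exact hker _ (by rw [map_sub, h, sub_self])

lemma exists_isDomain_localizationAway_of_smooth {R B : Type u} [CommRing R] [IsDomain R]
    [UniqueFactorizationMonoid R] [CommRing B] [Algebra R B] [Algebra.Smooth R B]
    (p : Ideal B) [p.IsPrime] : ∃ s ∉ p, IsDomain (Localization.Away s) := by
  obtain ⟨f, hfp, n, _, _, _⟩ :=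
    Algebra.IsSmoothAt.exists_isStandardEtale_mvPolynomial (R := R) (p := p)
  have hdisj : Disjoint (Submonoid.powers f : Set B) p := by
    rw [Set.disjoint_left]
    rintro _ ⟨m, rfl⟩ hm
    exact hfp (‹p.IsPrime›.mem_of_pow_mem _ hm)
  have := IsLocalization.isPrime_of_isPrime_disjoint (.powers f) (Localization.Away f) p ‹_› hdisj
  obtain ⟨g, hg, _⟩ := exists_isDomain_localizationAway_of_etale (P := MvPolynomial (Fin n) R)
    (p.map (algebraMap B (Localization.Away f)))
  let a := (IsLocalization.Away.sec f g).1
  have hag : Associated (algebraMap B (Localization.Away f) a) g :=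
    IsLocalization.Away.associated_sec_fst f g
  have hap : a ∉ p := fun h =>
    hg ((Ideal.mem_iff_of_associated hag).1 (Ideal.mem_map_of_mem _ h))
  have := IsLocalization.Away.mul_of_associated f a g (T := Localization.Away g) hag
  refine ⟨f * a, fun h => (‹p.IsPrime›.mem_or_mem h).elim hfp hap, ?_⟩
  exact (IsLocalization.algEquiv (.powers (f * a)) (Localization.Away (f * a))
    (Localization.Away g)).toMulEquiv.isDomain _

end Algebra

/-! ### The upper left entries -/

section UpperLeft

variable {k : Type u} [Field k] {ι : Type} {A : Type*} [CommRing A] [Algebra k A]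

/-- The map of coordinate rings of the morphism `(g_i) ↦ ((g_i)_{11})` from `G` to affine space. -/
def upperLeft (k : Type u) [Field k] (ι : Type) : MvPolynomial ι k →ₐ[k] CoordRing k ι :=
  MvPolynomial.aeval fun i => genericPt k ι i 0 0

lemma coordRing_algHom_ext {f g : CoordRing k ι →ₐ[k] A}
    (h : ∀ i a b, f (genericPt k ι i a b) = g (genericPt k ι i a b)) : f = g := by
  apply Ideal.Quotient.algHom_ext
  ext ⟨i, a, b⟩
  exact h i a b

/-- The `A`-point of `G` attached to a tuple of matrices of determinant one, as a map on the
coordinate ring. -/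
def coordLift (g : ι → Matrix (Fin 2) (Fin 2) A) (hg : ∀ i, (g i).det = 1) :
    CoordRing k ι →ₐ[k] A :=
  Ideal.Quotient.liftₐ _ (MvPolynomial.aeval fun x : ι × Fin 2 × Fin 2 => g x.1 x.2.1 x.2.2)
    fun _ ha => (Ideal.span_le (I := RingHom.ker _)).2 (by
      rintro _ ⟨i, rfl⟩
      simp [RingHom.mem_ker, ← Matrix.det_fin_two, hg i]) ha

lemma coordLift_genericPt (g : ι → Matrix (Fin 2) (Fin 2) A) (hg : ∀ i, (g i).det = 1) (i : ι)
    (a b : Fin 2) : coordLift (k := k) g hg (genericPt k ι i a b) = g i a b :=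
  (Ideal.Quotient.lift_mk _ _ _).trans (MvPolynomial.aeval_X _ _)

lemma exists_det_eq_one_of_sq_eq_bot {C : Type*} [CommRing C] {J : Ideal C} (hJ : J ^ 2 = ⊥)
    {M : Matrix (Fin 2) (Fin 2) (C ⧸ J)} (hM : M.det = 1) {a : C}
    (ha : Ideal.Quotient.mk J a = M 0 0) :
    ∃ g : Matrix (Fin 2) (Fin 2) C,
      g.det = 1 ∧ g 0 0 = a ∧ ∀ x y, Ideal.Quotient.mk J (g x y) = M x y := by
  obtain ⟨b, hb⟩ := Ideal.Quotient.mk_surjective (M 0 1)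
  obtain ⟨c, hc⟩ := Ideal.Quotient.mk_surjective (M 1 0)
  obtain ⟨d, hd⟩ := Ideal.Quotient.mk_surjective (M 1 1)
  set ε : C := a * d - b * c - 1 with hε
  have hεJ : Ideal.Quotient.mk J ε = 0 := by
    rw [hε, map_sub, map_sub, map_mul, map_mul, ha, hb, hc, hd, ← Matrix.det_fin_two, hM, map_one,
      sub_self]
  have hε2 : ε * ε = 0 := by
    rw [Ideal.Quotient.eq_zero_iff_mem] at hεJ
    rw [← Ideal.mem_bot, ← hJ, pow_two]
    exact Ideal.mul_mem_mul hεJ hεJ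
  -- Scaling the second row by `1 - ε` is scaling by `(1 + ε)⁻¹`, as `ε ^ 2 = 0`.
  refine ⟨!![a, b; (1 - ε) * c, (1 - ε) * d], ?_, rfl, fun x y => ?_⟩
  · rw [Matrix.det_fin_two_of]
    linear_combination (ε - 1) * hε - hε2
  · fin_cases x <;> fin_cases y <;> simp [ha, hb, hc, hd, hεJ]

lemma upperLeft_smooth (k : Type u) [Field k] (ι : Type) [Finite ι] :
    (upperLeft k ι : MvPolynomial ι k →+* CoordRing k ι).Smooth := by
  let _ : Algebra (MvPolynomial ι k) (CoordRing k ι) :=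
    (upperLeft k ι : MvPolynomial ι k →+* CoordRing k ι).toAlgebra
  have : IsScalarTower k (MvPolynomial ι k) (CoordRing k ι) :=
    .of_algebraMap_eq fun x => ((upperLeft k ι).commutes x).symm
  have : Algebra.FinitePresentation k (CoordRing k ι) :=
    Algebra.FinitePresentation.quotient (Submodule.fg_span (Set.finite_range _))
  have hX (i : ι) : algebraMap (MvPolynomial ι k) (CoordRing k ι) (.X i) = genericPt k ι i 0 0 :=
    MvPolynomial.aeval_X _ i
  refine ⟨.of_comp_surjective fun C _ _ J hJ f => ?_, .of_restrict_scalars_finitePresentation k _ _⟩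
  let _ : Algebra k C := ((algebraMap (MvPolynomial ι k) C).comp MvPolynomial.C).toAlgebra
  have : IsScalarTower k (MvPolynomial ι k) C := .of_algebraMap_eq fun _ => rfl
  have hdet (i : ι) : ((genericPt k ι i).1.map f).det = 1 :=
    (RingHom.map_det f.toRingHom _).symm.trans (by simp)
  have hmk (i : ι) : Ideal.Quotient.mk J (algebraMap (MvPolynomial ι k) C (.X i)) =
      (genericPt k ι i).1.map f 0 0 := by
    rw [Matrix.map_apply, ← hX, f.commutes]
    rfl
  choose g hg1 hg00 hgf using fun i => exists_det_eq_one_of_sq_eq_bot hJ (hdet i) (hmk i)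
  have hcomm : (coordLift g hg1).comp (upperLeft k ι) =
      IsScalarTower.toAlgHom k (MvPolynomial ι k) C := by
    ext i
    simp [upperLeft, coordLift_genericPt, hg00]
  have hlift : (Ideal.Quotient.mkₐ k J).comp (coordLift g hg1) = f.restrictScalars k :=
    coordRing_algHom_ext fun i x y => by
      rw [AlgHom.comp_apply, coordLift_genericPt]
      exact hgf i x y
  exact ⟨{ (coordLift g hg1).toRingHom with commutes' := DFunLike.congr_fun hcomm },
    AlgHom.ext fun q => DFunLike.congr_fun hlift q⟩

end UpperLeft

/-! ### Sections of the automorphic line bundles -/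

section Characters

variable {ι : Type} {p : ℕ} {σ : Equiv.Perm ι} {A B : Type u} [CommRing A] [CommRing B]

lemma torusCoord_zipGroupMap (f : A →+* B) (e : zipGroup p σ A) (i : ι) :
    torusCoord (zipGroupMap f e) i = Units.map f.toMonoidHom (torusCoord e i) :=
  rfl

lemma zipGroup_snd_zero_zero (e : zipGroup p σ A) (i : ι) :
    e.1.2 i 0 0 = ((torusCoord e (σ i) ^ p : Aˣ) : A) :=
  (e.2 i).2.2.trans (Units.val_pow_eq_pow_val (torusCoord e (σ i)) p).symm

lemma zipGroup_snd_one_one (e : zipGroup p σ A) (i : ι) :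
    e.1.2 i 1 1 = (((torusCoord e (σ i) ^ p)⁻¹ : Aˣ) : A) := by
  have hdet := (e.1.2 i).det_coe
  rw [Matrix.det_fin_two, (e.2 i).2.1, mul_zero, sub_zero, zipGroup_snd_zero_zero] at hdet
  exact (Units.inv_eq_of_mul_eq_one_right hdet).symm

variable [Fintype ι]

lemma character_add (lam mu : ι → ℤ) (e : zipGroup p σ A) :
    character (lam + mu) e = character lam e * character mu e := by
  simp [character, zpow_add, Finset.prod_mul_distrib]

lemma character_zero (e : zipGroup p σ A) : character (0 : ι → ℤ) e = 1 := by
  simp [character]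

lemma character_neg (lam : ι → ℤ) (e : zipGroup p σ A) :
    character (-lam) e = (character lam e)⁻¹ := by
  simp [character]

lemma character_zsmul (n : ℤ) (lam : ι → ℤ) (e : zipGroup p σ A) :
    character (n • lam) e = character lam e ^ n := by
  simp only [character, ← Finset.prod_zpow, Pi.smul_apply, smul_eq_mul, mul_comm n, zpow_mul]

lemma character_single [DecidableEq ι] (i : ι) (e : zipGroup p σ A) :
    character (Pi.single i 1) e = torusCoord e i := by
  rw [character, Finset.prod_eq_single_of_mem i (Finset.mem_univ i) fun l _ hl => by simp [hl],
    Pi.single_eq_same, zpow_one]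

lemma character_zipGroupMap (f : A →+* B) (lam : ι → ℤ) (e : zipGroup p σ A) :
    character lam (zipGroupMap f e) = Units.map f.toMonoidHom (character lam e) := by
  simp [character, torusCoord_zipGroupMap, map_prod, map_zpow]

end Characters

section Sections

variable {k : Type u} [Field k] {ι : Type}

lemma pull_comp {Y Z W : KSch k} (f : Y ⟶ Z) (g : Z ⟶ W) (a : Fn W) :
    pull (f ≫ g) a = pull f (pull g a) := by
  rw [pull, Over.comp_left, Scheme.Hom.comp_appTop]
  rfl

lemma pull_id {Y : KSch k} (a : Fn Y) : pull (𝟙 Y) a = a := by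
  simp [pull]

lemma mat_comp {Y Z : KSch k} (f : Y ⟶ Z) (g : Z ⟶ GSch k ι) (i : ι) (a b : Fin 2) :
    mat (f ≫ g) i a b = pull f (mat g i a b) :=
  pull_comp f g _

lemma mat_zero_one_mul_neg {J : KSch k} {g : J ⟶ GSch k ι} {i : ι} (hi : mat g i 0 0 = 0) :
    mat g i 0 1 * -mat g i 1 0 = 1 := by
  have hdet := (mat g i).det_coe
  rwa [Matrix.det_fin_two, hi, zero_mul, zero_sub, ← mul_neg] at hdet

variable [Fintype ι] {p : ℕ} {σ : Equiv.Perm ι} {J : KSch k}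
  {rel : ∀ T : KSch k, zipGroup p σ (Fn T) → (T ⟶ J) → (T ⟶ J) → Prop}

lemma IsSection.mul {lam mu : ι → ℤ} {f g : Fn J} (hf : IsSection p σ J rel lam f)
    (hg : IsSection p σ J rel mu g) : IsSection p σ J rel (lam + mu) (f * g) := by
  intro T e z z' h
  rw [map_mul, hf T e z z' h, hg T e z z' h, map_mul, character_add, Units.val_mul]
  ring

lemma IsSection.one : IsSection p σ J rel 0 (1 : Fn J) := by
  intro T e z z' _
  rw [map_one, map_one, character_zero, Units.val_one, mul_one]

lemma IsSection.pow {lam : ι → ℤ} {f : Fn J} (hf : IsSection p σ J rel lam f) (n : ℕ) :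
    IsSection p σ J rel (n • lam) (f ^ n) := by
  induction n with
  | zero => simpa using IsSection.one
  | succ n ih =>
    rw [succ_nsmul, pow_succ]
    exact ih.mul hf

lemma IsSection.prod {α : Type*} (s : Finset α) {lam : α → ι → ℤ} {f : α → Fn J}
    (hf : ∀ a ∈ s, IsSection p σ J rel (lam a) (f a)) :
    IsSection p σ J rel (∑ a ∈ s, lam a) (∏ a ∈ s, f a) := by
  classical
  induction s using Finset.induction_on with
  | empty => simpa using IsSection.one
  | insert a s ha ih =>
    rw [Finset.sum_insert ha, Finset.prod_insert ha]
    exact (hf a (Finset.mem_insert_self _ _)).mul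
      (ih fun b hb => hf b (Finset.mem_insert_of_mem hb))

lemma IsSection.units_inv {lam : ι → ℤ} {f : (Fn J)ˣ}
    (hf : IsSection p σ J rel lam (f : Fn J)) :
    IsSection p σ J rel (-lam) ((f⁻¹ : (Fn J)ˣ) : Fn J) := by
  intro T e z z' h
  have hunit : Units.map (pull z').toMonoidHom f =
      character lam e * Units.map (pull z).toMonoidHom f :=
    Units.ext (hf T e z z' h)
  have hinv : Units.map (pull z').toMonoidHom f⁻¹ =
      character (-lam) e * Units.map (pull z).toMonoidHom f⁻¹ := by
    rw [map_inv, map_inv, hunit, mul_inv, character_neg]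
  exact congrArg Units.val hinv

lemma IsSection.units_zpow {lam : ι → ℤ} {f : (Fn J)ˣ}
    (hf : IsSection p σ J rel lam (f : Fn J)) (n : ℤ) :
    IsSection p σ J rel (n • lam) ((f ^ n : (Fn J)ˣ) : Fn J) := by
  have hpow (m : ℕ) : IsSection p σ J rel (m • lam) ((f ^ m : (Fn J)ˣ) : Fn J) := by
    rw [Units.val_pow_eq_pow_val]
    exact hf.pow m
  obtain ⟨m, rfl | rfl⟩ := n.eq_nat_or_neg
  · rw [zpow_natCast, natCast_zsmul]
    exact hpow m
  · rw [zpow_neg, zpow_natCast, neg_smul, natCast_zsmul]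
    exact (hpow m).units_inv

lemma IsSection.pullback {J' : KSch k}
    {rel' : ∀ T : KSch k, zipGroup p σ (Fn T) → (T ⟶ J') → (T ⟶ J') → Prop} (φ : J' ⟶ J)
    (hφ : ∀ T e z z', rel' T e z z' → rel T e (z ≫ φ) (z' ≫ φ)) {lam : ι → ℤ} {f : Fn J}
    (hf : IsSection p σ J rel lam f) : IsSection p σ J' rel' lam (pull φ f) := by
  intro T e z z' h
  rw [← pull_comp, ← pull_comp]
  exact hf T e _ _ (hφ T e z z' h)

/-- The relation `rel` of an action of `E` on `J` is compatible with the action of `E` on `G`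
through `g : J ⟶ G`. -/
def IsCompatible (rel : ∀ T : KSch k, zipGroup p σ (Fn T) → (T ⟶ J) → (T ⟶ J) → Prop)
    (g : J ⟶ GSch k ι) : Prop :=
  ∀ T e z z', rel T e z z' → mat (z' ≫ g) = e.1.1 * mat (z ≫ g) * e.1.2⁻¹

variable [DecidableEq ι]

lemma IsCompatible.isSection_upperLeft {g : J ⟶ GSch k ι} (hg : IsCompatible rel g) (i : ι) :
    IsSection p σ J rel (hasseWeight p σ i) (mat g i 0 0) := by
  intro T e z z' h
  have hchar : (character (hasseWeight p σ i) e : Fn T) = e.1.1 i 0 0 * e.1.2 i 1 1 := by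
    rw [hasseWeight, sub_eq_add_neg, character_add, character_neg, character_zsmul,
      character_single, character_single, zpow_natCast, Units.val_mul, zipGroup_snd_one_one]
    rfl
  rw [← mat_comp, ← mat_comp, hg T e z z' h, hchar]
  simp only [Pi.mul_apply, Pi.inv_apply, Matrix.SpecialLinearGroup.coe_mul,
    Matrix.SpecialLinearGroup.coe_inv, Matrix.mul_apply, Fin.sum_univ_two, Matrix.adjugate_fin_two,
    (e.2 i).1, (e.2 i).2.1, Matrix.of_apply, Matrix.cons_val_zero, Matrix.cons_val_one]
  ring

lemma IsCompatible.isSection_upperRight {g : J ⟶ GSch k ι} (hg : IsCompatible rel g) {i : ι}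
    (hi : mat g i 0 0 = 0) :
    IsSection p σ J rel (Pi.single i 1 + (p : ℤ) • Pi.single (σ i) 1) (mat g i 0 1) := by
  intro T e z z' h
  have hchar : (character (Pi.single i 1 + (p : ℤ) • Pi.single (σ i) 1) e : Fn T) =
      e.1.1 i 0 0 * e.1.2 i 0 0 := by
    rw [character_add, character_zsmul, character_single, character_single, zpow_natCast,
      Units.val_mul, zipGroup_snd_zero_zero]
    rfl
  have hzero : mat (z ≫ g) i 0 0 = 0 := by rw [mat_comp, hi, map_zero]
  rw [← mat_comp, ← mat_comp, hg T e z z' h, hchar]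
  simp only [Pi.mul_apply, Pi.inv_apply, Matrix.SpecialLinearGroup.coe_mul,
    Matrix.SpecialLinearGroup.coe_inv, Matrix.mul_apply, Fin.sum_univ_two, Matrix.adjugate_fin_two,
    (e.2 i).1, hzero, Matrix.of_apply, Matrix.cons_val_zero, Matrix.cons_val_one]
  ring

/-- The upper right entry, as a unit, where the upper left entry vanishes. -/
def upperRightUnit {g : J ⟶ GSch k ι} {i : ι} (hi : mat g i 0 0 = 0) : (Fn J)ˣ :=
  .mkOfMulEqOne _ _ (mat_zero_one_mul_neg hi)

lemma IsCoord.eq_sum {S : Finset ι} {lam c : ι → ℤ} (hc : IsCoord p σ S lam fun i => (c i : ℚ)) :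
    lam = (∑ i ∈ Sᶜ, c i • (Pi.single i 1 + (p : ℤ) • Pi.single (σ i) 1)) +
      ∑ i ∈ S, c i • hasseWeight p σ i := by
  ext l
  have hl : lam l = c l - p * (if σ.symm l ∈ S then 1 else -1) * c (σ.symm l) := by
    have h : (lam l : ℚ) = c l - p * sgn S (σ.symm l) * c (σ.symm l) := hc l
    rw [sgn] at h
    split_ifs at h ⊢ <;> exact_mod_cast h
  have hsum (s : Finset ι) (q : ℤ) :
      (∑ i ∈ s, c i • (Pi.single i 1 + q • Pi.single (σ i) 1 : ι → ℤ)) l =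
        (if l ∈ s then c l else 0) + q * if σ.symm l ∈ s then c (σ.symm l) else 0 := by
    simp only [Finset.sum_apply, Pi.smul_apply, Pi.add_apply, Pi.single_apply, smul_eq_mul,
      mul_add, Finset.sum_add_distrib, ← Equiv.symm_apply_eq, mul_ite, mul_one, mul_zero,
      Finset.sum_ite_eq, mul_comm q, ite_mul, zero_mul, one_mul]
  have hweight (i : ι) : hasseWeight p σ i = Pi.single i 1 + (-(p : ℤ)) • Pi.single (σ i) 1 := by
    rw [hasseWeight, neg_smul, sub_eq_add_neg]
  simp only [hweight, Pi.add_apply, hsum, Finset.mem_compl, hl]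
  split_ifs <;> first | contradiction | ring

/-- A weight with integral coordinates that are non-negative on `S` has an explicit section where
the upper left entries outside `S` vanish. -/
lemma IsCompatible.exists_isSection {g : J ⟶ GSch k ι} (hg : IsCompatible rel g) {S : Finset ι}
    (hS : ∀ i ∉ S, mat g i 0 0 = 0) {lam c : ι → ℤ}
    (hc : IsCoord p σ S lam fun i => (c i : ℚ)) (hc0 : ∀ i ∈ S, 0 ≤ c i) :
    ∃ v : (Fn J)ˣ, IsSection p σ J rel lam (v * ∏ i ∈ S, mat g i 0 0 ^ (c i).toNat) := by
  have hright : ∃ v : (Fn J)ˣ, IsSection p σ J rel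
      (∑ i ∈ Sᶜ, c i • (Pi.single i 1 + (p : ℤ) • Pi.single (σ i) 1)) (v : Fn J) := by
    refine ⟨∏ i ∈ Sᶜ.attach, upperRightUnit (hS i (Finset.mem_compl.mp i.2)) ^ c i, ?_⟩
    rw [Units.coe_prod, ← Finset.sum_attach]
    exact .prod _ fun i _ => IsSection.units_zpow (f := upperRightUnit _)
      (hg.isSection_upperRight (hS i (Finset.mem_compl.mp i.2))) _
  obtain ⟨v, hv⟩ := hright
  refine ⟨v, ?_⟩
  rw [hc.eq_sum]
  refine hv.mul (.prod S fun i hi => ?_)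
  nth_rw 1 [← Int.toNat_of_nonneg (hc0 i hi), natCast_zsmul]
  exact (hg.isSection_upperLeft i).pow _

end Sections

/-! ### Coordinate cuts -/

section Restriction

variable {W J : Scheme.{u}}

/-- Restriction of global functions to an open subset. -/
abbrev res (U : W.Opens) : Γ(W, ⊤) →+* Γ(W, U) :=
  (W.presheaf.map (homOfLE (le_top : U ≤ ⊤)).op).hom

lemma eq_zero_of_forall_germ_eq_zero (h : Γ(W, ⊤))
    (H : ∀ y : W, W.presheaf.germ ⊤ y trivial h = 0) : h = 0 :=
  TopCat.Presheaf.section_ext W.sheaf ⊤ _ _ fun y _ => (H y).trans (map_zero _).symm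

lemma germ_res_apply (U : W.Opens) (y : W) (hy : y ∈ U) (h : Γ(W, ⊤)) :
    W.presheaf.germ U y hy (res U h) = W.presheaf.germ ⊤ y trivial h :=
  W.presheaf.germ_res_apply _ _ _ _

lemma eq_zero_of_forall_exists_res_eq_zero (h : Γ(W, ⊤))
    (H : ∀ y : W, ∃ U : W.Opens, y ∈ U ∧ res U h = 0) : h = 0 := by
  refine eq_zero_of_forall_germ_eq_zero h fun y => ?_
  obtain ⟨U, hy, hU⟩ := H y
  rw [← germ_res_apply U y hy, hU, map_zero]

lemma exists_gluing {α : Type*} (V : α → W.Opens) (hV : ∀ y, ∃ a, y ∈ V a) (g : ∀ a, Γ(W, V a))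
    (hg : ∀ a b y (ha : y ∈ V a) (hb : y ∈ V b),
      W.presheaf.germ (V a) y ha (g a) = W.presheaf.germ (V b) y hb (g b)) :
    ∃ s : Γ(W, ⊤), ∀ a, res (V a) s = g a := by
  obtain ⟨s, hs, -⟩ := W.sheaf.existsUnique_gluing' V ⊤ (fun y => homOfLE le_top)
    (fun y _ => TopologicalSpace.Opens.mem_iSup.2 (hV y)) g (by
      intro a b
      refine TopCat.Presheaf.section_ext W.sheaf _ _ _ fun y hy => ?_
      refine (W.presheaf.germ_res_apply _ _ _ _).trans (Eq.trans ?_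
        (W.presheaf.germ_res_apply _ _ _ _).symm)
      exact hg a b y hy.1 hy.2)
  exact ⟨s, hs⟩

lemma app_res (j : J ⟶ W) (U : W.Opens) (h : Γ(W, ⊤)) :
    j.app U (res U h) = res (j ⁻¹ᵁ U) (j.appTop h) := by
  have := j.naturality (homOfLE (le_top : U ≤ ⊤)).op
  exact congr($this h)

lemma exists_affineOpen_mem (w : W) : ∃ U : W.affineOpens, w ∈ U.1 :=
  let ⟨U, hU, hw, _⟩ := exists_isAffineOpen_mem_and_subset (TopologicalSpace.Opens.mem_top w)
  ⟨⟨U, hU⟩, hw⟩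

end Restriction

section IntegralCover

variable {J : Scheme.{u}}

lemma isReduced_of_exists_isReduced
    (H : ∀ y : J, ∃ V : J.affineOpens, y ∈ V.1 ∧ _root_.IsReduced Γ(J, V.1)) : IsReduced J := by
  have : ∀ y : J, _root_.IsReduced (J.presheaf.stalk y) := by
    intro y
    obtain ⟨V, hy, hV⟩ := H y
    let := J.presheaf.algebra_section_stalk ⟨y, hy⟩
    have := V.2.isLocalization_stalk ⟨y, hy⟩
    exact isReduced_localizationPreserves (V.2.primeIdealOf ⟨y, hy⟩).asIdeal.primeCompl
      (J.presheaf.stalk y) inferInstance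
  exact isReduced_of_isReduced_stalk J

lemma isReduced_of_exists_isDomain
    (H : ∀ y : J, ∃ V : J.affineOpens, y ∈ V.1 ∧ IsDomain Γ(J, V.1)) : IsReduced J :=
  isReduced_of_exists_isReduced fun y =>
    let ⟨V, hy, _⟩ := H y
    ⟨V, hy, inferInstance⟩

lemma exists_isPreirreducible_of_exists_isDomain
    (H : ∀ y : J, ∃ V : J.affineOpens, y ∈ V.1 ∧ IsDomain Γ(J, V.1)) (y : J) :
    ∃ V : J.Opens, y ∈ V ∧ IsPreirreducible (V : Set J) := by
  obtain ⟨V, hy, hV⟩ := H y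
  refine ⟨V.1, hy, ?_⟩
  have : IsAffine V.1 := V.2
  have : Nonempty V.1 := ⟨⟨y, hy⟩⟩
  have : IsDomain Γ(V.1, ⊤) := V.1.topIso.commRingCatIsoToRingEquiv.symm.isDomain_iff.1 hV
  have := isIntegral_of_isAffine_of_isDomain V.1
  have himage := (PreirreducibleSpace.isPreirreducible_univ (X := V.1)).image V.1.ι
    V.1.ι.continuous.continuousOn
  rwa [Set.image_univ, Scheme.Opens.range_ι] at himage

end IntegralCover

section Regular

variable {J : Scheme.{u}}

/-- The germs of `f` are not zero divisors: multiplication by `f` is injective on functions. -/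
def IsRegularFn (f : Γ(J, ⊤)) : Prop :=
  ∀ y : J, J.presheaf.germ ⊤ y trivial f ∈ nonZeroDivisors (J.presheaf.stalk y)

lemma IsRegularFn.eq_zero {f h : Γ(J, ⊤)} (hf : IsRegularFn f) (H : f * h = 0) : h = 0 := by
  refine eq_zero_of_forall_germ_eq_zero h fun y => ?_
  refine (mul_left_mem_nonZeroDivisors_eq_zero_iff (hf y)).1 ?_
  rw [← map_mul, H, map_zero]

lemma IsRegularFn.pow {f : Γ(J, ⊤)} (hf : IsRegularFn f) (n : ℕ) :
    IsRegularFn (f ^ n) := fun y => by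
  rw [map_pow]; exact pow_mem (hf y) n

lemma IsRegularFn.prod {α : Type*} (s : Finset α) {f : α → Γ(J, ⊤)}
    (hf : ∀ a ∈ s, IsRegularFn (f a)) : IsRegularFn (∏ a ∈ s, f a) := fun y => by
  rw [map_prod]; exact prod_mem fun a ha => hf a ha y

lemma IsRegularFn.of_flat {T : Scheme.{u}} (t : T ⟶ J) [Flat t] {f : Γ(J, ⊤)} (hf : IsRegularFn f) :
    IsRegularFn (t.appTop f) := by
  intro y
  have hgerm : T.presheaf.germ ⊤ y trivial (t.appTop f) =
      t.stalkMap y (J.presheaf.germ ⊤ (t y) trivial f) :=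
    (t.germ_stalkMap_apply ⊤ y trivial f).symm
  let := (t.stalkMap y).hom.toAlgebra
  have : Module.Flat (J.presheaf.stalk (t y)) (T.presheaf.stalk y) := Flat.stalkMap t y
  rw [hgerm, mem_nonZeroDivisors_iff_left]
  intro x hx
  refine Module.Flat.isSMulRegular_of_nonZeroDivisors (hf (t y)) (?_ : _ • x = _ • (0 : _))
  rw [smul_zero, Algebra.smul_def]
  exact hx

lemma IsRegularFn.dvd_of_local {f h : Γ(J, ⊤)} (hf : IsRegularFn f)
    (H : ∀ y : J, ∃ V : J.Opens, y ∈ V ∧ res V f ∣ res V h) : f ∣ h := by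
  choose V hV g hg using H
  obtain ⟨s, hs⟩ := exists_gluing V (fun y => ⟨y, hV y⟩) g (by
    intro a b y ha hb
    refine sub_eq_zero.1 ((mul_left_mem_nonZeroDivisors_eq_zero_iff (hf y)).1 ?_)
    rw [mul_sub]
    nth_rewrite 1 [← germ_res_apply (V a) y ha]
    rw [← germ_res_apply (V b) y hb, ← map_mul, ← map_mul, ← hg, ← hg, germ_res_apply,
      germ_res_apply, sub_self])
  refine ⟨s, ?_⟩
  rw [← sub_eq_zero]
  refine eq_zero_of_forall_exists_res_eq_zero _ fun y => ⟨V y, hV y, ?_⟩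
  rw [map_sub, map_mul, sub_eq_zero, hg y, hs y]

end Regular

section Cuts

variable {ι : Type} {W J : Scheme.{u}} {f : ι → Γ(W, ⊤)} {S : Set ι} {j : J ⟶ W}

/-- The ideal sheaf generated by the `f i` with `i ∉ S`. -/
def cutIdeal (f : ι → Γ(W, ⊤)) (S : Set ι) : W.IdealSheafData :=
  .ofIdealTop (Ideal.span (f '' Sᶜ))

/-- `j` is the inclusion of the closed subscheme of `W` cut out by the equations `f i = 0`,
`i ∉ S`. For `f` the upper left entries on `G` this is the closed stratum `G_S^*`. -/
structure IsCut (f : ι → Γ(W, ⊤)) (S : Set ι) (j : J ⟶ W) : Prop where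
  isClosedImmersion : IsClosedImmersion j
  ker_eq : j.ker = cutIdeal f S

lemma cutIdeal_ideal (U : W.affineOpens) :
    (cutIdeal f S).ideal U = Ideal.span ((fun i => res U.1 (f i)) '' Sᶜ) := by
  rw [cutIdeal, Scheme.IdealSheafData.ofIdealTop_ideal, Ideal.map_span, Set.image_image]

lemma cutIdeal_le_iff : cutIdeal f S ≤ j.ker ↔ ∀ i ∉ S, j.appTop (f i) = 0 := by
  rw [Scheme.Hom.ker, Scheme.IdealSheafData.le_ofIdeals_iff]
  refine ⟨fun h i hi => eq_zero_of_forall_exists_res_eq_zero _ fun y => ?_, fun h U => ?_⟩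
  · obtain ⟨U, hU⟩ := exists_affineOpen_mem (j y)
    refine ⟨j ⁻¹ᵁ U.1, hU, ?_⟩
    rw [← app_res]
    have := h U
    rw [cutIdeal_ideal, Ideal.span_le] at this
    exact this ⟨i, hi, rfl⟩
  · rw [cutIdeal_ideal, Ideal.span_le]
    rintro _ ⟨i, hi, rfl⟩
    change j.app U.1 _ = 0
    rw [app_res, h i hi, map_zero]

lemma mem_support_cutIdeal {w : W} :
    w ∈ (cutIdeal f S).support ↔ ∀ i ∉ S, w ∉ W.basicOpen (f i) := by
  rw [← SetLike.mem_coe, cutIdeal, Scheme.IdealSheafData.coe_support_ofIdealTop,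
    Scheme.zeroLocus_span, Scheme.mem_zeroLocus_iff, Set.forall_mem_image]
  rfl

lemma isCut_subschemeι (f : ι → Γ(W, ⊤)) (S : Set ι) : IsCut f S (cutIdeal f S).subschemeι :=
  ⟨inferInstance, Scheme.IdealSheafData.ker_subschemeι _⟩

lemma isCut_univ (f : ι → Γ(W, ⊤)) : IsCut f Set.univ (𝟙 W) := by
  refine ⟨inferInstance, ?_⟩
  rw [Scheme.Hom.ker_eq_bot_of_isIso]
  refine Scheme.IdealSheafData.ext ?_
  ext1 U
  rw [cutIdeal_ideal]
  simp

lemma IsCut.restrict (h : IsCut f S j) (U : W.Opens) :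
    IsCut (fun i => U.ι.appTop (f i)) S (j ∣_ U) := by
  have := h.isClosedImmersion
  refine ⟨inferInstance, Scheme.IdealSheafData.ext ?_⟩
  ext1 V
  rw [Scheme.ker_morphismRestrict_ideal, h.ker_eq, cutIdeal_ideal, cutIdeal_ideal]
  congr 1
  refine Set.image_congr fun i _ => ?_
  simp only [res, Scheme.Opens.ι_appTop]
  exact congr($(W.presheaf.map_comp (homOfLE (le_top : U.ι ''ᵁ ⊤ ≤ ⊤)).op
    (homOfLE (U.ι.image_mono le_top : U.ι ''ᵁ V.1 ≤ U.ι ''ᵁ ⊤)).op) (f i))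

lemma IsCut.appTop_eq_zero (h : IsCut f S j) {i : ι}
    (hi : i ∉ S) : j.appTop (f i) = 0 :=
  cutIdeal_le_iff.1 h.ker_eq.ge i hi

lemma IsCut.exists_lift (h : IsCut f S j) {T : Scheme.{u}}
    (t : T ⟶ W) (ht : ∀ i ∉ S, t.appTop (f i) = 0) : ∃ t' : T ⟶ J, t' ≫ j = t := by
  have := h.isClosedImmersion
  have H : j.ker ≤ t.ker := by rw [h.ker_eq, cutIdeal_le_iff]; exact ht
  exact ⟨IsClosedImmersion.lift j t H, IsClosedImmersion.lift_fac _ _ _⟩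

lemma IsCut.range_eq (h : IsCut f S j) :
    Set.range j = {w | ∀ i ∉ S, w ∉ W.basicOpen (f i)} := by
  have := h.isClosedImmersion
  have hsupp := j.support_ker
  rw [h.ker_eq, j.isClosedEmbedding.isClosed_range.closure_eq] at hsupp
  ext w
  rw [← hsupp]
  exact mem_support_cutIdeal

lemma IsCut.ker_app (h : IsCut f S j)
    (U : W.affineOpens) :
    RingHom.ker (j.app U.1).hom = Ideal.span ((fun i => res U.1 (f i)) '' Sᶜ) := by
  have := h.isClosedImmersion
  rw [← cutIdeal_ideal, ← h.ker_eq, Scheme.Hom.ker_apply]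

end Cuts

section SmoothCoordinates

variable {k : Type u} [Field k] {ι : Type} {W J : Scheme.{u}}

/-- The pullback of functions along a morphism to an affine scheme. -/
def pullSpec {R : Type u} [CommRing R] (t : W ⟶ Spec (CommRingCat.of R)) : R →+* Γ(W, ⊤) :=
  t.appTop.hom.comp (Scheme.ΓSpecIso (CommRingCat.of R)).inv.hom

lemma pullSpec_comp {R : Type u} [CommRing R] (s : J ⟶ W) (t : W ⟶ Spec (CommRingCat.of R)) :
    pullSpec (s ≫ t) = s.appTop.hom.comp (pullSpec t) := by
  rw [pullSpec, Scheme.Hom.comp_appTop]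
  rfl

lemma pullSpec_comp_specMap {R R' : Type u} [CommRing R] [CommRing R']
    (t : W ⟶ Spec (CommRingCat.of R)) (φ : R' →+* R) :
    pullSpec (t ≫ Spec.map (CommRingCat.ofHom φ)) = (pullSpec t).comp φ := by
  have h := Scheme.ΓSpecIso_inv_naturality (CommRingCat.ofHom φ)
  rw [pullSpec_comp]
  exact congrArg t.appTop.hom.comp congr(($h).hom).symm

lemma pullSpec_injective {R : Type u} [CommRing R] :
    Function.Injective (pullSpec : (W ⟶ Spec (CommRingCat.of R)) → R →+* Γ(W, ⊤)) := by
  intro s t h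
  refine ext_of_isAffine ((cancel_epi (Scheme.ΓSpecIso (CommRingCat.of R)).inv).1 ?_)
  exact CommRingCat.hom_ext h

/-- The functions `f i` are the coordinates of a smooth morphism to an affine space over `k`. -/
def SmoothCoordinates (k : Type u) [Field k] (f : ι → Γ(W, ⊤)) : Prop :=
  ∃ t : W ⟶ Spec (CommRingCat.of (MvPolynomial ι k)),
    Smooth t ∧ ∀ i, pullSpec t (.X i) = f i

lemma SmoothCoordinates.comp {f : ι → Γ(W, ⊤)} (hf : SmoothCoordinates k f) (s : J ⟶ W)
    [Smooth s] : SmoothCoordinates k fun i => s.appTop (f i) := by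
  obtain ⟨t, ht, htf⟩ := hf
  refine ⟨s ≫ t, inferInstance, fun i => ?_⟩
  rw [pullSpec_comp, RingHom.comp_apply, htf]

lemma smoothCoordinates_mat [Finite ι] {Y : KSch k} (g : Y ⟶ GSch k ι) (hg : Smooth g.left) :
    SmoothCoordinates (W := Y.left) k fun i => (mat g i 0 0 : Γ(Y.left, ⊤)) := by
  let t : Y.left ⟶ Spec (CommRingCat.of (CoordRing k ι)) := g.left
  have : Smooth t := hg
  have : Smooth (Spec.map (CommRingCat.ofHom
      (upperLeft k ι : MvPolynomial ι k →+* CoordRing k ι))) :=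
    (HasRingHomProperty.Spec_iff (P := @Smooth)).2 (upperLeft_smooth k ι)
  refine ⟨t ≫ Spec.map (CommRingCat.ofHom (upperLeft k ι : MvPolynomial ι k →+* CoordRing k ι)),
    inferInstance, fun i => ?_⟩
  rw [pullSpec_comp_specMap]
  exact congrArg (pullSpec t) (MvPolynomial.aeval_X _ i)

/-- The inclusion of a coordinate subspace in an affine space over `k`. -/
def coordIncl (k : Type u) [Field k] (S : Set ι) :
    Spec (CommRingCat.of (MvPolynomial S k)) ⟶ Spec (CommRingCat.of (MvPolynomial ι k)) :=
  Spec.map (CommRingCat.ofHom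
    (MvPolynomial.killCompl (R := k) (Subtype.val_injective (p := (· ∈ S)))).toRingHom)

/-- The projection of an affine space over `k` to a coordinate subspace. -/
def coordProj (k : Type u) [Field k] (S : Set ι) :
    Spec (CommRingCat.of (MvPolynomial ι k)) ⟶ Spec (CommRingCat.of (MvPolynomial S k)) :=
  Spec.map (CommRingCat.ofHom
    (MvPolynomial.rename (R := k) (Subtype.val : S → ι)).toRingHom)

lemma coordIncl_comp_coordProj (S : Set ι) : coordIncl k S ≫ coordProj k S = 𝟙 _ := by
  rw [coordIncl, coordProj, ← Spec.map_comp, ← CommRingCat.ofHom_comp, ← Spec.map_id]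
  exact congrArg (fun φ : MvPolynomial S k →ₐ[k] _ => Spec.map (CommRingCat.ofHom φ.toRingHom))
    (MvPolynomial.killCompl_comp_rename Subtype.val_injective)

lemma pullSpec_comp_coordProj (t : W ⟶ Spec (CommRingCat.of (MvPolynomial ι k))) {S : Set ι}
    (i : S) : pullSpec (t ≫ coordProj k S) (.X i) = pullSpec t (.X i) := by
  rw [coordProj, pullSpec_comp_specMap]
  exact congrArg (pullSpec t) (MvPolynomial.rename_X _ i)

lemma pullSpec_comp_coordIncl_of_notMem {S : Set ι}
    (t : W ⟶ Spec (CommRingCat.of (MvPolynomial S k))) {i : ι} (hi : i ∉ S) :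
    pullSpec (t ≫ coordIncl k S) (.X i) = 0 := by
  have hX : MvPolynomial.killCompl (R := k) (Subtype.val_injective (p := (· ∈ S))) (.X i) = 0 := by
    simp [MvPolynomial.killCompl, hi]
  rw [coordIncl, pullSpec_comp_specMap]
  exact (congrArg (pullSpec t) hX).trans (map_zero _)

lemma comp_coordProj_comp_coordIncl {t : W ⟶ Spec (CommRingCat.of (MvPolynomial ι k))}
    {S : Set ι} (ht : ∀ i ∉ S, pullSpec t (.X i) = 0) :
    t ≫ coordProj k S ≫ coordIncl k S = t := by
  refine pullSpec_injective ?_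
  rw [coordProj, coordIncl, ← Category.assoc, pullSpec_comp_specMap, pullSpec_comp_specMap]
  refine MvPolynomial.ringHom_ext (fun c => ?_) fun i => ?_
  · simp
  · by_cases hi : i ∈ S
    · simpa using congrArg (fun q => pullSpec t (MvPolynomial.rename Subtype.val q))
        (MvPolynomial.killCompl_rename_app (R := k) Subtype.val_injective
          (MvPolynomial.X (⟨i, hi⟩ : S)))
    · simp [MvPolynomial.killCompl, hi, ht i hi]

lemma IsCut.isPullback {f : ι → Γ(W, ⊤)} {S : Set ι} {j : J ⟶ W} (h : IsCut f S j)
    {t : W ⟶ Spec (CommRingCat.of (MvPolynomial ι k))} (ht : ∀ i, pullSpec t (.X i) = f i) :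
    IsPullback j (j ≫ t ≫ coordProj k S) t (coordIncl k S) := by
  have := h.isClosedImmersion
  have hcomm : j ≫ t = (j ≫ t ≫ coordProj k S) ≫ coordIncl k S := by
    rw [Category.assoc, Category.assoc, ← Category.assoc j,
      comp_coordProj_comp_coordIncl fun i hi => ?_]
    rw [pullSpec_comp, RingHom.comp_apply, ht]
    exact h.appTop_eq_zero hi
  refine ⟨⟨hcomm⟩, ⟨Limits.PullbackCone.isLimitAux' _ fun c => ?_⟩⟩
  have hzero (i : ι) (hi : i ∉ S) : c.fst.appTop (f i) = 0 := by
    rw [← ht i, ← RingHom.comp_apply, ← pullSpec_comp, c.condition]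
    exact pullSpec_comp_coordIncl_of_notMem c.snd hi
  have hlift := (h.exists_lift c.fst hzero).choose_spec
  refine ⟨_, hlift, ?_, fun hm _ => (cancel_mono j).1 (hm.trans hlift.symm)⟩
  change _ ≫ j ≫ t ≫ coordProj k S = c.snd
  rw [reassoc_of% hlift, reassoc_of% c.condition, coordIncl_comp_coordProj, Category.comp_id]

lemma IsCut.smoothCoordinates {f : ι → Γ(W, ⊤)} {S : Set ι} {j : J ⟶ W} (h : IsCut f S j)
    (hf : SmoothCoordinates k f) : SmoothCoordinates k fun i : S => j.appTop (f i) := by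
  obtain ⟨t, ht, htf⟩ := hf
  refine ⟨_, MorphismProperty.of_isPullback (h.isPullback htf) ht, fun i => ?_⟩
  rw [← Category.assoc, pullSpec_comp_coordProj, pullSpec_comp, RingHom.comp_apply, htf]

lemma SmoothCoordinates.exists_isDomain {f : ι → Γ(W, ⊤)} (hf : SmoothCoordinates k f) (y : W) :
    ∃ V : W.affineOpens, y ∈ V.1 ∧ IsDomain Γ(W, V.1) := by
  obtain ⟨t, ht, -⟩ := hf
  obtain ⟨U, hU⟩ := exists_affineOpen_mem y
  have hsmooth : ((res U.1).comp (pullSpec t)).Smooth :=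
    (RingHom.Smooth.of_bijective (ConcreteCategory.bijective_of_isIso
      (Scheme.ΓSpecIso (CommRingCat.of (MvPolynomial ι k))).inv)).comp
      (ht.smooth_appLE (isAffineOpen_top _) U.2 le_top)
  algebraize [(res U.1).comp (pullSpec t)]
  obtain ⟨s, hs, _⟩ := exists_isDomain_localizationAway_of_smooth (R := MvPolynomial ι k)
    (U.2.primeIdealOf ⟨y, hU⟩).asIdeal
  have := U.2.isLocalization_basicOpen s
  refine ⟨⟨W.basicOpen s, U.2.basicOpen s⟩, ?_,
    (IsLocalization.algEquiv (.powers s) (Localization.Away s) _).symm.toMulEquiv.isDomain _⟩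
  have hmem : U.2.primeIdealOf ⟨y, hU⟩ ∈ U.2.fromSpec ⁻¹ᵁ W.basicOpen s := by
    rwa [U.2.fromSpec_preimage_basicOpen]
  have hy : U.2.fromSpec (U.2.primeIdealOf ⟨y, hU⟩) = y := U.2.fromSpec_primeIdealOf ⟨y, hU⟩
  rw [← hy]
  exact hmem

lemma SmoothCoordinates.isRegularFn {f : ι → Γ(W, ⊤)} (hf : SmoothCoordinates k f) (i : ι) :
    IsRegularFn (f i) := by
  obtain ⟨t, ht, htf⟩ := hf
  rw [← htf]
  refine IsRegularFn.of_flat t fun y => mem_nonZeroDivisors_of_ne_zero ?_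
  refine (map_ne_zero_iff _ (germ_injective_of_isIntegral _ y (U := ⊤) trivial)).2 ?_
  refine (map_ne_zero_iff _
    (ConcreteCategory.bijective_of_isIso (Scheme.ΓSpecIso (CommRingCat.of _)).inv).injective).2 ?_
  exact MvPolynomial.X_ne_zero i

lemma IsCut.dvd_of_appTop_eq_zero {f : ι → Γ(W, ⊤)}
    (hf : SmoothCoordinates k f) {S : Set ι} {j : J ⟶ W} (h : IsCut f S j) {i : ι} (hi : i ∈ S)
    {J' : Scheme.{u}} {j' : J' ⟶ W} (h' : IsCut f (S \ {i}) j') (r : J' ⟶ J) (hr : r ≫ j = j')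
    (a : Γ(J, ⊤)) (ha : r.appTop a = 0) : j.appTop (f i) ∣ a := by
  have := h.isClosedImmersion
  refine ((h.smoothCoordinates hf).isRegularFn ⟨i, hi⟩).dvd_of_local fun y => ?_
  obtain ⟨U, hU⟩ := exists_affineOpen_mem (j y)
  refine ⟨j ⁻¹ᵁ U.1, hU, ?_⟩
  obtain ⟨b, hb⟩ := j.app_surjective U.1 U.2 (res (j ⁻¹ᵁ U.1) a)
  have hker : b ∈ RingHom.ker (j'.app U.1).hom := by
    subst hr
    rw [RingHom.mem_ker, Scheme.Hom.comp_app]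
    change r.app _ (j.app U.1 b) = 0
    rw [hb, app_res, ha, map_zero]
  have hS : (S \ {i})ᶜ = insert i Sᶜ := by
    ext l; by_cases hl : l = i <;> simp [hl]
  rw [h'.ker_app, hS, Set.image_insert_eq, Ideal.mem_span_insert, ← h.ker_app] at hker
  obtain ⟨c, z, hz, rfl⟩ := hker
  rw [← hb, map_add, map_mul, app_res, show j.app U.1 z = 0 from hz, add_zero]
  exact dvd_mul_left _ _
end SmoothCoordinates

/-! ### Relatively open and closed subsets that avoid a closed stratum -/

section Topology

variable {Y X : Type*}

/-- `A` is a union of fibres of `π`. -/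
def Saturated (π : Y → X) (A : Set Y) : Prop :=
  ∀ y y', π y = π y' → y ∈ A → y' ∈ A

lemma Saturated.preimage_image {π : Y → X} {A : Set Y} (hA : Saturated π A) :
    π ⁻¹' (π '' A) = A := by
  refine Set.Subset.antisymm ?_ (Set.subset_preimage_image _ _)
  rintro y ⟨a, ha, hay⟩
  exact hA a y hay ha

variable [TopologicalSpace Y]

/-- `A` is a relatively open subset of `Z`. -/
def RelOpen (Z A : Set Y) : Prop :=
  A ⊆ Z ∧ ∀ y ∈ A, ∃ V : Set Y, IsOpen V ∧ y ∈ V ∧ V ∩ Z ⊆ A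

/-- Every point of `Z` has an irreducible neighbourhood in `Z`. -/
def LocallyIrreducible (Z : Set Y) : Prop :=
  ∀ y ∈ Z, ∃ V : Set Y, IsOpen V ∧ y ∈ V ∧ IsPreirreducible (V ∩ Z)

/-- The union of the saturated, closed and relatively open subsets of `Z` that do not meet `E`.
It consists of the components of `Z` on which a section need not be seen near `E`. -/
def avoidingLocus (π : Y → X) (Z E : Set Y) : Set Y :=
  ⋃₀ {A | Saturated π A ∧ IsClosed A ∧ RelOpen Z A ∧ Disjoint A E}

variable {π : Y → X} {Z E A : Set Y}

lemma Saturated.closure [TopologicalSpace X] (hπ : IsOpenMap π) (hc : Continuous π)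
    (hA : Saturated π A) : Saturated π (closure A) := by
  have hclosure := hπ.preimage_closure_eq_closure_preimage hc (π '' A)
  rw [hA.preimage_image] at hclosure
  intro y y' hyy hy
  rw [← hclosure, Set.mem_preimage] at hy ⊢
  rwa [← hyy]

lemma RelOpen.isClosed_diff (hZ : IsClosed Z) (hA : RelOpen Z A) : IsClosed (Z \ A) := by
  rw [← isOpen_compl_iff, isOpen_iff_forall_mem_open]
  intro y hy
  by_cases hyA : y ∈ A
  · obtain ⟨V, hV, hyV, hsub⟩ := hA.2 y hyA
    exact ⟨V, fun v hv hv' => hv'.2 (hsub ⟨hv, hv'.1⟩), hV, hyV⟩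
  · exact ⟨Zᶜ, fun v hv hv' => hv hv'.1, hZ.isOpen_compl, fun h => hy ⟨h, hyA⟩⟩

lemma RelOpen.connectedComponentIn_subset_image [TopologicalSpace X]
    (hπ : Topology.IsQuotientMap π) {F : Set X} (hF : IsClosed F) (hA : IsClosed A)
    (hopen : RelOpen (π ⁻¹' F) A) (hsat : Saturated π A) {y : Y} (hy : y ∈ A) :
    connectedComponentIn F (π y) ⊆ π '' A := by
  have himage : IsClosed (π '' A) := by
    rwa [← hπ.isClosed_preimage, hsat.preimage_image]
  have hdiff : IsClosed (F \ π '' A) := by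
    rw [← hπ.isClosed_preimage, Set.preimage_sdiff, hsat.preimage_image]
    exact hopen.isClosed_diff (hF.preimage hπ.continuous)
  have hcover : connectedComponentIn F (π y) ⊆ π '' A ∪ F \ π '' A := by
    rw [Set.union_sdiff_self]
    exact (connectedComponentIn_subset _ _).trans Set.subset_union_right
  have hdisj : connectedComponentIn F (π y) ∩ (π '' A ∩ (F \ π '' A)) = ∅ := by
    rw [Set.inter_sdiff_self, Set.inter_empty]
  refine (isPreconnected_iff_subset_of_disjoint_closed.1 isPreconnected_connectedComponentIn _ _
    himage hdiff hcover hdisj).resolve_right fun hsub => ?_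
  exact (hsub (mem_connectedComponentIn (hopen.1 hy))).2 ⟨y, hy, rfl⟩

lemma RelOpen.closure (hZ : IsClosed Z) (hirr : LocallyIrreducible Z) (hA : RelOpen Z A) :
    RelOpen Z (closure A) := by
  refine ⟨hZ.closure_subset_iff.2 hA.1, fun y hy => ?_⟩
  obtain ⟨V, hV, hyV, hVirr⟩ := hirr y (hZ.closure_subset_iff.2 hA.1 hy)
  refine ⟨V, hV, hyV, fun v hv => ?_⟩
  rw [mem_closure_iff]
  intro U hU hvU
  obtain ⟨a, haV, haA⟩ := mem_closure_iff.1 hy V hV hyV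
  obtain ⟨V', hV', haV', hsub⟩ := hA.2 a haA
  obtain ⟨b, hb, hbU, hbV'⟩ := hVirr U V' hU hV' ⟨v, hv, hvU⟩ ⟨a, ⟨haV, hA.1 haA⟩, haV'⟩
  exact ⟨b, hbU, hsub ⟨hbV', hb.2⟩⟩

lemma avoidingLocus_subset : avoidingLocus π Z E ⊆ Z :=
  Set.sUnion_subset fun _ hA => hA.2.2.1.1

lemma LocallyIrreducible.isClosed_avoidingLocus (hZ : IsClosed Z) (hirr : LocallyIrreducible Z) :
    IsClosed (avoidingLocus π Z E) := by
  refine isClosed_of_closure_subset fun y hy => ?_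
  have hyZ : y ∈ Z := hZ.closure_subset_iff.2 avoidingLocus_subset hy
  obtain ⟨V, hV, hyV, hVirr⟩ := hirr y hyZ
  obtain ⟨a, haV, A, hA, haA⟩ := mem_closure_iff.1 hy V hV hyV
  refine ⟨A, hA, ?_⟩
  by_contra hyA
  obtain ⟨V', hV', haV', hsub⟩ := hA.2.2.1.2 a haA
  obtain ⟨b, hb, hbV', hbA⟩ := hVirr V' Aᶜ hV' hA.2.1.isOpen_compl
    ⟨a, ⟨haV, hA.2.2.1.1 haA⟩, haV'⟩ ⟨y, ⟨hyV, hyZ⟩, hyA⟩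
  exact hbA (hsub ⟨hbV', hb.2⟩)

lemma saturated_avoidingLocus : Saturated π (avoidingLocus π Z E) := by
  rintro y y' hyy ⟨A, hA, hy⟩
  exact ⟨A, hA, hA.1 y y' hyy hy⟩

lemma relOpen_avoidingLocus : RelOpen Z (avoidingLocus π Z E) := by
  refine ⟨avoidingLocus_subset, ?_⟩
  rintro y ⟨A, hA, hy⟩
  obtain ⟨V, hV, hyV, hsub⟩ := hA.2.2.1.2 y hy
  exact ⟨V, hV, hyV, hsub.trans (Set.subset_sUnion_of_mem hA)⟩

lemma disjoint_avoidingLocus : Disjoint (avoidingLocus π Z E) E :=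
  Set.disjoint_sUnion_left.2 fun _ hA => hA.2.2.2

lemma RelOpen.closure_inter_nonempty [TopologicalSpace X] (hπ : IsOpenMap π) (hc : Continuous π)
    (hZ : IsClosed Z) (hirr : LocallyIrreducible Z) (hA : RelOpen Z A) (hsat : Saturated π A)
    {a : Y} (ha : a ∈ A) (ha' : a ∉ avoidingLocus π Z E) :
    (_root_.closure A ∩ E).Nonempty := by
  by_contra hcon
  exact ha' ⟨_root_.closure A, ⟨hsat.closure hπ hc, isClosed_closure, hA.closure hZ hirr,
    Set.disjoint_iff_inter_eq_empty.2 (Set.not_nonempty_iff_eq_empty.1 hcon)⟩, subset_closure ha⟩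

end Topology

/-! ### Stable subschemes and cuts of the torsor -/

section Stable

variable {k : Type u} [Field k] {ι : Type} {p : ℕ} {σ : Equiv.Perm ι} {X : KSch k}

namespace ZipMorphism

variable (ζ : ZipMorphism p σ X)

/-- The upper left entry at `i`, as a function on the torsor. -/
def entry (i : ι) : Γ(ζ.I.left, ⊤) := mat ζ.q i 0 0

/-- The graph of the action of the zip group, restricted to `J`. -/
def actRel {J : KSch k} (j : J ⟶ ζ.I) (T : KSch k) (e : zipGroup p σ (Fn T)) (z z' : T ⟶ J) :
    Prop :=
  ζ.act e (z ≫ j) = z' ≫ j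

/-- `J` is a subscheme of the torsor that is stable under the zip group. As the zip group is
simply transitive on the fibres of `π`, this is a condition on points with the same image. -/
structure IsStable {J : KSch k} (j : J ⟶ ζ.I) : Prop where
  isPreimmersion : IsPreimmersion j.left
  exists_lift : ∀ {T : KSch k} (z : T ⟶ J) (w : T ⟶ ζ.I), w ≫ ζ.π = z ≫ j ≫ ζ.π →
    ∃ w' : T ⟶ J, w' ≫ j = w

/-- `(z, w)` is the universal pair of points of `J` in the same orbit, and `e` maps `z` to `w`. -/
structure IsOrbitPair {J T : KSch k} (j : J ⟶ ζ.I) (z w : T ⟶ J) (e : zipGroup p σ (Fn T)) :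
    Prop where
  actRel : ζ.actRel j T e z w
  isPullback : IsPullback z.left (w ≫ j).left (j ≫ ζ.π).left ζ.π.left

variable {ζ} {J T : KSch k} {j : J ⟶ ζ.I} {z w : T ⟶ J} {e : zipGroup p σ (Fn T)}

lemma isStable_id : ζ.IsStable (𝟙 ζ.I) :=
  ⟨inferInstanceAs (IsPreimmersion (𝟙 ζ.I.left)), fun _ w _ => ⟨w, Category.comp_id w⟩⟩

lemma IsStable.mono (hj : ζ.IsStable j) : Mono j :=
  have := hj.isPreimmersion
  Over.mono_of_mono_left j

lemma isCompatible_actRel (j : J ⟶ ζ.I) : IsCompatible (ζ.actRel j) (j ≫ ζ.q) := by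
  intro T e z z' h
  rw [← Category.assoc, ← Category.assoc, ← (h : ζ.act e (z ≫ j) = z' ≫ j), ζ.act_q]

lemma actRel_comp_iff {J' : KSch k} (r : J' ⟶ J) (j : J ⟶ ζ.I) {z z' : T ⟶ J'} :
    ζ.actRel (r ≫ j) T e z z' ↔ ζ.actRel j T e (z ≫ r) (z' ≫ r) := by
  simp only [actRel, Category.assoc]

lemma IsStable.exists_isOrbitPair (hj : ζ.IsStable j) :
    ∃ (T : KSch k) (z w : T ⟶ J) (e : zipGroup p σ (Fn T)), ζ.IsOrbitPair j z w e := by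
  let T : KSch k := Over.mk (Limits.pullback.fst (j ≫ ζ.π).left ζ.π.left ≫ J.hom)
  let z : T ⟶ J := Over.homMk (Limits.pullback.fst (j ≫ ζ.π).left ζ.π.left) rfl
  let v : T ⟶ ζ.I := Over.homMk (Limits.pullback.snd (j ≫ ζ.π).left ζ.π.left) (by
    have := Limits.pullback.condition (f := (j ≫ ζ.π).left) (g := ζ.π.left)
    simp only [T, Over.mk_hom, ← Over.w ζ.π, ← Over.w (j ≫ ζ.π)]
    rw [reassoc_of% this])
  have hv : v ≫ ζ.π = z ≫ j ≫ ζ.π := by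
    ext1
    exact Limits.pullback.condition.symm
  obtain ⟨w, hw⟩ := hj.exists_lift z v hv
  obtain ⟨e, he, -⟩ := ζ.simply_transitive (z ≫ j) (w ≫ j) (by rw [hw, hv, Category.assoc])
  exact ⟨T, z, w, e, he, hw ▸ IsPullback.of_hasPullback _ _⟩

lemma IsOrbitPair.flat (h : ζ.IsOrbitPair j z w e) : Flat z.left :=
  MorphismProperty.of_isPullback h.isPullback.flip ζ.flat

lemma IsOrbitPair.exists_fac (h : ζ.IsOrbitPair j z w e) [Mono j] {T' : KSch k}
    {e' : zipGroup p σ (Fn T')} {z' w' : T' ⟶ J} (h' : ζ.actRel j T' e' z' w') :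
    ∃ t : T' ⟶ T, t ≫ z = z' ∧ t ≫ w = w' ∧ zipGroupMap (pull t) e = e' := by
  have hπ : z' ≫ j ≫ ζ.π = (w' ≫ j) ≫ ζ.π := by
    rw [← (h' : ζ.act e' (z' ≫ j) = w' ≫ j), ζ.act_π, Category.assoc]
  have hπ' := congrArg CommaMorphism.left hπ
  let t : T' ⟶ T := Over.homMk (h.isPullback.lift z'.left (w' ≫ j).left hπ') (by
    rw [← Over.w z, ← Category.assoc, h.isPullback.lift_fst, Over.w])
  have htz : t ≫ z = z' := by
    ext1
    exact h.isPullback.lift_fst _ _ hπ'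
  have htw : t ≫ w ≫ j = w' ≫ j := by
    ext1
    exact h.isPullback.lift_snd _ _ hπ'
  refine ⟨t, htz, by rwa [← cancel_mono j, Category.assoc], ?_⟩
  have hact := ζ.act_natural t e (z ≫ j)
  rw [show ζ.act e (z ≫ j) = w ≫ j from h.actRel, htw, ← Category.assoc, htz] at hact
  exact (ζ.simply_transitive (z' ≫ j) (w' ≫ j) (by rw [← hπ, Category.assoc])).unique hact.symm h'

lemma IsOrbitPair.exists_point (h : ζ.IsOrbitPair j z w e) (hj : ζ.IsStable j) {y y' : J.left}
    (hyy : ζ.π.left (j.left y) = ζ.π.left (j.left y')) : ∃ t : T.left, z.left t = y ∧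
      w.left t = y' := by
  have := hj.isPreimmersion
  obtain ⟨t, ht, ht'⟩ := Scheme.exists_preimage_of_isPullback h.isPullback y (j.left y') hyy
  exact ⟨t, ht, j.left.injective ht'⟩

lemma IsStable.isSection_of_mul [Fintype ι] (hj : ζ.IsStable j)
    {lam mu : ι → ℤ} {f h : Fn J} (hf : IsSection p σ J (ζ.actRel j) lam f)
    (hreg : IsRegularFn (J := J.left) f)
    (hfh : IsSection p σ J (ζ.actRel j) (lam + mu) (f * h)) :
    IsSection p σ J (ζ.actRel j) mu h := by
  have := hj.mono
  obtain ⟨T, z, w, e, hT⟩ := hj.exists_isOrbitPair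
  have := hT.flat
  have huniv : pull w h = (character mu e : Fn T) * pull z h := by
    have hf' := hf T e z w hT.actRel
    have hfh' := hfh T e z w hT.actRel
    rw [map_mul, map_mul, hf', character_add, Units.val_mul] at hfh'
    have hzero : pull z f * ((character lam e : Fn T) *
        (pull w h - (character mu e : Fn T) * pull z h)) = 0 := by
      linear_combination hfh'
    have hreg' : IsRegularFn (J := T.left) (pull z f) := hreg.of_flat z.left
    exact sub_eq_zero.1 ((Units.mul_right_eq_zero _).1 (hreg'.eq_zero hzero))
  intro T' e' z' w' h'
  obtain ⟨t, rfl, rfl, rfl⟩ := hT.exists_fac h'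
  rw [pull_comp, pull_comp, huniv, map_mul, character_zipGroupMap]
  rfl

lemma IsStable.mem_basicOpen_of_isSection [Fintype ι] (hj : ζ.IsStable j) {lam : ι → ℤ}
    {f : Γ(J.left, ⊤)} (hf : IsSection p σ J (ζ.actRel j) lam f) {y y' : J.left}
    (hyy : ζ.π.left (j.left y) = ζ.π.left (j.left y')) (hy : y ∈ J.left.basicOpen f) :
    y' ∈ J.left.basicOpen f := by
  obtain ⟨T, z, w, e, hT⟩ := hj.exists_isOrbitPair
  obtain ⟨t, rfl, rfl⟩ := hT.exists_point hj hyy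
  have hft : w.left.appTop f = (character lam e : Fn T) * z.left.appTop f := hf T e z w hT.actRel
  have hopen : T.left.basicOpen (w.left.appTop f) = T.left.basicOpen (z.left.appTop f) := by
    rw [hft, Scheme.basicOpen_mul, Scheme.basicOpen_of_isUnit _ (Units.isUnit _), top_inf_eq]
  have ht : t ∈ z.left ⁻¹ᵁ J.left.basicOpen f := hy
  change t ∈ w.left ⁻¹ᵁ J.left.basicOpen f
  rw [Scheme.preimage_basicOpen_top] at ht ⊢
  exact hopen ▸ ht

lemma isSection_entry [Fintype ι] [DecidableEq ι] (j : J ⟶ ζ.I) (i : ι) :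
    IsSection p σ J (ζ.actRel j) (hasseWeight p σ i) (pull j (ζ.entry i)) := by
  have hsec := (isCompatible_actRel j).isSection_upperLeft i
  rwa [mat_comp] at hsec

end ZipMorphism

end Stable

section CutsOfTorsor

variable {k : Type u} [Field k] {ι : Type} {p : ℕ} {σ : Equiv.Perm ι} {X : KSch k}

namespace ZipMorphism

/-- `j` is the closed immersion into the open `O` that is defined by the vanishing of the entries
with index outside `S`. -/
def IsCutOn (ζ : ZipMorphism p σ X) (O : ζ.I.left.Opens) (S : Finset ι) {J : KSch k}
    (j : J ⟶ ζ.I) : Prop :=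
  ∃ j' : J.left ⟶ O, j' ≫ O.ι = j.left ∧ IsCut (fun i => O.ι.appTop (ζ.entry i)) S j'

variable {ζ : ZipMorphism p σ X} {O : ζ.I.left.Opens} {S : Finset ι} {J : KSch k} {j : J ⟶ ζ.I}

variable (ζ O S) in
lemma exists_isCutOn : ∃ (J : KSch k) (j : J ⟶ ζ.I), ζ.IsCutOn O S j := by
  let c := (cutIdeal (fun i => O.ι.appTop (ζ.entry i)) (S : Set ι)).subschemeι
  exact ⟨Over.mk (c ≫ O.ι ≫ ζ.I.hom), Over.homMk (c ≫ O.ι) (Category.assoc _ _ _), c, rfl,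
    isCut_subschemeι _ _⟩

lemma pull_eq_of_comp_ι {j' : J.left ⟶ O} (h : j' ≫ O.ι = j.left) (a : Fn ζ.I) :
    pull j a = j'.appTop (O.ι.appTop a) := by
  rw [pull, ← h, Scheme.Hom.comp_appTop]
  rfl

lemma IsCutOn.mem (hj : ζ.IsCutOn O S j) (y : J.left) : j.left y ∈ O := by
  obtain ⟨j', hι, -⟩ := hj
  rw [← hι, Scheme.Hom.comp_apply]
  exact (j' y).2

lemma IsCutOn.isPreimmersion (hj : ζ.IsCutOn O S j) : IsPreimmersion j.left := by
  obtain ⟨j', hι, hcut⟩ := hj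
  have := hcut.isClosedImmersion
  rw [← hι]
  infer_instance

lemma IsCutOn.pull_entry_eq_zero (hj : ζ.IsCutOn O S j) {i : ι} (hi : i ∉ S) :
    pull j (ζ.entry i) = 0 := by
  obtain ⟨j', hι, hcut⟩ := hj
  rw [pull_eq_of_comp_ι hι]
  exact hcut.appTop_eq_zero (i := i) hi

lemma IsCutOn.exists_lift (hj : ζ.IsCutOn O S j) {T : KSch k} (w : T ⟶ ζ.I)
    (hw : ∀ t, w.left t ∈ O) (hw' : ∀ i ∉ S, pull w (ζ.entry i) = 0) :
    ∃ w' : T ⟶ J, w' ≫ j = w := by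
  obtain ⟨j', hι, hcut⟩ := hj
  have hO : Set.range w.left ⊆ Set.range O.ι := by
    rw [Scheme.Opens.range_ι]
    rintro _ ⟨t, rfl⟩
    exact hw t
  have hfac := IsOpenImmersion.lift_fac O.ι w.left hO
  obtain ⟨v, hv⟩ := hcut.exists_lift (IsOpenImmersion.lift O.ι w.left hO) fun i hi =>
    (pull_eq_of_comp_ι hfac _).symm.trans (hw' i hi)
  have hvj : v ≫ j.left = w.left := by
    rw [← hι, reassoc_of% hv, hfac]
  refine ⟨Over.homMk v ?_, ?_⟩
  · rw [← Over.w j, reassoc_of% hvj, Over.w w]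
  · ext1
    exact hvj

lemma IsCutOn.isStable [Finite ι] (hO : Saturated ζ.π.left O) (hj : ζ.IsCutOn O S j) :
    ζ.IsStable j := by
  classical
  have := Fintype.ofFinite ι
  refine ⟨hj.isPreimmersion, fun {T} z w hw => ?_⟩
  obtain ⟨e, he, -⟩ := ζ.simply_transitive (z ≫ j) w (by rw [hw, Category.assoc])
  refine hj.exists_lift w (fun t => ?_) fun i hi => ?_
  · exact hO (j.left (z.left t)) _ congr(($hw).left t).symm (hj.mem _)
  · have hsec := isSection_entry (𝟙 ζ.I) i T e (z ≫ j) w (by simpa only [actRel, Category.comp_id])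
    rw [pull_id, pull_comp, hj.pull_entry_eq_zero hi, map_zero, mul_zero] at hsec
    exact hsec

lemma IsSmooth.smoothCoordinates_entry [Finite ι] (hζ : ζ.IsSmooth) :
    SmoothCoordinates (W := ζ.I.left) k ζ.entry :=
  smoothCoordinates_mat ζ.q hζ

lemma IsCutOn.isRegularFn [Finite ι] (hj : ζ.IsCutOn O S j) (hζ : ζ.IsSmooth) {i : ι}
    (hi : i ∈ S) : IsRegularFn (J := J.left) (pull j (ζ.entry i)) := by
  obtain ⟨j', hι, hcut⟩ := hj
  rw [pull_eq_of_comp_ι hι]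
  exact (hcut.smoothCoordinates (hζ.smoothCoordinates_entry.comp O.ι)).isRegularFn ⟨i, hi⟩

lemma IsCutOn.exists_isDomain [Finite ι] (hj : ζ.IsCutOn O S j) (hζ : ζ.IsSmooth) (y : J.left) :
    ∃ V : J.left.affineOpens, y ∈ V.1 ∧ IsDomain Γ(J.left, V.1) := by
  obtain ⟨j', -, hcut⟩ := hj
  exact (hcut.smoothCoordinates (hζ.smoothCoordinates_entry.comp O.ι)).exists_isDomain y

lemma IsCutOn.isReduced [Finite ι] (hj : ζ.IsCutOn O S j) (hζ : ζ.IsSmooth) : IsReduced J.left :=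
  isReduced_of_exists_isDomain (hj.exists_isDomain hζ)

lemma IsCutOn.dvd_of_pull_eq_zero [Finite ι] [DecidableEq ι] (hj : ζ.IsCutOn O S j)
    (hζ : ζ.IsSmooth) {i : ι} (hi : i ∈ S) {J' : KSch k} (r : J' ⟶ J)
    (hr : ζ.IsCutOn O (S.erase i) (r ≫ j)) (a : Fn J) (ha : pull r a = 0) :
    pull j (ζ.entry i) ∣ a := by
  obtain ⟨j', hι, hcut⟩ := hj
  obtain ⟨j'', hι', hcut'⟩ := hr
  rw [Finset.coe_erase] at hcut'
  have hrj : r.left ≫ j' = j'' := by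
    rw [← cancel_mono O.ι, Category.assoc, hι, hι', Over.comp_left]
  rw [pull_eq_of_comp_ι hι]
  exact hcut.dvd_of_appTop_eq_zero (hζ.smoothCoordinates_entry.comp O.ι) (i := i) hi hcut'
    r.left hrj a ha

lemma IsCutOn.isLocallyNoetherian [Finite ι] (hj : ζ.IsCutOn O S j) (hζ : ζ.IsSmooth) :
    IsLocallyNoetherian J.left := by
  obtain ⟨j', -, hcut⟩ := hj
  have := hcut.isClosedImmersion
  have : Smooth ζ.q.left := hζ
  have : IsLocallyNoetherian (GSch k ι).left :=
    inferInstanceAs (IsLocallyNoetherian (Spec (CommRingCat.of (CoordRing k ι))))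
  have : IsLocallyNoetherian ζ.I.left := LocallyOfFiniteType.isLocallyNoetherian ζ.q.left
  have : IsLocallyNoetherian O := LocallyOfFiniteType.isLocallyNoetherian O.ι
  exact LocallyOfFiniteType.isLocallyNoetherian j'

end ZipMorphism

end CutsOfTorsor

section Division

lemma exists_eq_prod_pow_mul_of_notMem_pow {A α : Type*} [CommRing A] {I : Ideal A}
    (s : Finset α) {f : α → A} (hf : ∀ i ∈ s, f i ∈ I) {N : ℕ} {h : A} (hN : h ∉ I ^ N) :
    ∃ (a : α → ℕ) (g : A), h = (∏ l ∈ s, f l ^ a l) * g ∧ ∀ i ∈ s, ¬ f i ∣ g := by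
  classical
  induction N generalizing h with
  | zero => simp at hN
  | succ N ih =>
    by_cases hdvd : ∃ i ∈ s, f i ∣ h
    · obtain ⟨i, hi, h', rfl⟩ := hdvd
      obtain ⟨a, g, hg, hndvd⟩ := ih (h := h') fun hmem =>
        hN (pow_succ' I N ▸ Ideal.mul_mem_mul (hf i hi) hmem)
      refine ⟨fun l => (if i = l then 1 else 0) + a l, g, ?_, hndvd⟩
      simp only [pow_add, Finset.prod_mul_distrib, Finset.prod_pow_boole, if_pos hi]
      rw [hg, mul_assoc]
    · exact ⟨0, h, by simp, fun i hi hi' => hdvd ⟨i, hi, hi'⟩⟩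

lemma exists_eq_prod_pow_mul_of_germ_ne_zero {α : Type*} {J : Scheme.{u}} [IsLocallyNoetherian J]
    (s : Finset α) {f : α → Γ(J, ⊤)} {h : Γ(J, ⊤)} {y : J} (hf : ∀ i ∈ s, y ∉ J.basicOpen (f i))
    (hy : J.presheaf.germ ⊤ y trivial h ≠ 0) :
    ∃ (a : α → ℕ) (g : Γ(J, ⊤)), h = (∏ l ∈ s, f l ^ a l) * g ∧ ∀ i ∈ s, ¬ f i ∣ g := by
  let m := IsLocalRing.maximalIdeal (J.presheaf.stalk y)
  let φ := (J.presheaf.germ ⊤ y trivial).hom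
  obtain ⟨N, hN⟩ : ∃ N, φ h ∉ m ^ N := by
    by_contra! hmem
    have hkrull := Ideal.iInf_pow_eq_bot_of_isLocalRing m (Ideal.IsPrime.ne_top inferInstance)
    exact hy (by rwa [← Ideal.mem_bot, ← hkrull, Ideal.mem_iInf])
  refine exists_eq_prod_pow_mul_of_notMem_pow (I := m.comap φ) (N := N) s (fun i hi => ?_)
    fun hmem => hN (Ideal.le_comap_pow φ N hmem)
  rw [Ideal.mem_comap, IsLocalRing.mem_maximalIdeal, mem_nonunits_iff, ← Scheme.mem_basicOpen_top]
  exact hf i hi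

variable {k : Type u} [Field k] {ι : Type} [Fintype ι] {p : ℕ} {σ : Equiv.Perm ι} {X : KSch k}

namespace ZipMorphism

/-- The weights of the non-zero sections on the cuts of `O`. -/
def cutWeights (ζ : ZipMorphism p σ X) (O : ζ.I.left.Opens) (S : Finset ι) : Set (ι → ℤ) :=
  {lam | ∃ (J : KSch k) (j : J ⟶ ζ.I) (h : Fn J), ζ.IsCutOn O S j ∧ h ≠ 0 ∧
    IsSection p σ J (ζ.actRel j) lam h}

lemma IsCutOn.sub_mem_cutWeights [DecidableEq ι] {ζ : ZipMorphism p σ X} {O : ζ.I.left.Opens}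
    {S : Finset ι} {J : KSch k} {j : J ⟶ ζ.I} (hj : ζ.IsCutOn O S j) (hζ : ζ.IsSmooth)
    (hO : Saturated ζ.π.left O) {lam : ι → ℤ} {h : Γ(J.left, ⊤)}
    (hh : IsSection p σ J (ζ.actRel j) lam h) {a : ι → ℕ} {g : Γ(J.left, ⊤)}
    (hg : h = (∏ l ∈ S, pull j (ζ.entry l) ^ a l) * g) {i : ι} (hi : i ∈ S)
    (hig : ¬ pull j (ζ.entry i) ∣ g) :
    lam - ∑ l ∈ S, a l • hasseWeight p σ l ∈ ζ.cutWeights O (S.erase i) := by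
  have hprod : IsSection p σ J (ζ.actRel j) (∑ l ∈ S, a l • hasseWeight p σ l)
      (∏ l ∈ S, pull j (ζ.entry l) ^ a l) :=
    IsSection.prod S fun l _ => (isSection_entry j l).pow (a l)
  have hsec : IsSection p σ J (ζ.actRel j) (lam - ∑ l ∈ S, a l • hasseWeight p σ l) g := by
    refine (hj.isStable hO).isSection_of_mul hprod
      (IsRegularFn.prod S fun l hl => (hj.isRegularFn hζ hl).pow _) ?_
    rw [add_sub_cancel]
    exact hg ▸ hh
  obtain ⟨J', j', hj'⟩ := ζ.exists_isCutOn O (S.erase i)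
  obtain ⟨r, rfl⟩ := hj.exists_lift j' hj'.mem fun l hl =>
    hj'.pull_entry_eq_zero fun h => hl (Finset.mem_of_mem_erase h)
  exact ⟨J', r ≫ j, pull r g, hj', fun hzero => hig (hj.dvd_of_pull_eq_zero hζ hi r hj' g hzero),
    hsec.pullback r fun _ _ _ _ h => (actRel_comp_iff r j).1 h⟩

lemma IsCutOn.exists_sub_mem_cutWeights [DecidableEq ι] {ζ : ZipMorphism p σ X}
    {O : ζ.I.left.Opens} {S : Finset ι} {J : KSch k} {j : J ⟶ ζ.I} (hj : ζ.IsCutOn O S j)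
    (hζ : ζ.IsSmooth) (hO : Saturated ζ.π.left O) {lam : ι → ℤ} {h : Γ(J.left, ⊤)}
    (hh : IsSection p σ J (ζ.actRel j) lam h) (y : J.left)
    (hy : J.left.presheaf.germ ⊤ y trivial h ≠ 0)
    (hyf : ∀ i ∈ S, j.left y ∉ ζ.I.left.basicOpen (ζ.entry i)) :
    ∃ a : ι → ℕ, ∀ i ∈ S, lam - ∑ l ∈ S, a l • hasseWeight p σ l ∈ ζ.cutWeights O (S.erase i) := by
  have := hj.isLocallyNoetherian hζ
  have hf : ∀ i ∈ S, y ∉ J.left.basicOpen (pull j (ζ.entry i)) := fun i hi => by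
    rw [← Scheme.preimage_basicOpen_top]
    exact hyf i hi
  obtain ⟨a, g, hg, hdvd⟩ := exists_eq_prod_pow_mul_of_germ_ne_zero S hf hy
  exact ⟨a, fun i hi => hj.sub_mem_cutWeights hζ hO hh hg hi (hdvd i hi)⟩

end ZipMorphism

end Division

/-! ### The good open subset -/

section GoodOpen

variable {k : Type u} [Field k] {ι : Type} {p : ℕ} {σ : Equiv.Perm ι} {X : KSch k}

namespace ZipMorphism

/-- The points of the torsor where the entries with index outside `S` vanish. -/
def zeroSet (ζ : ZipMorphism p σ X) (S : Finset ι) : Set ζ.I.left :=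
  {y | ∀ i ∉ S, y ∉ ζ.I.left.basicOpen (ζ.entry i)}

variable {ζ : ZipMorphism p σ X} {O : ζ.I.left.Opens} {S : Finset ι} {J : KSch k} {j : J ⟶ ζ.I}

lemma isClosed_zeroSet (S : Finset ι) : IsClosed (ζ.zeroSet S) := by
  simp only [zeroSet, Set.ofPred_forall]
  exact isClosed_iInter fun i => isClosed_iInter fun _ =>
    (ζ.I.left.basicOpen (ζ.entry i)).2.isClosed_compl

lemma zeroSet_mono {S T : Finset ι} (h : S ⊆ T) : ζ.zeroSet S ⊆ ζ.zeroSet T :=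
  fun _ hy i hi => hy i fun hiS => hi (h hiS)

lemma zeroSet_inter [DecidableEq ι] (S T : Finset ι) :
    ζ.zeroSet S ∩ ζ.zeroSet T = ζ.zeroSet (S ∩ T) := by
  ext y
  refine ⟨fun h i hi => ?_, fun h => ⟨zeroSet_mono Finset.inter_subset_left h,
    zeroSet_mono Finset.inter_subset_right h⟩⟩
  by_cases hS : i ∈ S
  · exact h.2 i fun hT => hi (Finset.mem_inter.2 ⟨hS, hT⟩)
  · exact h.1 i hS

lemma isOpenMap_π : IsOpenMap ζ.π.left := by
  have := ζ.flat
  have := ζ.locallyOfFinitePresentation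
  exact ζ.π.left.isOpenMap

lemma mem_basicOpen_entry_of_π_eq [Finite ι] {y y' : ζ.I.left}
    (hyy : ζ.π.left y = ζ.π.left y') {i : ι} (hy : y ∈ ζ.I.left.basicOpen (ζ.entry i)) :
    y' ∈ ζ.I.left.basicOpen (ζ.entry i) := by
  classical
  have := Fintype.ofFinite ι
  have hsec := isSection_entry (𝟙 ζ.I) i
  rw [pull_id] at hsec
  exact isStable_id.mem_basicOpen_of_isSection hsec hyy hy

lemma saturated_zeroSet [Finite ι] (S : Finset ι) : Saturated ζ.π.left (ζ.zeroSet S) :=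
  fun _ _ hyy hy i hi hy' => hy i hi (mem_basicOpen_entry_of_π_eq hyy.symm hy')

lemma IsCutOn.range_eq (hj : ζ.IsCutOn O S j) : Set.range j.left = ↑O ∩ ζ.zeroSet S := by
  obtain ⟨j', hι, hcut⟩ := hj
  rw [← hι, Scheme.Hom.comp_base, TopCat.coe_comp, Set.range_comp, hcut.range_eq]
  ext y
  simp only [← Scheme.preimage_basicOpen_top]
  exact ⟨fun ⟨x, hx, hxy⟩ => hxy ▸ ⟨x.2, hx⟩, fun ⟨hy, hy'⟩ => ⟨⟨y, hy⟩, hy', rfl⟩⟩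

lemma IsSmooth.locallyIrreducible_zeroSet [Finite ι] (hζ : ζ.IsSmooth) (S : Finset ι) :
    LocallyIrreducible (ζ.zeroSet S) := by
  intro y hy
  obtain ⟨J, j, hj⟩ := ζ.exists_isCutOn ⊤ S
  have := hj.isPreimmersion
  have hrange : Set.range j.left = ζ.zeroSet S := hj.range_eq.trans (Set.univ_inter _)
  obtain ⟨x, rfl⟩ : y ∈ Set.range j.left := hrange ▸ hy
  obtain ⟨V, hxV, hV⟩ := exists_isPreirreducible_of_exists_isDomain (hj.exists_isDomain hζ) x
  obtain ⟨U, hU, hUV⟩ := j.left.isEmbedding.isOpen_iff.1 V.2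
  refine ⟨U, hU, (hUV ▸ hxV : x ∈ j.left ⁻¹' U), ?_⟩
  rw [← hrange, ← Set.image_preimage_eq_inter_range, hUV]
  exact hV.image _ j.left.continuous.continuousOn

/-- The saturated open subset of the torsor obtained by removing, from all the closed sets
`zeroSet S`, the components that do not meet the smallest one. -/
def goodOpen [Finite ι] (hζ : ζ.IsSmooth) : ζ.I.left.Opens :=
  ⟨(⋃ S : Finset ι, avoidingLocus ζ.π.left (ζ.zeroSet S) (ζ.zeroSet ∅))ᶜ,
    (isClosed_iUnion_of_finite fun S =>
      (hζ.locallyIrreducible_zeroSet S).isClosed_avoidingLocus (isClosed_zeroSet S)).isOpen_compl⟩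

lemma mem_goodOpen [Finite ι] {hζ : ζ.IsSmooth} {y : ζ.I.left} :
    y ∈ goodOpen hζ ↔ ∀ S, y ∉ avoidingLocus ζ.π.left (ζ.zeroSet S) (ζ.zeroSet ∅) := by
  change y ∈ (⋃ S, avoidingLocus ζ.π.left (ζ.zeroSet S) (ζ.zeroSet ∅))ᶜ ↔ _
  simp

lemma saturated_goodOpen [Finite ι] (hζ : ζ.IsSmooth) : Saturated ζ.π.left (goodOpen hζ) := by
  intro y y' hyy hy
  rw [SetLike.mem_coe, mem_goodOpen] at hy ⊢
  exact fun S h => hy S (saturated_avoidingLocus y' y hyy.symm h)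

lemma zeroSet_empty_subset_goodOpen [Finite ι] (hζ : ζ.IsSmooth) : ζ.zeroSet ∅ ⊆ goodOpen hζ := by
  intro y hy
  rw [SetLike.mem_coe, mem_goodOpen]
  exact fun S h => Set.disjoint_left.1 disjoint_avoidingLocus h hy

lemma relOpen_zeroSet_singleton_diff_goodOpen [Finite ι] (hζ : ζ.IsSmooth) (i : ι) :
    RelOpen (ζ.zeroSet {i}) (ζ.zeroSet {i} \ goodOpen hζ) := by
  classical
  refine ⟨Set.sdiff_subset, fun y ⟨hy, hbad⟩ => ?_⟩
  rw [SetLike.mem_coe, mem_goodOpen] at hbad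
  push Not at hbad
  obtain ⟨T, hT⟩ := hbad
  obtain ⟨V, hV, hyV, hsub⟩ := relOpen_avoidingLocus.2 y hT
  have hiT : i ∈ T := by
    by_contra hiT
    have hyT : y ∈ ζ.zeroSet {i} ∩ ζ.zeroSet T := ⟨hy, avoidingLocus_subset hT⟩
    rw [zeroSet_inter, Finset.singleton_inter_of_notMem hiT] at hyT
    exact Set.disjoint_left.1 disjoint_avoidingLocus hT hyT
  refine ⟨V, hV, hyV, fun v hv => ⟨hv.2, fun hgood => ?_⟩⟩
  exact mem_goodOpen.1 hgood T
    (hsub ⟨hv.1, zeroSet_mono (Finset.singleton_subset_iff.2 hiT) hv.2⟩)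

lemma IsCutOn.relOpen_image (hj : ζ.IsCutOn O S j) (U : J.left.Opens) :
    RelOpen (ζ.zeroSet S) (j.left '' (U : Set J.left)) := by
  have := hj.isPreimmersion
  refine ⟨(Set.image_subset_range _ _).trans (hj.range_eq.trans_subset Set.inter_subset_right), ?_⟩
  rintro _ ⟨y, hy, rfl⟩
  obtain ⟨V, hV, hVU⟩ := j.left.isEmbedding.isOpen_iff.1 U.2
  refine ⟨V ∩ O, hV.inter O.2, ⟨(hVU ▸ hy : y ∈ j.left ⁻¹' V), hj.mem y⟩, ?_⟩
  rintro v ⟨⟨hvV, hvO⟩, hvS⟩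
  obtain ⟨x, rfl⟩ : v ∈ Set.range j.left := hj.range_eq ▸ ⟨hvO, hvS⟩
  exact ⟨x, (hVU ▸ hvV : x ∈ U.carrier), rfl⟩

lemma IsCutOn.saturated_image_basicOpen [Fintype ι] (hO : Saturated ζ.π.left O)
    (hj : ζ.IsCutOn O S j) {lam : ι → ℤ} {h : Γ(J.left, ⊤)}
    (hh : IsSection p σ J (ζ.actRel j) lam h) :
    Saturated ζ.π.left (j.left '' (J.left.basicOpen h : Set J.left)) := by
  rintro _ y' hyy ⟨y, hy, rfl⟩
  have hjy : j.left y ∈ (O : Set ζ.I.left) ∩ ζ.zeroSet S := hj.range_eq ▸ ⟨y, rfl⟩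
  obtain ⟨x, rfl⟩ : y' ∈ Set.range j.left :=
    hj.range_eq ▸ ⟨hO _ _ hyy hjy.1, saturated_zeroSet S _ _ hyy hjy.2⟩
  exact ⟨x, (hj.isStable hO).mem_basicOpen_of_isSection hh hyy hy, rfl⟩

lemma germ_ne_zero_of_mem_closure {J : Scheme.{u}} (h : Γ(J, ⊤)) {y : J}
    (hy : y ∈ closure (J.basicOpen h : Set J)) : J.presheaf.germ ⊤ y trivial h ≠ 0 := by
  intro hzero
  rw [← map_zero (J.presheaf.germ ⊤ y trivial).hom] at hzero
  obtain ⟨V, hyV, i, _, hV⟩ := J.presheaf.germ_eq (U := ⊤) (V := ⊤) y trivial trivial _ _ hzero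
  obtain ⟨v, hv, hvh⟩ := mem_closure_iff.1 hy V V.2 hyV
  have hvV : v ∈ V ⊓ J.basicOpen h := ⟨hv, hvh⟩
  rw [← Scheme.basicOpen_res _ _ i.op, hV, map_zero] at hvV
  simp at hvV

lemma IsCutOn.exists_germ_ne_zero [Fintype ι] (hζ : ζ.IsSmooth)
    (hj : ζ.IsCutOn (goodOpen hζ) S j) {lam : ι → ℤ} {h : Γ(J.left, ⊤)}
    (hh : IsSection p σ J (ζ.actRel j) lam h) (hne : h ≠ 0) :
    ∃ y : J.left, J.left.presheaf.germ ⊤ y trivial h ≠ 0 ∧ j.left y ∈ ζ.zeroSet ∅ := by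
  have := hj.isReduced hζ
  have := hj.isPreimmersion
  obtain ⟨y, hy⟩ := (TopologicalSpace.Opens.ne_bot_iff_nonempty _).1
    (mt (basicOpen_eq_bot_iff h).1 hne)
  obtain ⟨e, he, he'⟩ := (hj.relOpen_image (J.left.basicOpen h)).closure_inter_nonempty
    (E := ζ.zeroSet ∅) isOpenMap_π ζ.π.left.continuous (isClosed_zeroSet S)
    (hζ.locallyIrreducible_zeroSet S)
    (hj.saturated_image_basicOpen (saturated_goodOpen hζ) hh) ⟨y, hy, rfl⟩
    (mem_goodOpen.1 (hj.mem y) S)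
  obtain ⟨x, rfl⟩ : e ∈ Set.range j.left := hj.range_eq ▸
    ⟨zeroSet_empty_subset_goodOpen hζ he', zeroSet_mono (Finset.empty_subset S) he'⟩
  refine ⟨x, germ_ne_zero_of_mem_closure h ?_, he'⟩
  rwa [j.left.isEmbedding.closure_eq_preimage_closure_image]

lemma exists_sub_mem_cutWeights [Fintype ι] [DecidableEq ι] (hζ : ζ.IsSmooth) (S : Finset ι)
    {lam : ι → ℤ} (hlam : lam ∈ ζ.cutWeights (goodOpen hζ) S) :
    ∃ a : ι → ℕ, ∀ i ∈ S,
      lam - ∑ l ∈ S, a l • hasseWeight p σ l ∈ ζ.cutWeights (goodOpen hζ) (S.erase i) := by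
  obtain ⟨J, j, h, hj, hne, hh⟩ := hlam
  obtain ⟨y, hy, hy'⟩ := hj.exists_germ_ne_zero hζ hh hne
  exact hj.exists_sub_mem_cutWeights hζ (saturated_goodOpen hζ) hh y hy fun i _ =>
    hy' i (Finset.notMem_empty i)

end ZipMorphism

end GoodOpen

/-! ### Stratum closures and their restricted torsors -/

section Reduced

open TensorProduct

lemma eq_zero_of_isNilpotent_of_tmul {A B : Type*} [CommRing A] [CommRing B] [Algebra A B]
    [_root_.IsReduced A] [Module.Flat A B] {f : B} (hf : IsNilpotent f) (v : B ⊗[A] B)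
    (h : (1 : B) ⊗ₜ[A] f = v * (f ⊗ₜ[A] (1 : B))) : f = 0 := by
  have pow_eq_zero_of_succ : ∀ n : ℕ, f ^ (n + 1 + 1) = 0 → f ^ (n + 1) = 0 := by
    intro n hn
    refine eq_zero_of_tmul_self_eq_zero (A := A) ?_
    have hpow : (1 : B) ⊗ₜ[A] (f ^ (n + 1)) = v ^ (n + 1) * ((f ^ (n + 1)) ⊗ₜ[A] (1 : B)) := by
      simpa [mul_pow, Algebra.TensorProduct.tmul_pow] using congrArg (· ^ (n + 1)) h
    calc (f ^ (n + 1)) ⊗ₜ[A] (f ^ (n + 1))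
        = ((f ^ (n + 1)) ⊗ₜ[A] (1 : B)) * ((1 : B) ⊗ₜ[A] (f ^ (n + 1))) := by simp
      _ = v ^ (n + 1) * ((f ^ (n + 1) * f ^ (n + 1)) ⊗ₜ[A] (1 : B)) := by
        rw [hpow, mul_left_comm, Algebra.TensorProduct.tmul_mul_tmul, one_mul]
      _ = 0 := by
        rw [← pow_add, pow_eq_zero_of_le (by omega : n + 1 + 1 ≤ n + 1 + (n + 1)) hn, zero_tmul,
          mul_zero]
  obtain ⟨n, hn⟩ := hf
  have hn' : f ^ (n + 1) = 0 := by rw [pow_succ, hn, zero_mul]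
  clear hn
  induction n with
  | zero => simpa using hn'
  | succ n ih => exact ih (pow_eq_zero_of_succ n hn')

variable {J Y W : Scheme.{u}}

lemma appTop_SpecMap_fromSpec {V : J.Opens} (hV : IsAffineOpen V) {R : CommRingCat.{u}}
    (φ : Γ(J, V) ⟶ R) (f : Γ(J, ⊤)) :
    (Spec.map φ ≫ hV.fromSpec).appTop f = (Scheme.ΓSpecIso R).inv (φ (res V f)) := by
  have hfromSpec : hV.fromSpec.appTop f = (Scheme.ΓSpecIso Γ(J, V)).inv (res V f) := by
    have happ := congr($(hV.fromSpec_app_of_le ⊤ le_top) f)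
    simp only [CommRingCat.comp_apply] at happ
    exact happ.trans
      congr($((Spec Γ(J, V)).presheaf.map_id _) ((Scheme.ΓSpecIso Γ(J, V)).inv (res V f)))
  rw [Scheme.Hom.comp_appTop, CommRingCat.comp_apply, hfromSpec, ← CommRingCat.comp_apply,
    ← Scheme.ΓSpecIso_inv_naturality, CommRingCat.comp_apply]

lemma exists_map_res_eq_mul_map_res {π : J ⟶ Y} {f : Γ(J, ⊤)}
    (H : ∀ (P : Scheme.{u}) (z w : P ⟶ J), z ≫ π = w ≫ π →
      ∃ v : Γ(P, ⊤), w.appTop f = v * z.appTop f)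
    {U : Y.Opens} (hU : IsAffineOpen U) {V : J.Opens} (hV : IsAffineOpen V) (hVU : V ≤ π ⁻¹ᵁ U)
    {R : CommRingCat.{u}} {a b : Γ(J, V) ⟶ R} (hab : π.appLE U V hVU ≫ a = π.appLE U V hVU ≫ b) :
    ∃ v : R, b (res V f) = v * a (res V f) := by
  obtain ⟨v, hv⟩ := H (Spec R) (Spec.map a ≫ hV.fromSpec) (Spec.map b ≫ hV.fromSpec) (by
    rw [Category.assoc, Category.assoc, ← hU.SpecMap_appLE_fromSpec π hV hVU,
      ← Category.assoc, ← Category.assoc, ← Spec.map_comp, ← Spec.map_comp, hab])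
  refine ⟨(Scheme.ΓSpecIso R).hom v, ?_⟩
  rw [appTop_SpecMap_fromSpec, appTop_SpecMap_fromSpec] at hv
  simpa only [map_mul, ← CommRingCat.comp_apply, Category.assoc, Iso.inv_hom_id, Category.comp_id]
    using congrArg (Scheme.ΓSpecIso R).hom hv

lemma eq_zero_of_flat_of_isReduced (π : J ⟶ Y) [Flat π] [IsReduced Y] (f : Γ(J, ⊤))
    (hf : J.basicOpen f = ⊥)
    (H : ∀ (P : Scheme.{u}) (z w : P ⟶ J), z ≫ π = w ≫ π →
      ∃ v : Γ(P, ⊤), w.appTop f = v * z.appTop f) : f = 0 := by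
  refine eq_zero_of_forall_exists_res_eq_zero f fun y => ?_
  obtain ⟨U, hU⟩ := exists_affineOpen_mem (π y)
  obtain ⟨_, ⟨V, hV, rfl⟩, hyV, hVU⟩ :=
    J.isBasis_affineOpens.exists_subset_of_mem_open hU (π ⁻¹ᵁ U.1).2
  replace hV : IsAffineOpen V := hV
  refine ⟨V, hyV, ?_⟩
  let φ := π.appLE U.1 V hVU
  let := φ.hom.toAlgebra
  have : Module.Flat Γ(Y, U.1) Γ(J, V) :=
    HasRingHomProperty.appLE (P := @Flat) π inferInstance U ⟨V, hV⟩ hVU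
  have hnil : IsNilpotent (res V f) := by
    rw [Scheme.isNilpotent_iff_basicOpen_eq_bot_of_isCompact hV.isCompact, Scheme.basicOpen_res,
      hf, inf_bot_eq]
  let inl : Γ(J, V) →ₐ[Γ(Y, U.1)] Γ(J, V) ⊗[Γ(Y, U.1)] Γ(J, V) :=
    Algebra.TensorProduct.includeLeft
  let inr : Γ(J, V) →ₐ[Γ(Y, U.1)] Γ(J, V) ⊗[Γ(Y, U.1)] Γ(J, V) :=
    Algebra.TensorProduct.includeRight
  have hinlr : φ ≫ CommRingCat.ofHom inl.toRingHom = φ ≫ CommRingCat.ofHom inr.toRingHom := by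
    ext x
    exact (inl.commutes x).trans (inr.commutes x).symm
  obtain ⟨v, hv⟩ := exists_map_res_eq_mul_map_res H U.2 hV hVU hinlr
  exact eq_zero_of_isNilpotent_of_tmul (A := Γ(Y, U.1)) hnil v hv

lemma ker_le_ker_of_isReduced (t : Y ⟶ W) [IsClosedImmersion t] [IsReduced J] (j : J ⟶ W)
    (h : Set.range j ⊆ Set.range t) : t.ker ≤ j.ker := by
  refine Scheme.IdealSheafData.le_ofIdeals_iff.2 fun U b hb => ?_
  rw [Scheme.Hom.ker_apply] at hb
  change j.app U.1 b = 0
  rw [← basicOpen_eq_bot_iff, ← Scheme.preimage_basicOpen, eq_bot_iff]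
  intro y hy
  obtain ⟨y', hy'⟩ := h ⟨y, rfl⟩
  have hmem : y' ∈ t ⁻¹ᵁ W.basicOpen b := by
    change t y' ∈ W.basicOpen b
    exact hy' ▸ hy
  rw [Scheme.preimage_basicOpen, RingHom.mem_ker.1 hb, Scheme.basicOpen_zero] at hmem
  exact hmem

lemma IsRegularFn.mem_closure_basicOpen [IsReduced J] {f : Γ(J, ⊤)}
    (hf : IsRegularFn f) (y : J) : y ∈ closure (J.basicOpen f : Set J) := by
  rw [mem_closure_iff]
  intro V hV hyV
  let V' : J.Opens := ⟨V, hV⟩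
  by_contra hcon
  have hres : res V' f = 0 := by
    rw [← basicOpen_eq_bot_iff, Scheme.basicOpen_res, eq_bot_iff]
    rintro v ⟨hv, hvf⟩
    exact hcon ⟨v, hv, hvf⟩
  have hgerm := hf y
  rw [← germ_res_apply V' y hyV, hres, map_zero] at hgerm
  exact zero_notMem_nonZeroDivisors hgerm

end Reduced

section TorsorOver

variable {k : Type u} [Field k] (Y : KSch k) (s : Set Y.left)

lemma range_redClosureι : Set.range (redClosureι Y s).left = closure s := by
  change Set.range (Scheme.IdealSheafData.subschemeι _) = _
  rw [Scheme.IdealSheafData.range_subschemeι, Scheme.IdealSheafData.coe_support_vanishingIdeal]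
  rfl

lemma isClosedImmersion_redClosureι : IsClosedImmersion (redClosureι Y s).left := by
  change IsClosedImmersion (Scheme.IdealSheafData.subschemeι _)
  infer_instance

lemma isReduced_redClosure : IsReduced (redClosure Y s).left := by
  let I := Scheme.IdealSheafData.vanishingIdeal (X := Y.left) ⟨closure s, isClosed_closure⟩
  change IsReduced I.subscheme
  refine isReduced_of_exists_isReduced fun y => ?_
  obtain ⟨U, hU⟩ := exists_affineOpen_mem (I.subschemeι y)
  refine ⟨⟨I.subschemeι ⁻¹ᵁ U.1, U.2.preimage _⟩, hU, ⟨fun x hx => ?_⟩⟩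
  obtain ⟨b, rfl⟩ := I.subschemeι_app_surjective U x
  obtain ⟨n, hn⟩ := hx
  have hpow : b ^ n ∈ I.ideal U := by
    rw [← I.ker_subschemeι_app U, RingHom.mem_ker, map_pow]
    exact hn
  have hb : b ∈ I.ideal U := by
    rw [Scheme.IdealSheafData.vanishingIdeal_ideal, PrimeSpectrum.mem_vanishingIdeal] at hpow ⊢
    exact fun P hP => P.2.mem_of_pow_mem n (hpow P hP)
  rwa [← I.ker_subschemeι_app U] at hb

variable {ι : Type} {p : ℕ} {σ : Equiv.Perm ι} {X : KSch k}

namespace ZipMorphism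

variable {ζ : ZipMorphism p σ X}

lemma saturated_preStratum [Finite ι] (S : Finset ι) :
    Saturated ζ.π.left (preStratum ζ.q S) := by
  intro y y' hyy hy i
  rw [← hy i]
  exact ⟨mem_basicOpen_entry_of_π_eq hyy.symm, mem_basicOpen_entry_of_π_eq hyy⟩

lemma IsSmooth.closure_preStratum [Finite ι] (hζ : ζ.IsSmooth) (S : Finset ι) :
    closure (preStratum ζ.q S) = ζ.zeroSet S := by
  classical
  refine Set.Subset.antisymm ((isClosed_zeroSet S).closure_subset_iff.2
    fun y hy i hi h => hi ((hy i).1 h)) fun y hy => ?_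
  obtain ⟨J, j, hj⟩ := ζ.exists_isCutOn ⊤ S
  have hrange : Set.range j.left = ζ.zeroSet S := hj.range_eq.trans (Set.univ_inter _)
  have := hj.isReduced hζ
  obtain ⟨x, rfl⟩ : y ∈ Set.range j.left := hrange ▸ hy
  have hreg : IsRegularFn (J := J.left) (∏ i ∈ S, pull j (ζ.entry i)) :=
    IsRegularFn.prod S fun i hi => hj.isRegularFn hζ hi
  refine map_mem_closure j.left.continuous (hreg.mem_closure_basicOpen x) fun z hz i => ?_
  change j.left z ∈ ζ.I.left.basicOpen (ζ.entry i) ↔ _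
  constructor
  · intro h
    by_contra hi
    have hmem : j.left z ∈ ζ.zeroSet S := hrange ▸ ⟨z, rfl⟩
    exact hmem i hi h
  · intro hi
    change z ∈ j.left ⁻¹ᵁ ζ.I.left.basicOpen (ζ.entry i)
    rw [Scheme.preimage_basicOpen_top]
    rw [SetLike.mem_coe, ← Finset.mul_prod_erase S _ hi, Scheme.basicOpen_mul] at hz
    exact hz.1

lemma IsSmooth.preimage_closure_stratum [Finite ι] (hζ : ζ.IsSmooth) (S : Finset ι) :
    ζ.π.left ⁻¹' closure (ζ.stratum S) = ζ.zeroSet S := by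
  rw [isOpenMap_π.preimage_closure_eq_closure_preimage ζ.π.left.continuous,
    ← hζ.closure_preStratum]
  exact congrArg closure (saturated_preStratum S).preimage_image

lemma IsSmooth.range_torsorOverι [Finite ι] (hζ : ζ.IsSmooth) (S : Finset ι) :
    Set.range (ζ.torsorOverι S).left = ζ.zeroSet S := by
  change Set.range (Limits.pullback.fst ζ.π.left (redClosureι X (ζ.stratum S)).left) = _
  rw [Scheme.Pullback.range_fst, range_redClosureι, hζ.preimage_closure_stratum]

variable (ζ) in
/-- The inclusion of a stratum closure into `X`. -/
def stratumClosureι (S : Finset ι) : ζ.stratumClosure S ⟶ X := redClosureι X (ζ.stratum S)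

variable (ζ) in
/-- The projection of the restricted torsor to the stratum closure. -/
def torsorOverπ (S : Finset ι) : ζ.torsorOver S ⟶ ζ.stratumClosure S :=
  Over.homMk (Limits.pullback.snd ζ.π.left (redClosureι X (ζ.stratum S)).left) (by
    have h := Limits.pullback.condition (f := ζ.π.left) (g := (redClosureι X (ζ.stratum S)).left)
    change _ ≫ (ζ.stratumClosure S).hom = Limits.pullback.fst ζ.π.left _ ≫ ζ.I.hom
    rw [← Over.w ζ.π, reassoc_of% h]
    exact congrArg _ (Over.w (redClosureι X (ζ.stratum S))).symm)

lemma torsorOver_condition (S : Finset ι) :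
    ζ.torsorOverι S ≫ ζ.π = ζ.torsorOverπ S ≫ ζ.stratumClosureι S := by
  ext1
  exact Limits.pullback.condition

lemma isClosedImmersion_torsorOverι (S : Finset ι) :
    IsClosedImmersion (ζ.torsorOverι S).left := by
  have := isClosedImmersion_redClosureι X (ζ.stratum S)
  change IsClosedImmersion (Limits.pullback.fst ζ.π.left (redClosureι X (ζ.stratum S)).left)
  infer_instance

lemma flat_torsorOverπ (S : Finset ι) : Flat (ζ.torsorOverπ S).left := by
  have := ζ.flat
  change Flat (Limits.pullback.snd ζ.π.left (redClosureι X (ζ.stratum S)).left)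
  infer_instance

lemma exists_forall_appTop_eq_character_mul [Fintype ι] {S : Finset ι} {P : Scheme.{u}}
    {z w : P ⟶ (ζ.torsorOver S).left}
    (h : z ≫ (ζ.torsorOverπ S).left = w ≫ (ζ.torsorOverπ S).left) :
    ∃ e : zipGroup p σ Γ(P, ⊤), ∀ (lam : ι → ℤ) (f : Fn (ζ.torsorOver S)),
      IsSection p σ (ζ.torsorOver S) (ζ.actRel (ζ.torsorOverι S)) lam f →
        w.appTop f = (character lam e : Γ(P, ⊤)) * z.appTop f := by
  let T : KSch k := Over.mk (z ≫ (ζ.torsorOver S).hom)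
  let z' : T ⟶ ζ.torsorOver S := Over.homMk z rfl
  let w' : T ⟶ ζ.torsorOver S := Over.homMk w (by
    rw [← Over.w (ζ.torsorOverπ S), ← reassoc_of% h, Over.w]
    rfl)
  have h' : z' ≫ ζ.torsorOverπ S = w' ≫ ζ.torsorOverπ S := Over.OverMorphism.ext h
  obtain ⟨e, he, -⟩ := ζ.simply_transitive (z' ≫ ζ.torsorOverι S) (w' ≫ ζ.torsorOverι S) (by
    rw [Category.assoc, Category.assoc, torsorOver_condition, reassoc_of% h'])
  exact ⟨e, fun lam f hf => hf T e z' w' he⟩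

lemma IsSmooth.pull_torsorOverι_entry_eq_zero [Finite ι] (hζ : ζ.IsSmooth) {S : Finset ι} {i : ι}
    (hi : i ∉ S) : pull (ζ.torsorOverι S) (ζ.entry i) = 0 := by
  classical
  have := Fintype.ofFinite ι
  have := flat_torsorOverπ (ζ := ζ) S
  have : IsReduced (ζ.stratumClosure S).left := isReduced_redClosure X (ζ.stratum S)
  refine eq_zero_of_flat_of_isReduced (ζ.torsorOverπ S).left _ ?_ fun P z w hzw => ?_
  · unfold pull
    rw [← Scheme.preimage_basicOpen_top, eq_bot_iff]
    intro y hy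
    have hmem : (ζ.torsorOverι S).left y ∈ ζ.zeroSet S := hζ.range_torsorOverι S ▸ ⟨y, rfl⟩
    exact hmem i hi hy
  · obtain ⟨e, he⟩ := exists_forall_appTop_eq_character_mul hzw
    exact ⟨_, he _ _ (isSection_entry (ζ.torsorOverι S) i)⟩

lemma IsSmooth.isCut_torsorOverι [Finite ι] (hζ : ζ.IsSmooth) (S : Finset ι) :
    IsCut (W := ζ.I.left) ζ.entry S (ζ.torsorOverι S).left := by
  have := isClosedImmersion_torsorOverι (ζ := ζ) S
  refine ⟨this, le_antisymm ?_ ?_⟩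
  · have hc := isCut_subschemeι ζ.entry (S : Set ι)
    have := isReduced_of_exists_isDomain
      (hc.smoothCoordinates hζ.smoothCoordinates_entry).exists_isDomain
    rw [← hc.ker_eq]
    refine ker_le_ker_of_isReduced _ _ ?_
    rw [hc.range_eq, hζ.range_torsorOverι]
    rfl
  · rw [cutIdeal_le_iff]
    exact fun i hi => hζ.pull_torsorOverι_entry_eq_zero hi

end ZipMorphism

end TorsorOver

section Descent

variable {J Y W : Scheme.{u}}

lemma exists_descent (π : J ⟶ Y) [Flat π] [Surjective π] [LocallyOfFinitePresentation π]
    (f : Γ(J, ⊤)) (H : ∀ (P : Scheme.{u}) (z w : P ⟶ J), z ≫ π = w ≫ π →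
      z.appTop f = w.appTop f) : ∃ g : Γ(Y, ⊤), π.appTop g = f := by
  let v : J ⟶ 𝔸(PUnit.{u + 1}; Y) := AffineSpace.homOfVector π fun _ => f
  have hv : ∀ (P : Scheme.{u}) (z w : P ⟶ J), z ≫ π = w ≫ π → z ≫ v = w ≫ v := by
    intro P z w hzw
    simp only [v, AffineSpace.comp_homOfVector, hzw]
    congr 1
    exact funext fun _ => H P z w hzw
  refine ⟨(EffectiveEpi.desc π v fun z w => hv _ z w).appTop (AffineSpace.coord Y PUnit.unit), ?_⟩
  rw [← CommRingCat.comp_apply, ← Scheme.Hom.comp_appTop, EffectiveEpi.fac]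
  exact AffineSpace.homOfVector_appTop_coord _ _ _

lemma topIso_hom_ι_appTop (U : W.Opens) (F : Γ(W, ⊤)) :
    U.topIso.hom (U.ι.appTop F) = res U F := by
  rw [Scheme.Opens.ι_appTop]
  exact congr($(W.presheaf.map_comp (homOfLE (le_top : U.ι ''ᵁ ⊤ ≤ ⊤)).op
    (eqToHom U.ι_image_top.symm).op) F).symm

lemma topIso_hom_injective (U : W.Opens) : Function.Injective U.topIso.hom :=
  (ConcreteCategory.bijective_of_isIso U.topIso.hom).1

lemma ι_appTop_eq_zero_iff (U : W.Opens) (F : Γ(W, ⊤)) : U.ι.appTop F = 0 ↔ res U F = 0 := by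
  rw [← topIso_hom_ι_appTop, map_eq_zero_iff _ (topIso_hom_injective U)]

lemma eq_of_ι_appTop_eq (U V : W.Opens) (hcover : ∀ y, y ∈ U ∨ y ∈ V) {F G : Γ(W, ⊤)}
    (hU : U.ι.appTop F = U.ι.appTop G) (hV : V.ι.appTop F = V.ι.appTop G) : F = G := by
  rw [← sub_eq_zero] at hU hV ⊢
  rw [← map_sub, ι_appTop_eq_zero_iff] at hU hV
  refine eq_zero_of_forall_exists_res_eq_zero _ fun y => ?_
  rcases hcover y with hy | hy
  exacts [⟨U, hy, hU⟩, ⟨V, hy, hV⟩]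

lemma exists_extension_by_zero (U V : W.Opens) (hcover : ∀ y, y ∈ U ∨ y ∈ V)
    (hdisj : ∀ y ∈ U, y ∉ V) (f : Γ(U, ⊤)) :
    ∃ F : Γ(W, ⊤), U.ι.appTop F = f ∧ V.ι.appTop F = 0 := by
  obtain ⟨F, hF⟩ := exists_gluing (fun b : Bool => if b then U else V)
    (fun y => (hcover y).elim (fun h => ⟨true, h⟩) fun h => ⟨false, h⟩)
    (fun b => match b with
      | true => U.topIso.hom f
      | false => (0 : Γ(W, V))) (by
    rintro (_ | _) (_ | _) y ha hb
    · rfl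
    · exact absurd ha (hdisj y hb)
    · exact absurd hb (hdisj y ha)
    · rfl)
  exact ⟨F, topIso_hom_injective U ((topIso_hom_ι_appTop U F).trans (hF true)),
    (ι_appTop_eq_zero_iff V F).2 (hF false)⟩

lemma PseudoComplete.isClosed_basicOpen {k : Type u} [Field k] {Y : KSch k} (hY : PseudoComplete Y)
    (g : Γ(Y.left, ⊤)) : IsClosed (Y.left.basicOpen g : Set Y.left) := by
  rw [← isOpen_compl_iff, isOpen_iff_forall_mem_open]
  intro y hy
  obtain ⟨U, c, hyU, hU⟩ := hY.2 g y
  have mem_iff : ∀ v ∈ U, v ∈ Y.left.basicOpen g ↔ v ∈ Y.left.basicOpen (const Y c) := by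
    intro v hv
    have hres := congrArg (v ∈ Y.left.basicOpen ·) hU
    simpa only [Scheme.basicOpen_res, TopologicalSpace.Opens.mem_inf, hv, true_and, eq_iff_iff]
      using hres
  refine ⟨U, fun v hv hvg => hy ((mem_iff y hyU).2 ?_), U.2, hyU⟩
  have hc : c ≠ 0 := by
    rintro rfl
    have hv0 := (mem_iff v hv).1 hvg
    rw [show const Y (0 : k) = 0 by simp [const], Scheme.basicOpen_zero] at hv0
    exact hv0
  have hunit : IsUnit (const Y c) :=
    (hc.isUnit.map (Scheme.ΓSpecIso (CommRingCat.of k)).inv.hom).map Y.hom.appTop.hom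
  rw [Scheme.basicOpen_of_isUnit _ hunit]
  trivial

end Descent

lemma exists_mul_eq_intCast {ι : Type*} [Finite ι] (c : ι → ℚ) :
    ∃ N : ℕ, 1 ≤ N ∧ ∃ C : ι → ℤ, ∀ i, (C i : ℚ) = N * c i := by
  classical
  have := Fintype.ofFinite ι
  refine ⟨∏ i, (c i).den, Finset.one_le_prod' fun i _ => (c i).den_pos,
    fun i => (∏ l ∈ Finset.univ.erase i, (c l).den : ℕ) * (c i).num, fun i => ?_⟩
  rw [← Finset.mul_prod_erase Finset.univ _ (Finset.mem_univ i)]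
  push_cast
  rw [← Rat.mul_den_eq_num (c i)]
  ring

section Coord

variable {ι : Type} [DecidableEq ι] {p : ℕ} {σ : Equiv.Perm ι} {S : Finset ι} {lam : ι → ℤ}
  {c : ι → ℚ}

lemma IsCoord.exists_nsmul [Finite ι] (h : IsCoord p σ S lam c) :
    ∃ N : ℕ, 1 ≤ N ∧ ∃ C : ι → ℤ, (IsCoord p σ S (N • lam) fun i => (C i : ℚ)) ∧
      ∀ i, (C i : ℚ) = N * c i := by
  obtain ⟨N, hN, C, hC⟩ := exists_mul_eq_intCast c
  exact ⟨N, hN, C, (funext hC : (fun i => (C i : ℚ)) = _) ▸ h.nsmul N, hC⟩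

lemma IsCoord.neg (h : IsCoord p σ S lam c) : IsCoord p σ S (-lam) (-c) := fun i => by
  simp only [Pi.neg_apply, Int.cast_neg, h i]
  ring

end Coord

section OpenSub

variable {k : Type u} [Field k]

/-- An open subscheme, as a scheme over the base. -/
def openSub (J : KSch k) (U : J.left.Opens) : KSch k := Over.mk (U.ι ≫ J.hom)

/-- The inclusion of an open subscheme, as a morphism over the base. -/
def openSubι (J : KSch k) (U : J.left.Opens) : openSub J U ⟶ J := Over.homMk U.ι rfl

lemma exists_comp_openSubι_eq {J T : KSch k} {U : J.left.Opens} (w : T ⟶ J)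
    (hw : ∀ t, w.left t ∈ U) : ∃ w' : T ⟶ openSub J U, w' ≫ openSubι J U = w := by
  have hrange : Set.range w.left ⊆ Set.range U.ι := by
    rw [Scheme.Opens.range_ι]
    rintro _ ⟨t, rfl⟩
    exact hw t
  let l := IsOpenImmersion.lift U.ι w.left hrange
  have hl : l ≫ U.ι = w.left := IsOpenImmersion.lift_fac _ _ _
  have hbase : l ≫ U.ι ≫ J.hom = T.hom := by rw [reassoc_of% hl, Over.w]
  exact ⟨Over.homMk l hbase, Over.OverMorphism.ext hl⟩

end OpenSub

lemma germ_eq_zero_of_isClosed_basicOpen {J : Scheme.{u}} [IsReduced J] {f : Γ(J, ⊤)}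
    (hf : IsClosed (J.basicOpen f : Set J)) {y : J} (hy : y ∉ J.basicOpen f) :
    J.presheaf.germ ⊤ y trivial f = 0 := by
  let V : J.Opens := ⟨_, hf.isOpen_compl⟩
  have hV : res V f = 0 := by
    rw [← basicOpen_eq_bot_iff, Scheme.basicOpen_res, eq_bot_iff]
    rintro v ⟨hv, hvf⟩
    exact hv hvf
  rw [← germ_res_apply V y hy, hV, map_zero]

/-! ### Sections over the minimal strata -/

section WeightZero

variable {k : Type u} [Field k] {ι : Type} {p : ℕ} {σ : Equiv.Perm ι} {X : KSch k}

namespace ZipMorphism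

variable {ζ : ZipMorphism p σ X} {J J' : KSch k} {j : J ⟶ ζ.I} {j' : J' ⟶ ζ.I} {S : Finset ι}
  {O : ζ.I.left.Opens} {lam : ι → ℤ}

lemma isSection_pull_comp [Fintype ι] (a : J' ⟶ J) {h : Fn J}
    (hh : IsSection p σ J (ζ.actRel j) lam h) :
    IsSection p σ J' (ζ.actRel (a ≫ j)) lam (pull a h) :=
  hh.pullback a fun _ _ _ _ => (actRel_comp_iff a j).1

lemma IsCutOn.exists_comp_eq (hO : Saturated ζ.π.left O) [Finite ι] (hj : ζ.IsCutOn O S j)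
    (hj' : ζ.IsCutOn O S j') : ∃ a : J' ⟶ J, a ≫ j = j' ∧ Function.Injective (pull a) := by
  obtain ⟨a, ha⟩ := hj.exists_lift j' hj'.mem fun i hi => hj'.pull_entry_eq_zero hi
  obtain ⟨b, hb⟩ := hj'.exists_lift j hj.mem fun i hi => hj.pull_entry_eq_zero hi
  have := (hj.isStable hO).mono
  have hba : b ≫ a = 𝟙 J := by rw [← cancel_mono j, Category.assoc, ha, hb, Category.id_comp]
  refine ⟨a, ha, fun x y hxy => ?_⟩
  have hbxy := congrArg (pull b) hxy
  rwa [← pull_comp, ← pull_comp, hba, pull_id, pull_id] at hbxy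

lemma π_left_apply_of_actRel {T : KSch k} {e : zipGroup p σ (Fn T)} {z w : T ⟶ J}
    (h : ζ.actRel j T e z w) (t : T.left) :
    (j ≫ ζ.π).left (z.left t) = (j ≫ ζ.π).left (w.left t) := by
  have hπ : z ≫ j ≫ ζ.π = w ≫ j ≫ ζ.π := by
    rw [← Category.assoc w, ← (h : ζ.act e (z ≫ j) = w ≫ j), ζ.act_π, Category.assoc]
  exact congr(($hπ).left t)

lemma actRel_pull {T T' : KSch k} {e : zipGroup p σ (Fn T)} {z w : T ⟶ J} (t : T' ⟶ T)
    (h : ζ.actRel j T e z w) : ζ.actRel j T' (zipGroupMap (pull t) e) (t ≫ z) (t ≫ w) := by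
  change ζ.act _ ((t ≫ z) ≫ j) = (t ≫ w) ≫ j
  rw [Category.assoc, ← ζ.act_natural, (h : ζ.act e (z ≫ j) = w ≫ j), Category.assoc]

lemma pull_openSubι_eq_of_actRel [Fintype ι] {U : J.left.Opens}
    (hU : Saturated (j ≫ ζ.π).left U) {F : Fn J}
    (hF : IsSection p σ (openSub J U) (ζ.actRel (openSubι J U ≫ j)) lam (pull (openSubι J U) F))
    {T : KSch k} {e : zipGroup p σ (Fn T)} {z w : T ⟶ J} (h : ζ.actRel j T e z w) :
    pull (openSubι T (z.left ⁻¹ᵁ U)) (pull w F) =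
      pull (openSubι T (z.left ⁻¹ᵁ U)) ((character lam e : Fn T) * pull z F) := by
  let q := openSubι T (z.left ⁻¹ᵁ U)
  have hz : ∀ t, (q ≫ z).left t ∈ U := fun t => t.2
  obtain ⟨z', hz'⟩ := exists_comp_openSubι_eq (q ≫ z) hz
  obtain ⟨w', hw'⟩ := exists_comp_openSubι_eq (U := U) (q ≫ w) fun t =>
    hU _ _ (π_left_apply_of_actRel (actRel_pull q h) t) (hz t)
  have hsec := hF _ (zipGroupMap (pull q) e) z' w' (by
    rw [actRel_comp_iff, hz', hw']
    exact actRel_pull q h)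
  rw [← pull_comp, ← pull_comp, hz', hw', pull_comp, pull_comp, character_zipGroupMap] at hsec
  rw [map_mul, hsec]
  rfl

lemma isSection_of_isSection_openSub [Fintype ι] {U V : J.left.Opens}
    (hcover : ∀ y, y ∈ U ∨ y ∈ V) (hU : Saturated (j ≫ ζ.π).left U)
    (hV : Saturated (j ≫ ζ.π).left V) {F : Fn J}
    (hFU : IsSection p σ (openSub J U) (ζ.actRel (openSubι J U ≫ j)) lam (pull (openSubι J U) F))
    (hFV : IsSection p σ (openSub J V) (ζ.actRel (openSubι J V ≫ j)) lam (pull (openSubι J V) F)) :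
    IsSection p σ J (ζ.actRel j) lam F := fun _ _ z _ h =>
  eq_of_ι_appTop_eq (z.left ⁻¹ᵁ U) (z.left ⁻¹ᵁ V) (fun t => hcover (z.left t))
    (pull_openSubι_eq_of_actRel hU hFU h) (pull_openSubι_eq_of_actRel hV hFV h)

lemma exists_pull_torsorOverπ_eq [Fintype ι] {F : Fn (ζ.torsorOver S)}
    (hF : IsSection p σ (ζ.torsorOver S) (ζ.actRel (ζ.torsorOverι S)) 0 F) :
    ∃ g : Fn (ζ.stratumClosure S), pull (ζ.torsorOverπ S) g = F := by
  have := ζ.surjective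
  have := ζ.locallyOfFinitePresentation
  have := flat_torsorOverπ (ζ := ζ) S
  have : Surjective (ζ.torsorOverπ S).left :=
    inferInstanceAs (Surjective (Limits.pullback.snd ζ.π.left (redClosureι X (ζ.stratum S)).left))
  have : LocallyOfFinitePresentation (ζ.torsorOverπ S).left :=
    inferInstanceAs (LocallyOfFinitePresentation
      (Limits.pullback.snd ζ.π.left (redClosureι X (ζ.stratum S)).left))
  refine exists_descent (ζ.torsorOverπ S).left F fun P z w hzw => ?_
  obtain ⟨e, he⟩ := exists_forall_appTop_eq_character_mul hzw
  rw [he 0 F hF, character_zero, Units.val_one, one_mul]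

lemma exists_pull_openSubι_comp_torsorOverπ_eq [Fintype ι] {U : (ζ.torsorOver S).left.Opens}
    (hclosed : IsClosed (U : Set (ζ.torsorOver S).left))
    (hU : Saturated (ζ.torsorOverι S ≫ ζ.π).left U) {f : Fn (openSub (ζ.torsorOver S) U)}
    (hf : IsSection p σ (openSub (ζ.torsorOver S) U)
      (ζ.actRel (openSubι (ζ.torsorOver S) U ≫ ζ.torsorOverι S)) 0 f) :
    ∃ g : Fn (ζ.stratumClosure S),
      pull (openSubι (ζ.torsorOver S) U ≫ ζ.torsorOverπ S) g = f := by
  let V : (ζ.torsorOver S).left.Opens := ⟨_, hclosed.isOpen_compl⟩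
  have hcover : ∀ y, y ∈ U ∨ y ∈ V := fun y => em _
  have hV : Saturated (ζ.torsorOverι S ≫ ζ.π).left V := fun y y' hyy hy hy' =>
    hy (hU y' y hyy.symm hy')
  obtain ⟨F, hFU, hFV⟩ := exists_extension_by_zero U V hcover (fun _ hy hy' => hy' hy) f
  replace hFU : pull (openSubι (ζ.torsorOver S) U) F = f := hFU
  replace hFV : pull (openSubι (ζ.torsorOver S) V) F = 0 := hFV
  obtain ⟨g, hg⟩ := exists_pull_torsorOverπ_eq (isSection_of_isSection_openSub hcover hU hV
    (hFU.symm ▸ hf) (hFV.symm ▸ fun _ _ _ _ _ => by rw [map_zero, map_zero, mul_zero]))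
  exact ⟨g, by rw [pull_comp, hg, hFU]⟩

end ZipMorphism

end WeightZero

section Minimal

variable {k : Type u} [Field k] {ι : Type} {p : ℕ} {σ : Equiv.Perm ι} {X : KSch k}

namespace ZipMorphism

variable {ζ : ZipMorphism p σ X}

lemma isCutOn_openSub {J : KSch k} {j : J ⟶ ζ.I} {S : Finset ι} (hj : IsCut ζ.entry S j.left)
    (O : ζ.I.left.Opens) : ζ.IsCutOn O S (openSubι J (j.left ⁻¹ᵁ O) ≫ j) :=
  ⟨j.left ∣_ O, morphismRestrict_ι _ _, hj.restrict O⟩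

lemma isClosed_preimage_goodOpen [Finite ι] (hζ : ζ.IsSmooth) (i : ι) :
    IsClosed ((ζ.torsorOverι {i}).left ⁻¹' goodOpen hζ) := by
  have hmem : ∀ y, (ζ.torsorOverι {i}).left y ∈ ζ.zeroSet {i} := fun y =>
    hζ.range_torsorOverι {i} ▸ ⟨y, rfl⟩
  have hclosed := (relOpen_zeroSet_singleton_diff_goodOpen hζ i).isClosed_diff (isClosed_zeroSet _)
  rw [Set.sdiff_sdiff_right_self] at hclosed
  convert hclosed.preimage (ζ.torsorOverι {i}).left.continuous using 1
  ext y
  exact (and_iff_right (hmem y)).symm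

-- A section of weight zero on the good part descends to the pseudo-complete stratum closure, so
-- its non-vanishing locus is closed and cannot accumulate at a zero of the entry.
lemma eq_zero_of_isSection_zero [Fintype ι] (hζ : ζ.IsSmooth) {i : ι}
    (hpc : PseudoComplete (ζ.stratumClosure {i})) {J : KSch k} {j : J ⟶ ζ.I}
    (hj : ζ.IsCutOn (goodOpen hζ) {i} j) {f : Fn J} (hf : IsSection p σ J (ζ.actRel j) 0 f)
    (hdvd : pull j (ζ.entry i) ∣ f) : f = 0 := by
  by_contra hne
  let U := (ζ.torsorOverι {i}).left ⁻¹ᵁ goodOpen hζ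
  have hU : Saturated (ζ.torsorOverι {i} ≫ ζ.π).left U := fun y y' hyy hy =>
    saturated_goodOpen hζ _ _ hyy hy
  let T := openSub (ζ.torsorOver {i}) U
  have hcut := isCutOn_openSub (hζ.isCut_torsorOverι {i}) (goodOpen hζ)
  obtain ⟨a, ha, hinj⟩ := hj.exists_comp_eq (saturated_goodOpen hζ) hcut
  have hfa := isSection_pull_comp a hf
  rw [ha] at hfa
  have hclosed : IsClosed (T.left.basicOpen (pull a f) : Set T.left) := by
    obtain ⟨g, hg⟩ := exists_pull_openSubι_comp_torsorOverπ_eq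
      (isClosed_preimage_goodOpen hζ i) hU hfa
    rw [← hg]
    unfold pull
    rw [← Scheme.preimage_basicOpen_top]
    exact (hpc.isClosed_basicOpen g).preimage (Scheme.Hom.continuous _)
  obtain ⟨y, hy, hyZ⟩ := hcut.exists_germ_ne_zero hζ hfa
    fun hzero => hne (hinj (hzero.trans (map_zero _).symm))
  have := hcut.isReduced hζ
  refine hy (germ_eq_zero_of_isClosed_basicOpen hclosed fun hyf => ?_)
  obtain ⟨b, hb⟩ := map_dvd (pull a) hdvd
  rw [hb, ← pull_comp, ha, Scheme.basicOpen_mul] at hyf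
  have hentry := hyf.1
  unfold pull at hentry
  rw [← Scheme.preimage_basicOpen_top] at hentry
  exact hyZ i (Finset.notMem_empty i) hentry

lemma coordNonneg_cutWeights_singleton [Fintype ι] [DecidableEq ι] (hζ : ζ.IsSmooth) {i : ι}
    (hpc : PseudoComplete (ζ.stratumClosure {i})) :
    CoordNonneg p σ (ζ.cutWeights (goodOpen hζ)) {i} i := by
  rintro lam ⟨J, j, h, hj, hne, hh⟩ c hc
  by_contra! hneg
  obtain ⟨N, hN, C, hcC, hC⟩ := hc.exists_nsmul
  have hCi : C i < 0 := by
    have : (C i : ℚ) < 0 := by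
      rw [hC]
      exact mul_neg_of_pos_of_neg (by positivity) hneg
    exact_mod_cast this
  have hnegC : IsCoord p σ {i} (-(N • lam)) fun l => ((-C l : ℤ) : ℚ) := by
    simp only [Int.cast_neg]
    exact hcC.neg
  obtain ⟨v, hv⟩ := (isCompatible_actRel j).exists_isSection
    (fun l hl => by rw [mat_comp]; exact hj.pull_entry_eq_zero hl) hnegC
    fun l hl => (Finset.mem_singleton.1 hl) ▸ by omega
  rw [Finset.prod_singleton, mat_comp] at hv
  have hmul := (hh.pow N).mul hv
  rw [add_neg_cancel] at hmul
  have hzero := eq_zero_of_isSection_zero hζ hpc hj hmul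
    (Dvd.dvd.mul_left (Dvd.dvd.mul_left (dvd_pow_self _ (by omega)) _) _)
  have hreg : IsRegularFn (J := J.left) (pull j (ζ.entry i)) :=
    hj.isRegularFn hζ (Finset.mem_singleton_self i)
  have hpow : v * h ^ N = 0 := (hreg.pow (-C i).toNat).eq_zero (by
    rw [← hzero, entry]
    ring)
  have := hj.isReduced hζ
  exact hne ((pow_eq_zero_iff (by omega)).1 ((Units.mul_right_eq_zero v).1 hpow))

end ZipMorphism

end Minimal

/-! ### Comparison of the cones -/

section Group

variable {k : Type u} [Field k] {ι : Type}

lemma mat_eq_appTop {Y : KSch k} (g : Y ⟶ GSch k ι) (i : ι) (a b : Fin 2) :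
    mat g i a b = g.left.appTop (mat (𝟙 (GSch k ι)) i a b) := by
  rw [← Category.comp_id g, mat_comp, Category.comp_id]

lemma mem_basicOpen_mat_iff {Y : KSch k} (g : Y ⟶ GSch k ι) (i : ι) (a b : Fin 2) (y : Y.left) :
    y ∈ Y.left.basicOpen (mat g i a b : Γ(Y.left, ⊤)) ↔
      g.left y ∈ (GSch k ι).left.basicOpen (mat (𝟙 (GSch k ι)) i a b : Γ((GSch k ι).left, ⊤)) := by
  rw [mat_eq_appTop, ← Scheme.preimage_basicOpen_top]
  rfl

lemma mem_preStratum_iff {Y : KSch k} (g : Y ⟶ GSch k ι) (S : Finset ι) (y : Y.left) :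
    y ∈ preStratum g S ↔ g.left y ∈ groupStratum k S :=
  forall_congr' fun i => by rw [mem_basicOpen_mat_iff]

lemma mem_basicOpen_mat_id_iff (P : PrimeSpectrum (CoordRing k ι)) (i : ι) (a b : Fin 2) :
    P ∈ (GSch k ι).left.basicOpen (mat (𝟙 (GSch k ι)) i a b : Γ((GSch k ι).left, ⊤)) ↔
      genericPt k ι i a b ∉ P.asIdeal := by
  have hmat : (mat (𝟙 (GSch k ι)) i a b : Γ((GSch k ι).left, ⊤)) =
      (Scheme.ΓSpecIso (CommRingCat.of (CoordRing k ι))).inv (genericPt k ι i a b) :=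
    pull_id (Y := GSch k ι) _
  rw [hmat]
  change P ∈ (Spec (CommRingCat.of (CoordRing k ι))).basicOpen
    ((Scheme.ΓSpecIso (CommRingCat.of (CoordRing k ι))).inv (genericPt k ι i a b)) ↔ _
  rw [basicOpen_eq_of_affine]
  rfl

lemma groupStratum_nonempty (S : Finset ι) : (groupStratum k S).Nonempty := by
  classical
  let g : ι → Matrix (Fin 2) (Fin 2) k := fun i => if i ∈ S then 1 else !![0, 1; -1, 0]
  have hg : ∀ i, (g i).det = 1 := fun i => by
    by_cases hi : i ∈ S <;> simp [g, hi]
  let φ := coordLift (k := k) g hg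
  refine ⟨(⟨RingHom.ker φ, RingHom.ker_isPrime _⟩ : PrimeSpectrum (CoordRing k ι)), fun i => ?_⟩
  refine (mem_basicOpen_mat_id_iff _ i 0 0).trans ?_
  rw [RingHom.mem_ker, coordLift_genericPt]
  by_cases hi : i ∈ S <;> simp [g, hi]

lemma isReduced_GSch [Finite ι] : IsReduced (GSch k ι).left :=
  isReduced_of_exists_isDomain (smoothCoordinates_mat (𝟙 (GSch k ι))
    (inferInstanceAs (Smooth (𝟙 (GSch k ι).left)))).exists_isDomain

lemma mat_redClosureι_eq_zero (S : Finset ι) {i : ι} (hi : i ∉ S) :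
    mat (redClosureι (GSch k ι) (groupStratum k S)) i 0 0 = 0 := by
  let r := redClosureι (GSch k ι) (groupStratum k S)
  have := isReduced_redClosure (GSch k ι) (groupStratum k S)
  change (mat r i 0 0 : Γ((redClosure (GSch k ι) (groupStratum k S)).left, ⊤)) = 0
  rw [← basicOpen_eq_bot_iff, eq_bot_iff]
  intro y hy
  have hyS : r.left y ∈ closure (groupStratum k S) := by
    rw [← range_redClosureι]
    exact ⟨y, rfl⟩
  obtain ⟨x, hx, hxS⟩ := mem_closure_iff.1 hyS _
    ((GSch k ι).left.basicOpen (mat (𝟙 (GSch k ι)) i 0 0 : Γ((GSch k ι).left, ⊤))).2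
    ((mem_basicOpen_mat_iff r i 0 0 y).1 hy)
  exact hi ((hxS i).1 hx)

variable [Fintype ι] {p : ℕ} {σ : Equiv.Perm ι} {R : KSch k}
  {rel : ∀ T : KSch k, zipGroup p σ (Fn T) → (T ⟶ R) → (T ⟶ R) → Prop}

lemma IsCompatible.mem_sectionCone [DecidableEq ι] {g : R ⟶ GSch k ι} (hg : IsCompatible rel g)
    {S : Finset ι} (hS : ∀ i ∉ S, mat g i 0 0 = 0) (hne : (preStratum g S).Nonempty)
    {lam : ι → ℤ} {c : ι → ℚ} (hc : IsCoord p σ S lam c) (hc0 : ∀ i ∈ S, 0 ≤ c i) :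
    lam ∈ sectionCone p σ R rel := by
  obtain ⟨y, hy⟩ := hne
  obtain ⟨N, hN, C, hcC, hC⟩ := hc.exists_nsmul
  obtain ⟨v, hv⟩ := hg.exists_isSection hS hcC fun i hi => by
    have : (0 : ℚ) ≤ C i := by
      rw [hC]
      exact mul_nonneg (by positivity) (hc0 i hi)
    exact_mod_cast this
  refine ⟨N, hN, _, fun hzero => ?_, hv⟩
  have hunit : ∀ i ∈ S, IsUnit (R.left.presheaf.germ ⊤ y trivial (mat g i 0 0)) := fun i hi =>
    (Scheme.mem_basicOpen_top _ _ y).1 ((hy i).2 hi)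
  have hgerm : IsUnit (R.left.presheaf.germ ⊤ y trivial
      ((v : Fn R) * ∏ i ∈ S, mat g i 0 0 ^ (C i).toNat)) := by
    rw [map_mul, map_prod]
    refine (v.isUnit.map _).mul (IsUnit.prod_iff.2 fun i hi => ?_)
    rw [map_pow]
    exact (hunit i hi).pow _
  rw [hzero, map_zero] at hgerm
  exact not_isUnit_zero hgerm

lemma sectionCone_subset_of_surjective {J : KSch k}
    {rel' : ∀ T : KSch k, zipGroup p σ (Fn T) → (T ⟶ J) → (T ⟶ J) → Prop} (φ : J ⟶ R)
    [IsReduced R.left] (hφ : ∀ T e z z', rel' T e z z' → rel T e (z ≫ φ) (z' ≫ φ))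
    (hsurj : Function.Surjective φ.left) : sectionCone p σ R rel ⊆ sectionCone p σ J rel' := by
  rintro lam ⟨m, hm, f, hf, hsec⟩
  refine ⟨m, hm, pull φ f, fun hzero => hf ?_, hsec.pullback φ hφ⟩
  rw [← basicOpen_eq_bot_iff, ← TopologicalSpace.Opens.coe_eq_empty]
  refine hsurj.preimage_injective ?_
  change ((φ.left ⁻¹ᵁ R.left.basicOpen f : J.left.Opens) : Set J.left) = ∅
  change φ.left.appTop f = 0 at hzero
  rw [Scheme.preimage_basicOpen_top, hzero, Scheme.basicOpen_zero]
  rfl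

end Group

section Comparison

variable {k : Type u} [Field k] {ι : Type} {p : ℕ} {σ : Equiv.Perm ι} {X : KSch k}

namespace ZipMorphism

variable {ζ : ZipMorphism p σ X} {S : Finset ι}

lemma MapsOnto.mono {Z Z' : Set X.left} {V V' : Set (GSch k ι).left} (h : ζ.MapsOnto Z V)
    (hZ : Z ⊆ Z') (hV : V' ⊆ V) : ζ.MapsOnto Z' V' := fun g hg =>
  let ⟨z, hz, hzg⟩ := h g (hV hg)
  ⟨z, hZ hz, hzg⟩

lemma mem_zeroSet_empty_iff (y : ζ.I.left) : y ∈ ζ.zeroSet ∅ ↔ ζ.q.left y ∈ groupStratum k ∅ := by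
  rw [← mem_preStratum_iff]
  exact forall_congr' fun i => by simp [entry]

lemma MapsOnto.zeroSet_empty_nonempty {Z : Set X.left} (h : ζ.MapsOnto Z Set.univ) :
    (ζ.zeroSet ∅).Nonempty := by
  obtain ⟨g, hg⟩ := groupStratum_nonempty (k := k) (∅ : Finset ι)
  obtain ⟨z, -, rfl⟩ := h g (Set.mem_univ g)
  exact ⟨z, (mem_zeroSet_empty_iff z).2 hg⟩

lemma IsSmooth.mapsTo_closure_groupStratum [Finite ι] (hζ : ζ.IsSmooth) (S : Finset ι) :
    Set.MapsTo ζ.q.left (ζ.zeroSet S) (closure (groupStratum k S)) := by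
  rw [← hζ.closure_preStratum]
  exact Set.MapsTo.closure (fun y hy => (mem_preStratum_iff ζ.q S y).1 hy) ζ.q.left.continuous

/-- The hypothesis on a stratum closure in the comparison of cones: all its connected components
are mapped onto the corresponding stratum closure of the stack. -/
def ComponentsMapOnto (ζ : ZipMorphism p σ X) (S : Finset ι) : Prop :=
  ∀ x ∈ closure (ζ.stratum S), ζ.MapsOnto (connectedComponentIn (closure (ζ.stratum S)) x)
    (closure (groupStratum k S))

lemma ComponentsMapOnto.inter_zeroSet_empty_nonempty [Finite ι] (hcomp : ζ.ComponentsMapOnto S)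
    (hζ : ζ.IsSmooth) (hne : (ζ.zeroSet ∅).Nonempty) {A : Set ζ.I.left} (hA : IsClosed A)
    (hopen : RelOpen (ζ.zeroSet S) A) (hsat : Saturated ζ.π.left A) (hAne : A.Nonempty) :
    (A ∩ ζ.zeroSet ∅).Nonempty := by
  obtain ⟨z₀, hz₀⟩ := hne
  obtain ⟨y, hy⟩ := hAne
  rw [← hζ.preimage_closure_stratum] at hopen
  obtain ⟨z, hz, hzz₀⟩ := hcomp _ (hopen.1 hy) (ζ.q.left z₀)
    (hζ.mapsTo_closure_groupStratum S (zeroSet_mono (Finset.empty_subset S) hz₀))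
  obtain ⟨a, ha, haz⟩ := hopen.connectedComponentIn_subset_image
    (isOpenMap_π.isQuotientMap ζ.π.left.continuous ζ.surjective.surj) isClosed_closure hA hsat hy hz
  refine ⟨z, hsat a z haz ha, ?_⟩
  rwa [mem_zeroSet_empty_iff, hzz₀, ← mem_zeroSet_empty_iff]

lemma isCutOn_top {J : KSch k} {j : J ⟶ ζ.I} (hj : IsCut ζ.entry S j.left) :
    ζ.IsCutOn ⊤ S j := by
  have hcut := hj.restrict ⊤
  have := hcut.isClosedImmersion
  have : IsIso (j.left ⁻¹ᵁ ⊤).ι := J.left.topIso.isIso_hom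
  refine ⟨inv (j.left ⁻¹ᵁ ⊤).ι ≫ (j.left ∣_ ⊤), ?_, inferInstance, ?_⟩
  · rw [Category.assoc, morphismRestrict_ι, IsIso.inv_hom_id_assoc]
  · rw [← hcut.ker_eq]
    exact Scheme.Hom.ker_comp_of_isIso _ _

lemma IsSmooth.exists_comp_redClosureι_eq [Finite ι] (hζ : ζ.IsSmooth) (S : Finset ι) :
    ∃ φ : ζ.torsorOver S ⟶ redClosure (GSch k ι) (groupStratum k S),
      φ ≫ redClosureι _ _ = ζ.torsorOverι S ≫ ζ.q := by
  let r := redClosureι (GSch k ι) (groupStratum k S)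
  have := (isCutOn_top (hζ.isCut_torsorOverι S)).isReduced hζ
  have : IsClosedImmersion r.left := isClosedImmersion_redClosureι _ _
  have hrange : Set.range (ζ.torsorOverι S ≫ ζ.q).left ⊆ Set.range r.left := by
    rw [range_redClosureι]
    rintro _ ⟨y, rfl⟩
    exact hζ.mapsTo_closure_groupStratum S (hζ.range_torsorOverι S ▸ ⟨y, rfl⟩)
  let l := IsClosedImmersion.lift _ _ (ker_le_ker_of_isReduced _ _ hrange)
  have hl : l ≫ r.left = (ζ.torsorOverι S ≫ ζ.q).left := IsClosedImmersion.lift_fac _ _ _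
  exact ⟨Over.homMk l (by rw [← Over.w r, reassoc_of% hl, Over.w]), Over.OverMorphism.ext hl⟩

lemma pull_openSubι_ne_zero {J : KSch k} {U : J.left.Opens} {h : Fn J} {x : J.left} (hx : x ∈ U)
    (hxh : x ∈ J.left.basicOpen h) : pull (openSubι J U) h ≠ 0 := fun hzero => by
  change U.ι.appTop h = 0 at hzero
  have hmem : (⟨x, hx⟩ : U) ∈ U.ι ⁻¹ᵁ J.left.basicOpen h := hxh
  rw [Scheme.preimage_basicOpen_top, hzero, Scheme.basicOpen_zero] at hmem
  exact hmem

-- The closure of the non-vanishing locus of a section is a saturated union of components of the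
-- stratum closure, so it meets the smallest stratum and a fortiori the good open.
lemma mem_cutWeights_of_isCut [Fintype ι] (hζ : ζ.IsSmooth) (hne : (ζ.zeroSet ∅).Nonempty)
    (hcomp : ζ.ComponentsMapOnto S) {J : KSch k} {j : J ⟶ ζ.I} (hj : IsCut ζ.entry S j.left)
    {lam : ι → ℤ} {h : Fn J} (hh : IsSection p σ J (ζ.actRel j) lam h) (hh0 : h ≠ 0) :
    lam ∈ ζ.cutWeights (goodOpen hζ) S := by
  have hcut := isCutOn_top hj
  have := hcut.isReduced hζ
  let A := j.left '' (J.left.basicOpen h : Set J.left)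
  have hopen : RelOpen (ζ.zeroSet S) A := hcut.relOpen_image _
  have hsat : Saturated ζ.π.left A :=
    hcut.saturated_image_basicOpen (fun _ _ _ _ => Set.mem_univ _) hh
  have hA : A.Nonempty := ((TopologicalSpace.Opens.ne_bot_iff_nonempty _).1
    (mt (basicOpen_eq_bot_iff h).1 hh0)).image _
  obtain ⟨z, hzA, hz⟩ := hcomp.inter_zeroSet_empty_nonempty hζ hne isClosed_closure
    (hopen.closure (isClosed_zeroSet S) (hζ.locallyIrreducible_zeroSet S))
    (hsat.closure isOpenMap_π ζ.π.left.continuous) hA.closure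
  obtain ⟨_, hx, x, hxh, rfl⟩ := mem_closure_iff.1 hzA _ (goodOpen hζ).2
    (zeroSet_empty_subset_goodOpen hζ hz)
  exact ⟨_, _, _, isCutOn_openSub hj (goodOpen hζ), pull_openSubι_ne_zero hx hxh,
    isSection_pull_comp _ hh⟩

end ZipMorphism

end Comparison

section Inclusions

variable {k : Type u} [Field k] {ι : Type} [Fintype ι] {p : ℕ} {σ : Equiv.Perm ι} {X : KSch k}

namespace ZipMorphism

variable {ζ : ZipMorphism p σ X} {S : Finset ι}

lemma sectionCone_subset_of_isCut [DecidableEq ι] (hp : 2 ≤ p) (hζ : ζ.IsSmooth)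
    (hpc : ∀ i, PseudoComplete (ζ.stratumClosure {i})) (hne : (ζ.zeroSet ∅).Nonempty)
    (hS : ∀ i ∈ S, IsSignAdmissible σ S i) (hcomp : ζ.ComponentsMapOnto S) {J : KSch k}
    {j : J ⟶ ζ.I} (hj : IsCut ζ.entry S j.left) {R : KSch k}
    {rel : ∀ T : KSch k, zipGroup p σ (Fn T) → (T ⟶ R) → (T ⟶ R) → Prop} {g : R ⟶ GSch k ι}
    (hg : IsCompatible rel g) (hgS : ∀ i ∉ S, mat g i 0 0 = 0) (hgne : (preStratum g S).Nonempty) :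
    sectionCone p σ J (ζ.actRel j) ⊆ sectionCone p σ R rel := by
  rintro lam ⟨m, hm, f, hf, hsec⟩
  obtain ⟨c, hc⟩ := exists_isCoord hp σ S lam
  refine hg.mem_sectionCone hgS hgne hc fun i hi => ?_
  have hnonneg : CoordNonneg p σ (ζ.cutWeights (goodOpen hζ)) S i :=
    (hS i hi).coordNonneg hp (fun S _ => exists_sub_mem_cutWeights hζ S)
      fun j => coordNonneg_cutWeights_singleton hζ (hpc j)
  have hmc := hnonneg _ (mem_cutWeights_of_isCut hζ hne hcomp hj hsec hf) _ (hc.nsmul m)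
  exact nonneg_of_mul_nonneg_right hmc (by exact_mod_cast hm)

lemma stratumCone_subset_stackStratumCone [DecidableEq ι] (hp : 2 ≤ p) (hζ : ζ.IsSmooth)
    (hpc : ∀ i, PseudoComplete (ζ.stratumClosure {i})) (hne : (ζ.zeroSet ∅).Nonempty)
    (hS : ∀ i ∈ S, IsSignAdmissible σ S i) (hcomp : ζ.ComponentsMapOnto S) :
    ζ.stratumCone S ⊆ stackStratumCone k p σ S := by
  refine sectionCone_subset_of_isCut hp hζ hpc hne hS hcomp (hζ.isCut_torsorOverι S)
    (g := redClosureι (GSch k ι) (groupStratum k S)) (fun _ _ _ _ h => h)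
    (fun i hi => mat_redClosureι_eq_zero S hi) ?_
  obtain ⟨g, hg⟩ := groupStratum_nonempty (k := k) S
  obtain ⟨y, rfl⟩ : g ∈ Set.range (redClosureι (GSch k ι) (groupStratum k S)).left := by
    rw [range_redClosureι]
    exact subset_closure hg
  exact ⟨y, (mem_preStratum_iff _ S y).2 hg⟩

lemma cone_eq_sectionCone_actRel : ζ.cone = sectionCone p σ ζ.I (ζ.actRel (𝟙 ζ.I)) := by
  have hrel : ζ.actRel (𝟙 ζ.I) = fun _ e z z' => ζ.act e z = z' := by
    ext T e z z'
    simp only [actRel, Category.comp_id]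
  rw [hrel]
  rfl

lemma IsSmooth.closure_stratum_univ (hζ : ζ.IsSmooth) :
    closure (ζ.stratum Finset.univ) = Set.univ := by
  refine Set.eq_univ_of_forall fun x => ?_
  obtain ⟨z, rfl⟩ := ζ.surjective.surj x
  rw [← Set.mem_preimage, hζ.preimage_closure_stratum]
  exact fun i hi => absurd (Finset.mem_univ i) hi

lemma IsSmooth.componentsMapOnto_univ (hζ : ζ.IsSmooth)
    (hsurj : ∀ x : X.left, ζ.MapsOnto (connectedComponent x) Set.univ) :
    ζ.ComponentsMapOnto Finset.univ := fun x _ => by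
  rw [hζ.closure_stratum_univ, connectedComponentIn_univ]
  exact (hsurj x).mono subset_rfl (Set.subset_univ _)

lemma cone_subset_stackCone (hp : 2 ≤ p) (hζ : ζ.IsSmooth)
    (hpc : ∀ i, PseudoComplete (ζ.stratumClosure {i})) (hne : (ζ.zeroSet ∅).Nonempty)
    (hcomp : ζ.ComponentsMapOnto Finset.univ) : ζ.cone ⊆ stackCone k p σ := by
  classical
  rw [cone_eq_sectionCone_actRel]
  have hcut : IsCut (W := ζ.I.left) ζ.entry (Finset.univ : Finset ι) (𝟙 ζ.I.left) := by
    rw [Finset.coe_univ]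
    exact isCut_univ _
  exact sectionCone_subset_of_isCut hp hζ hpc hne (fun i _ => isSignAdmissible_univ σ i) hcomp
    (j := 𝟙 ζ.I) hcut (g := 𝟙 (GSch k ι))
    (fun T e z z' h => by rwa [Category.comp_id, Category.comp_id])
    (fun i hi => absurd (Finset.mem_univ i) hi) (groupStratum_nonempty Finset.univ)

lemma stackStratumCone_subset_stratumCone (hζ : ζ.IsSmooth)
    (honto : ζ.MapsOnto (closure (ζ.stratum S)) (closure (groupStratum k S))) :
    stackStratumCone k p σ S ⊆ ζ.stratumCone S := by
  let r := redClosureι (GSch k ι) (groupStratum k S)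
  have : IsClosedImmersion r.left := isClosedImmersion_redClosureι _ _
  have := isReduced_redClosure (GSch k ι) (groupStratum k S)
  obtain ⟨φ, hφ⟩ := hζ.exists_comp_redClosureι_eq S
  refine sectionCone_subset_of_surjective φ (fun T e z z' h => ?_) fun y => ?_
  · have hcompat := isCompatible_actRel (ζ.torsorOverι S) T e z z' h
    rw [← hφ] at hcompat
    simpa only [Category.assoc] using hcompat
  · obtain ⟨z, hz, hzy⟩ := honto (r.left y) (range_redClosureι _ (groupStratum k S) ▸ ⟨y, rfl⟩)
    rw [← Set.mem_preimage, hζ.preimage_closure_stratum, ← hζ.range_torsorOverι] at hz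
    obtain ⟨x, rfl⟩ := hz
    refine ⟨x, r.left.injective ?_⟩
    rw [← hzy]
    exact congr(($hφ).left x)

lemma stackCone_subset_cone (honto : ζ.MapsOnto Set.univ Set.univ) :
    stackCone k p σ ⊆ ζ.cone := by
  have := isReduced_GSch (k := k) (ι := ι)
  refine sectionCone_subset_of_surjective ζ.q (fun T e z z' h => ?_) fun y => ?_
  · subst h
    exact ζ.act_q e z
  · obtain ⟨z, -, hz⟩ := honto y (Set.mem_univ y)
    exact ⟨z, hz⟩

end ZipMorphism

end Inclusions

end ZipCone

end

theorem theorem4_general (p : ℕ) (hp : 2 ≤ p) {k : Type u} [Field k] {ι : Type} [Fintype ι]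
    [DecidableEq ι] (σ : Equiv.Perm ι) (X : ZipCone.KSch k) [Nonempty X.left]
    (ζ : ZipCone.ZipMorphism p σ X) (hsmooth : ζ.IsSmooth)
    (hsurj : ∀ x : X.left, ζ.MapsOnto (connectedComponent x) Set.univ)
    (hpc : ∀ i, ZipCone.PseudoComplete (ζ.stratumClosure {i})) :
    (∀ S : Finset ι, (∀ j ∈ S, ZipCone.IsSignAdmissible σ S j) → ζ.ComponentsMapOnto S →
      ζ.stratumCone S = ZipCone.stackStratumCone k p σ S) ∧
    ζ.cone = ZipCone.stackCone k p σ := by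
  obtain ⟨x₀⟩ := ‹Nonempty X.left›
  obtain ⟨z₀, hz₀⟩ := (hsurj x₀).zeroSet_empty_nonempty
  refine ⟨fun S hS hcomp => Set.Subset.antisymm ?_ ?_, Set.Subset.antisymm ?_ ?_⟩
  · exact ZipCone.ZipMorphism.stratumCone_subset_stackStratumCone hp hsmooth hpc ⟨z₀, hz₀⟩ hS hcomp
  · have hmem : ζ.π.left z₀ ∈ closure (ζ.stratum S) := by
      rw [← Set.mem_preimage, hsmooth.preimage_closure_stratum]
      exact ZipCone.ZipMorphism.zeroSet_mono (Finset.empty_subset S) hz₀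
    exact ZipCone.ZipMorphism.stackStratumCone_subset_stratumCone hsmooth
      ((hcomp _ hmem).mono (connectedComponentIn_subset _ _) subset_rfl)
  · exact ZipCone.ZipMorphism.cone_subset_stackCone hp hsmooth hpc ⟨z₀, hz₀⟩
      (hsmooth.componentsMapOnto_univ hsurj)
  · exact ZipCone.ZipMorphism.stackCone_subset_cone
      ((hsurj x₀).mono (Set.subset_univ _) subset_rfl)

theorem theorem4 (p : ℕ) [Fact p.Prime] {k : Type u} [Field k] [Algebra (ZMod p) k]
    [IsAlgClosure (ZMod p) k] {r : ℕ} (d : Fin r → ℕ) (hd : ∀ m, 1 ≤ d m)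
    (X : ZipCone.KSch k) [Nonempty X.left] (ζ : ZipCone.ZipMorphism p (ZipCone.frobPerm d) X)
    (hsmooth : ζ.IsSmooth)
    (hsurj : ∀ x : X.left, ζ.MapsOnto (connectedComponent x) Set.univ)
    (hpc : ∀ S : Finset (ZipCone.Idx d), ZipCone.PseudoComplete (ζ.stratumClosure S)) :
    (∀ S : Finset (ZipCone.Idx d), ZipCone.IsGAdmissible S →
      (∀ x ∈ closure (ζ.stratum S),
        ζ.MapsOnto (connectedComponentIn (closure (ζ.stratum S)) x)
          (closure (ZipCone.groupStratum k S))) →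
      ζ.stratumCone S = ZipCone.stackStratumCone k p (ZipCone.frobPerm d) S) ∧
    ζ.cone = ZipCone.stackCone k p (ZipCone.frobPerm d) ∧
    ((∀ m, d m = 1) → ∀ S : Finset (ZipCone.Idx d), ZipCone.IsGAdmissible S) := by
  have ⟨hstrata, hcone⟩ := theorem4_general p (Fact.out : p.Prime).two_le (ZipCone.frobPerm d) X ζ
    hsmooth hsurj fun i => hpc {i}
  exact ⟨fun S hS => hstrata S fun j hj => (hS j hj).isSignAdmissible, hcone,
    ZipCone.isGAdmissible_of_forall_eq_one⟩
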